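/- Let $N\ge 1$, $p>1$ and $\gamma>0$. For $y\in\mathbb R^N$, $s\in\mathbb R$ and $\rho,\tau>0$ let $K_\rho(y)\subset\mathbb R^N$ be the cube of edge $2\rho$ centred at $y$ (with edges parallel to the axes) and let $(y,s)+Q_{\rho,\tau}=K_\rho(y)\times(s-\tau,s]$. Let $D$ denote the weak gradient in the space variable $x\in\mathbb R^N$. Let $E\subset\mathbb R^N\times\mathbb R$ be open and let $\mathcal A=\mathcal A(R,T,\rho,\tau)>0$ be defined for $0<\rho<R$, $0<\tau<T$. Say that a measurable function $v:E\to\mathbb R$ belongs to the class $\mathfrak A_p^+$ in $E$ with $\mathcal A$ if, for every $(y,s)+Q_{R,T}$ whose closure is a compact subset of $E$, \[ v\in L^\infty\big(s-T,s;L^p(K_R(y))\big)\cap L^p\big(s-T,s;W^{1,p}(K_R(y))\big), \] and for all $0<\rho<R$, $0<\tau<T$ and $k\in\mathbb R$, \[ \operatorname*{ess\,sup}_{s-\tau<t<s}\int_{K_\rho(y)}(v-k)_+^p(\cdot,t)\,dx+\iint_{(y,s)+Q_{\rho,\tau}}|D(v-k)_+|^p\,dx\,dt \le\Big[\frac{\mathcal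 A(R,T,\rho,\tau)}{(R-\rho)^p}+\frac{\mathcal A(R,T,\rho,\tau)}{T-\tau}\Big]\iint_{(y,s)+Q_{R,T}}(v-k)_+^p\,dx\,dt . \] When $\mathcal A\equiv\gamma$ is constant, this is the parabolic De Giorgi class $\mathfrak A_p^+(E,\gamma)$. Call $\mathcal A$ homogeneous if, under the relations $\rho=\sigma_1R$, $\tau=\sigma_2T$, $T=R^p$ with $\sigma_1,\sigma_2\in(0,1)$, it becomes a quantity of $\sigma_1$ and $\sigma_2$ only, i.e. $\mathcal A(R,R^p,\sigma_1R,\sigma_2R^p)=f(\sigma_1,\sigma_2)$ for some function $f$ and all $R>0$. Then there is a positive homogeneous quantity $\mathcal A$, determined only by $N$, $p$ and $\gamma$, such that the following holds for every open $E\subset\mathbb R^N\times\mathbb R$, every convex and non-decreasing $\varphi:\mathbb R\to\mathbb R$ and every $u\in\mathfrak A_p^+(E,\gamma)$: the function $\varphi(u)$ belongs to the (generalized) class $\mathfrak A_p^+$ in $E$ with this $\mathcal A$. -/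

import Mathlib

open MeasureTheory
open scoped ContDiff

namespace ParabolicDeGiorgi

/-- The (open) cube `K_ρ(y)` of edge `2ρ` centred at `y ∈ ℝ^N`. -/
def cube {N : ℕ} (y : EuclideanSpace ℝ (Fin N)) (ρ : ℝ) : Set (EuclideanSpace ℝ (Fin N)) :=
  {x | ∀ i, |x i - y i| < ρ}

/-- The cylinder `(y,s) + Q_{ρ,τ} = K_ρ(y) × (s-τ, s]`. -/
def parCylinder {N : ℕ} (y : EuclideanSpace ℝ (Fin N)) (s ρ τ : ℝ) :
    Set (EuclideanSpace ℝ (Fin N) × ℝ) :=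
  cube y ρ ×ˢ Set.Ioc (s - τ) s

/-- Compact containment `A ⋐ E`. -/
def CompactlyContained {X : Type*} [TopologicalSpace X] (A E : Set X) : Prop :=
  IsCompact (closure A) ∧ closure A ⊆ E

/-- `G` is the weak (distributional) gradient of `v` in the open set `Ω ⊆ ℝ^N`. -/
def HasWeakGradient {N : ℕ} (Ω : Set (EuclideanSpace ℝ (Fin N)))
    (v : EuclideanSpace ℝ (Fin N) → ℝ)
    (G : EuclideanSpace ℝ (Fin N) → EuclideanSpace ℝ (Fin N)) : Prop :=
  LocallyIntegrableOn v Ω ∧ LocallyIntegrableOn G Ω ∧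
    ∀ η : EuclideanSpace ℝ (Fin N) → ℝ, ContDiff ℝ ∞ η → HasCompactSupport η → tsupport η ⊆ Ω →
      ∀ i : Fin N,
        ∫ x in Ω, v x * fderiv ℝ η x (EuclideanSpace.single i 1) = - ∫ x in Ω, G x i * η x

/-- `G` is the weak gradient `Dv` of `v = v(x,t)` with respect to the space variable `x` in the
cylinder `(y,s) + Q_{R,T}`: it is jointly measurable, and for a.e. `t ∈ (s-T,s)` the slice
`G(·,t)` is the weak gradient of `v(·,t)` in `K_R(y)`. -/
def HasSpatialGradient {N : ℕ} (y : EuclideanSpace ℝ (Fin N)) (s R T : ℝ)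
    (v : EuclideanSpace ℝ (Fin N) × ℝ → ℝ)
    (G : EuclideanSpace ℝ (Fin N) × ℝ → EuclideanSpace ℝ (Fin N)) : Prop :=
  AEStronglyMeasurable G (volume.restrict (parCylinder y s R T)) ∧
    ∀ᵐ t ∂(volume.restrict (Set.Ioo (s - T) s)),
      HasWeakGradient (cube y R) (fun x => v (x, t)) (fun x => G (x, t))

/-- `u ∈ L^∞(s-T, s; L^p(K_R(y)))`. -/
def MemLinftyLp {N : ℕ} (p : ℝ) (y : EuclideanSpace ℝ (Fin N)) (s R T : ℝ)
    (u : EuclideanSpace ℝ (Fin N) × ℝ → ℝ) : Prop :=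
  AEStronglyMeasurable u (volume.restrict (parCylinder y s R T)) ∧
    essSup (fun t => eLpNorm (fun x => u (x, t)) (ENNReal.ofReal p) (volume.restrict (cube y R)))
      (volume.restrict (Set.Ioo (s - T) s)) < ⊤

/-- `u ∈ L^p(s-T, s; W^{1,p}(K_R(y)))`: both `u` and its spatial weak gradient are in `L^p` of the
cylinder. -/
def MemLpW1p {N : ℕ} (p : ℝ) (y : EuclideanSpace ℝ (Fin N)) (s R T : ℝ)
    (u : EuclideanSpace ℝ (Fin N) × ℝ → ℝ) : Prop :=
  MemLp u (ENNReal.ofReal p) (volume.restrict (parCylinder y s R T)) ∧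
    ∃ G : EuclideanSpace ℝ (Fin N) × ℝ → EuclideanSpace ℝ (Fin N),
      HasSpatialGradient y s R T u G ∧
        MemLp G (ENNReal.ofReal p) (volume.restrict (parCylinder y s R T))

/-- The standing assumption on `u`: it is measurable in `E` and lies in
`L^∞(s-T,s;L^p(K_R(y))) ∩ L^p(s-T,s;W^{1,p}(K_R(y)))` for every `(y,s) + Q_{R,T} ⋐ E`. -/
def ParabolicSpace {N : ℕ} (E : Set (EuclideanSpace ℝ (Fin N) × ℝ)) (p : ℝ)
    (u : EuclideanSpace ℝ (Fin N) × ℝ → ℝ) : Prop :=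
  AEMeasurable u (volume.restrict E) ∧
    ∀ (y : EuclideanSpace ℝ (Fin N)) (s R T : ℝ), 0 < R → 0 < T →
      CompactlyContained (parCylinder y s R T) E →
        MemLinftyLp p y s R T u ∧ MemLpW1p p y s R T u

/-- The truncation `(u-k)_+`. -/
def truncPlus {X : Type*} (u : X → ℝ) (k : ℝ) : X → ℝ := fun z => max (u z - k) 0

/-- The energy inequality
`ess sup_{s-τ<t<s} ∫_{K_ρ(y)} (u-k)_+^p(·,t) dx + ∬_{(y,s)+Q_{ρ,τ}} |D(u-k)_+|^p dx dt
  ≤ [a/(R-ρ)^p + a/(T-τ)] ∬_{(y,s)+Q_{R,T}} (u-k)_+^p dx dt`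
with constant `a`. The weak spatial gradient of `(u-k)_+` is a.e. unique, so that it does not
matter which representative is taken. -/
def EnergyIneqPlus {N : ℕ} (p a : ℝ) (y : EuclideanSpace ℝ (Fin N)) (s R T ρ τ k : ℝ)
    (u : EuclideanSpace ℝ (Fin N) × ℝ → ℝ) : Prop :=
  ∃ G : EuclideanSpace ℝ (Fin N) × ℝ → EuclideanSpace ℝ (Fin N),
    HasSpatialGradient y s R T (truncPlus u k) G ∧
      essSup (fun t => ∫⁻ x in cube y ρ, ENNReal.ofReal (truncPlus u k (x, t) ^ p))
          (volume.restrict (Set.Ioo (s - τ) s))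
        + ∫⁻ z in parCylinder y s ρ τ, ENNReal.ofReal (‖G z‖ ^ p)
      ≤ ENNReal.ofReal (a / (R - ρ) ^ p + a / (T - τ))
        * ∫⁻ z in parCylinder y s R T, ENNReal.ofReal (truncPlus u k z ^ p)

/-- The class `𝔄_p^+` in `E` with the constant replaced by a function `A(R,T,ρ,τ)`. -/
def GeneralizedClassAPlus {N : ℕ} (E : Set (EuclideanSpace ℝ (Fin N) × ℝ)) (p : ℝ)
    (A : ℝ → ℝ → ℝ → ℝ → ℝ) (u : EuclideanSpace ℝ (Fin N) × ℝ → ℝ) : Prop :=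
  ParabolicSpace E p u ∧
    ∀ (y : EuclideanSpace ℝ (Fin N)) (s R T ρ τ k : ℝ), 0 < ρ → ρ < R → 0 < τ → τ < T →
      CompactlyContained (parCylinder y s R T) E →
        EnergyIneqPlus p (A R T ρ τ) y s R T ρ τ k u

/-- The parabolic De Giorgi class `𝔄_p^+(E,γ)`. -/
def ClassAPlus {N : ℕ} (E : Set (EuclideanSpace ℝ (Fin N) × ℝ)) (p γ : ℝ)
    (u : EuclideanSpace ℝ (Fin N) × ℝ → ℝ) : Prop :=
  GeneralizedClassAPlus E p (fun _ _ _ _ => γ) u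

/-- `A(R,T,ρ,τ)` is a positive, homogeneous quantity: under the relations `ρ = σ₁R`, `τ = σ₂T`,
`T = R^p` it becomes a quantity of `σ₁` and `σ₂` only. -/
def IsHomogeneousQuantity (p : ℝ) (A : ℝ → ℝ → ℝ → ℝ → ℝ) : Prop :=
  (∀ R T ρ τ : ℝ, 0 < ρ → ρ < R → 0 < τ → τ < T → 0 < A R T ρ τ) ∧
    ∃ f : ℝ → ℝ → ℝ, ∀ R T σ₁ σ₂ : ℝ, 0 < R → T = R ^ p →
      0 < σ₁ → σ₁ < 1 → 0 < σ₂ → σ₂ < 1 → A R T (σ₁ * R) (σ₂ * T) = f σ₁ σ₂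

end ParabolicDeGiorgi

/-! Fix `k` and put ψ = (φ - k)_+, again convex, non-decreasing and nonnegative. The energy
inequality for ψ(u) is a superposition of the energy inequalities for (u - κ_j)_+ over finitely many
levels κ_j. Each half of the inequality needs its own pointwise comparison between ψ and a
combination of truncations.

Gradient half. Here |Dψ(u)|^p = ψ'(u)^p |Du|^p, with ψ' the left derivative. Let κ_j be the point
beyond which ψ' exceeds δ 2^j. Below a bound M of u, ψ'^p is at most δ^p + 2^p Σ (δ 2^j)^p 1_{s >
κ_j}. Conversely the lines of slope δ 2^j starting at κ_j lie under ψ, and since their slopes are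
geometric their sum is at most 2ψ; superadditivity of t^p then gives Σ (δ 2^j)^p (s - κ_j)_+^p ≤ 2^p
ψ^p (`exists_slope_ladder`). Sum the inequalities for u at the levels κ_j and let δ tend to 0.

Supremum half. Let κ_j be a point where ψ = ε 2^j, and m_j the secant slope over [κ_j, κ_{j+1}]. The
combination F = Σ (m_j^p - m_{j-1}^p)(s - κ_j)_+^p, with first coefficient m_0^p, satisfies ψ^p ≤
(2ε)^p + 4^p F below M, and F ≤ (p + 1) ψ^p (`exists_value_ladder`). Letting ε decrease to inf ψ
leaves the term (2 inf ψ)^p |K_ρ|. It is absorbed by the right-hand side, because ψ(u) ≥ inf ψ on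
the whole cylinder and the coefficient contains γ/(T - τ).

Both halves, the chain rule and the integrability of φ(u) require u to be bounded above on the
cylinder, since φ may grow arbitrarily fast. This is a De Giorgi iteration
(`ClassAPlus.exists_ae_le`) based on a Faber–Krahn inequality obtained by averaging translation
estimates (`HasWeakGradient.lintegral_rpow_le`). None of the constants in the two halves depends on
the radii, so the homogeneous quantity can be taken constant. -/

namespace ParabolicDeGiorgi

open Filter Topology Set
open scoped Convolution ENNReal NNReal

/-! ### Mollification: almost everywhere and L¹ convergence, commutation with the weak gradient. -/

section Mollification

variable {N : ℕ} {F : Type*} [NormedAddCommGroup F] [NormedSpace ℝ F]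

/-- A standard mollifier at scale `1 / (n + 1)`. -/
noncomputable def stdBump (N n : ℕ) : ContDiffBump (0 : EuclideanSpace ℝ (Fin N)) :=
  ⟨1 / (n + 1) / 2, 1 / (n + 1), by positivity, half_lt_self (by positivity)⟩

/-- The mollification of `f` at scale `1 / (n + 1)`. -/
noncomputable def mollify (n : ℕ) (f : EuclideanSpace ℝ (Fin N) → F) :
    EuclideanSpace ℝ (Fin N) → F :=
  (stdBump N n).normed volume ⋆[ContinuousLinearMap.lsmul ℝ ℝ, volume] f

theorem stdBump_rOut_tendsto (N : ℕ) : Tendsto (fun n => (stdBump N n).rOut) atTop (𝓝 0) :=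
  tendsto_one_div_add_atTop_nhds_zero_nat

theorem mollify_apply (n : ℕ) (f : EuclideanSpace ℝ (Fin N) → F) (x) :
    mollify n f x = ∫ z, (stdBump N n).normed volume z • f (x - z) := rfl

theorem mollify_ae_tendsto [CompleteSpace F] {f : EuclideanSpace ℝ (Fin N) → F}
    (hf : LocallyIntegrable f) :
    ∀ᵐ x, Tendsto (fun n => mollify n f x) atTop (𝓝 (f x)) := by
  -- The outer radius is twice the inner one; this bounded ratio is what Lebesgue differentiation
  -- needs.
  refine ContDiffBump.ae_convolution_tendsto_right_of_locallyIntegrable (K := 2)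
    (stdBump_rOut_tendsto N) (Eventually.of_forall fun n => ?_) hf
  simp only [stdBump]
  linarith

theorem mollify_integrable {f : EuclideanSpace ℝ (Fin N) → F} (hf : Integrable f) (n : ℕ) :
    Integrable (mollify n f) :=
  Integrable.integrable_convolution _ (stdBump N n).integrable_normed hf

theorem mollify_contDiff [CompleteSpace F] {f : EuclideanSpace ℝ (Fin N) → F}
    (hf : LocallyIntegrable f) (n : ℕ) : ContDiff ℝ ∞ (mollify n f) :=
  (stdBump N n).hasCompactSupport_normed.contDiff_convolution_left _
    (stdBump N n).contDiff_normed hf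

theorem integral_mollify [CompleteSpace F] {f : EuclideanSpace ℝ (Fin N) → F}
    (hf : Integrable f) (n : ℕ) : ∫ x, mollify n f x = ∫ x, f x := by
  have := integral_convolution (L := ContinuousLinearMap.lsmul ℝ ℝ) (μ := volume) (ν := volume)
    ((stdBump N n).integrable_normed (μ := volume)) hf
  rw [mollify, this, ContDiffBump.integral_normed]
  simp

theorem norm_mollify_le (f : EuclideanSpace ℝ (Fin N) → F) (n : ℕ) (x) :
    ‖mollify n f x‖ ≤ mollify n (fun z => ‖f z‖) x := by
  rw [mollify_apply, mollify_apply]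
  refine (norm_integral_le_integral_norm _).trans (le_of_eq ?_)
  congr 1
  ext z
  rw [norm_smul, Real.norm_of_nonneg ((stdBump N n).nonneg_normed z), smul_eq_mul]

/-- Mollifications converge in `L¹`. -/
theorem tendsto_lintegral_mollify_sub [CompleteSpace F] {f : EuclideanSpace ℝ (Fin N) → F}
    (hf : Integrable f) :
    Tendsto (fun n => ∫⁻ x, ENNReal.ofReal ‖mollify n f x - f x‖) atTop (𝓝 0) := by
  set I := ∫⁻ x, ENNReal.ofReal ‖f x‖ with hI
  have hIfin : I ≠ ⊤ := by
    rw [hI, ← ofReal_integral_eq_lintegral_ofReal hf.norm (ae_of_all _ fun _ => norm_nonneg _)]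
    exact ENNReal.ofReal_ne_top
  set g : ℕ → EuclideanSpace ℝ (Fin N) → ℝ := fun n x => mollify n (fun z => ‖f z‖) x + ‖f x‖
  have hgint : ∀ n, Integrable (g n) := fun n => (mollify_integrable hf.norm n).add hf.norm
  have hle : ∀ n x, ‖mollify n f x - f x‖ ≤ g n x := fun n x =>
    (norm_sub_le _ _).trans (add_le_add_left (norm_mollify_le f n x) _)
  have hg0 : ∀ n x, 0 ≤ g n x := fun n x => (norm_nonneg _).trans (hle n x)
  have hgI : ∀ n, ∫⁻ x, ENNReal.ofReal (g n x) = I + I := by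
    intro n
    rw [← ofReal_integral_eq_lintegral_ofReal (hgint n) (ae_of_all _ (hg0 n)),
      integral_add (mollify_integrable hf.norm n) hf.norm, integral_mollify hf.norm,
      ENNReal.ofReal_add (integral_nonneg fun _ => norm_nonneg _)
        (integral_nonneg fun _ => norm_nonneg _),
      ofReal_integral_eq_lintegral_ofReal hf.norm (ae_of_all _ fun _ => norm_nonneg _)]
  have hmeas : ∀ n, AEMeasurable (fun x => ENNReal.ofReal ‖mollify n f x - f x‖) := fun n =>
    (((mollify_integrable hf n).sub hf).norm.aestronglyMeasurable.aemeasurable).ennreal_ofReal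
  have hfat : I + I ≤ liminf (fun n => (I + I) -
      ∫⁻ x, ENNReal.ofReal ‖mollify n f x - f x‖) atTop := by
    have h1 : ∀ n, (I + I) - ∫⁻ x, ENNReal.ofReal ‖mollify n f x - f x‖
        = ∫⁻ x, ENNReal.ofReal (g n x - ‖mollify n f x - f x‖) := by
      intro n
      rw [← hgI n, ← lintegral_sub' (hmeas n)]
      · refine lintegral_congr fun x => ?_
        rw [ENNReal.ofReal_sub _ (norm_nonneg _)]
      · refine ((lintegral_mono fun x => ENNReal.ofReal_le_ofReal (hle n x)).trans_lt ?_).ne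
        rw [hgI n]
        exact ENNReal.add_lt_top.2 ⟨hIfin.lt_top, hIfin.lt_top⟩
      · exact ae_of_all _ fun x => ENNReal.ofReal_le_ofReal (hle n x)
    simp_rw [h1]
    refine le_trans (le_of_eq ?_) (lintegral_liminf_le' fun n =>
      ((hgint n).sub ((mollify_integrable hf n).sub hf).norm).aestronglyMeasurable.aemeasurable.ennreal_ofReal)
    rw [hI, ← lintegral_add_left' hf.norm.aestronglyMeasurable.aemeasurable.ennreal_ofReal]
    refine lintegral_congr_ae ?_
    filter_upwards [mollify_ae_tendsto hf.locallyIntegrable,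
      mollify_ae_tendsto hf.norm.locallyIntegrable] with x hx hx'
    have : Tendsto (fun n => ENNReal.ofReal (g n x - ‖mollify n f x - f x‖)) atTop
        (𝓝 (ENNReal.ofReal (‖f x‖ + ‖f x‖ - ‖f x - f x‖))) :=
      ENNReal.tendsto_ofReal ((hx'.add_const _).sub (hx.sub_const _).norm)
    rw [this.liminf_eq, sub_self, norm_zero, sub_zero,
      ENNReal.ofReal_add (norm_nonneg _) (norm_nonneg _)]
  have hII : I + I ≠ ⊤ := ENNReal.add_ne_top.2 ⟨hIfin, hIfin⟩
  have hls : limsup (fun n => ∫⁻ x, ENNReal.ofReal ‖mollify n f x - f x‖) atTop ≤ 0 := by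
    rw [ENNReal.liminf_const_sub _ _ hII] at hfat
    by_contra hcon
    rw [not_le] at hcon
    -- The truncated subtraction detects a positive limsup only when `I + I` is nonzero; otherwise
    -- all the integrals vanish.
    rcases eq_or_ne (I + I) 0 with h0 | h0
    · have : ∀ n, ∫⁻ x, ENNReal.ofReal ‖mollify n f x - f x‖ = 0 := fun n =>
        le_antisymm ((lintegral_mono fun x => ENNReal.ofReal_le_ofReal (hle n x)).trans
          (by rw [hgI, h0])) bot_le
      simp_rw [this] at hcon
      simp at hcon
    · exact absurd hfat (not_le.2 (ENNReal.sub_lt_self hII h0 hcon.ne'))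
  exact tendsto_of_le_liminf_of_limsup_le bot_le hls

theorem contDiff_stdBump_normed (N n : ℕ) :
    ContDiff ℝ ∞ ((stdBump N n).normed (volume : Measure (EuclideanSpace ℝ (Fin N)))) :=
  (stdBump N n).contDiff_normed

/-- The derivative is put on the kernel, which will then serve as a test function in the definition
of the weak gradient. -/
theorem fderiv_mollify_apply {f : EuclideanSpace ℝ (Fin N) → ℝ} (hf : LocallyIntegrable f) (n : ℕ)
    (x e : EuclideanSpace ℝ (Fin N)) :
    fderiv ℝ (mollify n f) x e =
      ∫ z, f z * fderiv ℝ ((stdBump N n).normed volume) (x - z) e := by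
  have hfc := (stdBump N n).hasCompactSupport_normed (μ := volume)
  have hfd := contDiff_stdBump_normed N n
  have hD := (hfc.hasFDerivAt_convolution_left (ContinuousLinearMap.lsmul ℝ ℝ)
    (hfd.of_le (by simp)) hf x).fderiv
  have hconv := (hfc.fderiv ℝ).convolutionExists_left
      (ContinuousLinearMap.precompL (EuclideanSpace ℝ (Fin N))
      (ContinuousLinearMap.lsmul ℝ ℝ)) (hfd.continuous_fderiv (by simp)) hf x
  rw [mollify, hD, convolution_def, ContinuousLinearMap.integral_apply hconv,
    ← integral_sub_left_eq_self _ _ x]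
  refine integral_congr_ae (ae_of_all _ fun z => ?_)
  simp [ContinuousLinearMap.precompL_apply, mul_comm]

theorem mollify_apply_sub (n : ℕ) (f : EuclideanSpace ℝ (Fin N) → F) (x) :
    mollify n f x = ∫ z, (stdBump N n).normed volume (x - z) • f z := by
  rw [mollify_apply, ← integral_sub_left_eq_self _ _ x]
  simp

theorem stdBump_normed_sub_eq_zero {n : ℕ} {x z : EuclideanSpace ℝ (Fin N)}
    (hz : z ∉ Metric.closedBall x (1 / (n + 1))) :
    x - z ∉ tsupport ((stdBump N n).normed (volume : Measure (EuclideanSpace ℝ (Fin N)))) := by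
  rw [ContDiffBump.tsupport_normed_eq]
  intro hmem
  refine hz ?_
  rw [Metric.mem_closedBall, dist_zero_right] at hmem
  rw [Metric.mem_closedBall, dist_comm, dist_eq_norm]
  exact hmem

/-- The gradient of a mollification is the mollification of the weak gradient. -/
theorem HasWeakGradient.fderiv_mollify {Ω : Set (EuclideanSpace ℝ (Fin N))}
    {w : EuclideanSpace ℝ (Fin N) → ℝ} {G : EuclideanSpace ℝ (Fin N) → EuclideanSpace ℝ (Fin N)}
    (hw : HasWeakGradient Ω w G) (hΩ : MeasurableSet Ω) {K : Set (EuclideanSpace ℝ (Fin N))}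
    (hK : IsCompact K)
    (hKΩ : K ⊆ Ω) (n : ℕ) {x : EuclideanSpace ℝ (Fin N)}
    (hx : Metric.closedBall x (1 / (n + 1)) ⊆ K) (i : Fin N) :
    fderiv ℝ (mollify n (K.indicator w)) x (EuclideanSpace.single i 1)
      = mollify n (K.indicator G) x i := by
  have hwK : Integrable (K.indicator w) :=
    (integrable_indicator_iff hK.measurableSet).2 (hw.1.integrableOn_compact_subset hKΩ hK)
  have hGK : Integrable (K.indicator G) :=
    (integrable_indicator_iff hK.measurableSet).2 (hw.2.1.integrableOn_compact_subset hKΩ hK)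
  rw [fderiv_mollify_apply hwK.locallyIntegrable, mollify_apply_sub]
  have hfd := contDiff_stdBump_normed N n
  have hz0 : ∀ z ∉ K, x - z ∉ tsupport
      ((stdBump N n).normed (volume : Measure (EuclideanSpace ℝ (Fin N)))) := fun z hz =>
    stdBump_normed_sub_eq_zero fun h => hz (hx h)
  have hint : Integrable (fun z => (stdBump N n).normed volume (x - z) • K.indicator G z) := by
    simpa using ((stdBump N n).hasCompactSupport_normed.convolutionExists_left
      (ContinuousLinearMap.lsmul ℝ ℝ) hfd.continuous hGK.locallyIntegrable x).integrable_swap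
  generalize (stdBump N n).normed (volume : Measure (EuclideanSpace ℝ (Fin N))) = f at *
  have hcoord : (∫ z, f (x - z) • K.indicator G z) i = ∫ z, (f (x - z) • K.indicator G z) i :=
    ((EuclideanSpace.proj i : EuclideanSpace ℝ (Fin N) →L[ℝ] ℝ).integral_comp_comm hint).symm
  rw [hcoord]
  -- The reflected kernel is an admissible test function supported in `K`. The sign from
  -- differentiating x - z cancels the one from integration by parts.
  set η : EuclideanSpace ℝ (Fin N) → ℝ := fun z => f (x - z) with hη
  have hηd : ContDiff ℝ ∞ η := hfd.comp (contDiff_const.sub contDiff_id)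
  have hηsub : tsupport η ⊆ K := by
    refine closure_minimal (fun z hz => ?_) hK.isClosed
    by_contra h
    have h0 : f (x - z) = 0 := image_eq_zero_of_notMem_tsupport (hz0 z h)
    exact hz h0
  have hηc : HasCompactSupport η := hK.of_isClosed_subset (isClosed_tsupport _) hηsub
  have hηfd : ∀ z e, fderiv ℝ f (x - z) e = - fderiv ℝ η z e := by
    intro z e
    have h1 : HasFDerivAt f (fderiv ℝ f (x - z)) (x - z) :=
      (hfd.differentiable (by simp) _).hasFDerivAt
    have h2 : HasFDerivAt (fun z => x - z)
        (-(ContinuousLinearMap.id ℝ (EuclideanSpace ℝ (Fin N)))) z := by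
      simpa using (hasFDerivAt_id z).const_sub x
    have h3 : fderiv ℝ η z = _ := (h1.comp z h2).fderiv
    rw [h3]
    simp
  have key := hw.2.2 η hηd hηc (hηsub.trans hKΩ) i
  have hη0 : ∀ z ∉ K, η z = 0 := fun z hz => image_eq_zero_of_notMem_tsupport fun h => hz (hηsub h)
  have hη0' : ∀ z ∉ K, fderiv ℝ η z = 0 := fun z hz =>
    image_eq_zero_of_notMem_tsupport fun h => hz (hηsub (tsupport_fderiv_subset ℝ h))
  rw [← integral_indicator hΩ, ← integral_indicator hΩ] at key
  have e1 : ∀ z, Ω.indicator (fun z => w z * fderiv ℝ η z (EuclideanSpace.single i 1)) z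
      = K.indicator w z * fderiv ℝ η z (EuclideanSpace.single i 1) := by
    intro z
    by_cases hz : z ∈ K
    · simp [hz, hKΩ hz]
    · simp [hη0' z hz, Set.indicator]
  have e2 : ∀ z, Ω.indicator (fun z => G z i * η z) z = (f (x - z) • K.indicator G z) i := by
    intro z
    by_cases hz : z ∈ K
    · simp [hz, hKΩ hz, hη, mul_comm]
    · have := hη0 z hz
      simp [hz, this, Set.indicator]
  simp_rw [e1, e2] at key
  simp_rw [hηfd, mul_neg, integral_neg, key, neg_neg]

end Mollification

/-! ### Weak gradients: uniqueness and chain rules. -/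

section WeakGradient

variable {N : ℕ} {Ω : Set (EuclideanSpace ℝ (Fin N))}
  {w w' : EuclideanSpace ℝ (Fin N) → ℝ}
  {G G' : EuclideanSpace ℝ (Fin N) → EuclideanSpace ℝ (Fin N)}

theorem LocallyIntegrableOn.ae_eq_congr {F : Type*} [NormedAddCommGroup F]
    {f g : EuclideanSpace ℝ (Fin N) → F} (hΩ : IsOpen Ω) (hf : LocallyIntegrableOn f Ω)
    (h : f =ᵐ[volume.restrict Ω] g) : LocallyIntegrableOn g Ω := by
  rw [locallyIntegrableOn_iff hΩ.isLocallyClosed] at hf ⊢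
  intro k hk hkc
  exact (hf k hk hkc).congr (ae_restrict_of_ae_restrict_of_subset hk h)

theorem HasWeakGradient.congr (hw : HasWeakGradient Ω w G) (hΩ : IsOpen Ω)
    (h : w =ᵐ[volume.restrict Ω] w') (h' : G =ᵐ[volume.restrict Ω] G') :
    HasWeakGradient Ω w' G' := by
  refine ⟨LocallyIntegrableOn.ae_eq_congr hΩ hw.1 h, LocallyIntegrableOn.ae_eq_congr hΩ hw.2.1 h',
    fun η h1 h2 h3 i => ?_⟩
  have e1 : ∫ x in Ω, w' x * fderiv ℝ η x (EuclideanSpace.single i 1)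
      = ∫ x in Ω, w x * fderiv ℝ η x (EuclideanSpace.single i 1) :=
    integral_congr_ae (h.mono fun x hx => by simp only [hx])
  have e2 : ∫ x in Ω, G' x i * η x = ∫ x in Ω, G x i * η x :=
    integral_congr_ae (h'.mono fun x hx => by simp only [hx])
  rw [e1, e2]
  exact hw.2.2 η h1 h2 h3 i

/-- Weak gradients are almost everywhere unique. -/
theorem HasWeakGradient.ae_unique (hw : HasWeakGradient Ω w G) (hw' : HasWeakGradient Ω w G')
    (hΩ : IsOpen Ω) : G =ᵐ[volume.restrict Ω] G' := by
  have hcoord : ∀ i : Fin N, ∀ᵐ x, x ∈ Ω → G x i - G' x i = 0 := by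
    intro i
    have hGi : ∀ {H : EuclideanSpace ℝ (Fin N) → EuclideanSpace ℝ (Fin N)},
        LocallyIntegrableOn H Ω → LocallyIntegrableOn (fun x => H x i) Ω := by
      intro H hH
      rw [locallyIntegrableOn_iff hΩ.isLocallyClosed] at hH ⊢
      intro k hk hkc
      exact (EuclideanSpace.proj i : EuclideanSpace ℝ (Fin N) →L[ℝ] ℝ).integrable_comp (hH k hk hkc)
    have hint : ∀ {H : EuclideanSpace ℝ (Fin N) → EuclideanSpace ℝ (Fin N)},
        LocallyIntegrableOn H Ω → ∀ g : EuclideanSpace ℝ (Fin N) → ℝ, Continuous g →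
        HasCompactSupport g → tsupport g ⊆ Ω → Integrable (fun x => H x i * g x) := by
      intro H hH g hg hgc hgs
      have h1 : IntegrableOn (fun x => H x i * g x) (tsupport g) :=
        IntegrableOn.mul_continuousOn
          ((hGi hH).integrableOn_compact_subset hgs hgc) hg.continuousOn hgc
      exact (integrableOn_iff_integrable_of_support_subset fun x hx =>
        subset_tsupport _ (fun h => hx (by simp [h]))).1 h1
    refine hΩ.ae_eq_zero_of_integral_contDiff_smul_eq_zero
      ((hGi hw.2.1).sub (hGi hw'.2.1)) fun g hg hgc hgs => ?_
    have h1 := hw.2.2 g hg hgc hgs i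
    rw [hw'.2.2 g hg hgc hgs i, neg_inj] at h1
    have hset : ∀ (H : EuclideanSpace ℝ (Fin N) → EuclideanSpace ℝ (Fin N)),
        ∫ x in Ω, H x i * g x = ∫ x, H x i * g x := fun H =>
      setIntegral_eq_integral_of_forall_compl_eq_zero fun x hx => by
        rw [image_eq_zero_of_notMem_tsupport fun h => hx (hgs h), mul_zero]
    rw [hset, hset] at h1
    have : ∀ x, g x • (G x i - G' x i) = G x i * g x - G' x i * g x := fun x => by
      rw [smul_eq_mul]; ring
    simp_rw [this]
    rw [integral_sub (hint hw.2.1 g hg.continuous hgc hgs) (hint hw'.2.1 g hg.continuous hgc hgs),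
      h1, sub_self]
  rw [EventuallyEq, ae_restrict_iff' hΩ.measurableSet]
  filter_upwards [ae_all_iff.2 hcoord] with x hx hxΩ
  ext i
  exact sub_eq_zero.1 (hx i hxΩ)

theorem locallyIntegrableOn_comp (hΩ : IsOpen Ω) (hw : LocallyIntegrableOn w Ω) {f : ℝ → ℝ}
    {L : ℝ≥0} (hf : LipschitzWith L f) : LocallyIntegrableOn (fun x => f (w x)) Ω := by
  rw [locallyIntegrableOn_iff hΩ.isLocallyClosed] at hw ⊢
  intro k hk hkc
  have hwk := hw k hk hkc
  have hfin : IsFiniteMeasure (volume.restrict k) := ⟨by simpa using hkc.measure_lt_top⟩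
  refine Integrable.mono' (g := fun x => L * ‖w x‖ + ‖f 0‖)
    ((hwk.norm.const_mul _).add (integrable_const _))
    (hf.continuous.comp_aestronglyMeasurable hwk.aestronglyMeasurable) (ae_of_all _ fun x => ?_)
  have := hf.dist_le_mul (w x) 0
  rw [dist_eq_norm, dist_eq_norm, sub_zero] at this
  calc ‖f (w x)‖ = ‖(f (w x) - f 0) + f 0‖ := by rw [sub_add_cancel]
    _ ≤ _ := norm_add_le _ _
    _ ≤ _ := by gcongr

theorem locallyIntegrableOn_bdd_smul (hΩ : IsOpen Ω) (hw : LocallyIntegrableOn w Ω)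
    (hG : LocallyIntegrableOn G Ω) {d : ℝ → ℝ}
    {L : ℝ} (hd : Measurable d) (hL : ∀ s, |d s| ≤ L) :
    LocallyIntegrableOn (fun x => d (w x) • G x) Ω := by
  rw [locallyIntegrableOn_iff hΩ.isLocallyClosed] at hw hG ⊢
  intro k hk hkc
  refine (hG k hk hkc).bdd_smul L
    (hd.comp_aemeasurable (hw k hk hkc).aestronglyMeasurable.aemeasurable).aestronglyMeasurable
    (ae_of_all _ fun x => hL _)

/-- Chain rule for weak gradients, smooth outer function. -/
theorem HasWeakGradient.comp_contDiff (hw : HasWeakGradient Ω w G) (hΩ : IsOpen Ω) {f : ℝ → ℝ}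
    (hf : ContDiff ℝ 1 f) {L : ℝ≥0} (hL : ∀ s, |deriv f s| ≤ L) :
    HasWeakGradient Ω (fun x => f (w x)) (fun x => deriv f (w x) • G x) := by
  have hlip : LipschitzWith L f := lipschitzWith_of_nnnorm_deriv_le
    (hf.differentiable (by simp)) fun s => by
      rw [← NNReal.coe_le_coe]; simpa using hL s
  have hfdc : Continuous (deriv f) := hf.continuous_deriv (by simp)
  refine ⟨locallyIntegrableOn_comp hΩ hw.1 hlip,
    locallyIntegrableOn_bdd_smul hΩ hw.1 hw.2.1 hfdc.measurable hL, fun η hη hηc hηs i => ?_⟩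
  -- Cutting off to a compact neighbourhood of the support of η makes the data globally integrable.
  -- Mollification at scale below δ does not see the cut at points of the support.
  obtain ⟨δ, hδ, hδΩ⟩ := hηc.isCompact.exists_cthickening_subset_open hΩ hηs
  set K := Metric.cthickening δ (tsupport η) with hK
  have hKc : IsCompact K := hηc.isCompact.cthickening
  have hsK : tsupport η ⊆ K := Metric.self_subset_cthickening _
  have hwK : Integrable (K.indicator w) :=
    (integrable_indicator_iff hKc.measurableSet).2 (hw.1.integrableOn_compact_subset hδΩ hKc)
  have hGK : Integrable (K.indicator G) :=
    (integrable_indicator_iff hKc.measurableSet).2 (hw.2.1.integrableOn_compact_subset hδΩ hKc)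
  set W := K.indicator w with hW
  set H := K.indicator G with hH
  set e : EuclideanSpace ℝ (Fin N) := EuclideanSpace.single i 1
  obtain ⟨C, hC⟩ := hηc.exists_bound_of_continuous hη.continuous
  have hη1 : Continuous (fun x => fderiv ℝ η x e) :=
    (hη.continuous_fderiv (by simp)).clm_apply continuous_const
  have hη1c : HasCompactSupport (fun x => fderiv ℝ η x e) := hηc.fderiv_apply (𝕜 := ℝ) e
  obtain ⟨C', hC'⟩ := hη1c.exists_bound_of_continuous hη1
  have hsm : ∀ n, ContDiff ℝ ∞ (mollify n W) := fun n => mollify_contDiff hwK.locallyIntegrable n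
  have hae1 := mollify_ae_tendsto hwK.locallyIntegrable
  -- integrability of products with test functions
  have hint1 : ∀ v : EuclideanSpace ℝ (Fin N) → ℝ, Integrable v →
      Integrable (fun x => f (v x) * fderiv ℝ η x e) := by
    intro v hv
    have h1 : LocallyIntegrableOn (fun x => f (v x)) univ :=
      locallyIntegrableOn_comp isOpen_univ (hv.locallyIntegrable.locallyIntegrableOn _) hlip
    rw [locallyIntegrableOn_univ] at h1
    simpa [mul_comm] using h1.integrable_smul_left_of_hasCompactSupport hη1 hη1c
  have hint2 : ∀ (v : EuclideanSpace ℝ (Fin N) → ℝ) (V : EuclideanSpace ℝ (Fin N) →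
      EuclideanSpace ℝ (Fin N)), Integrable v → Integrable V →
      Integrable (fun x => deriv f (v x) * V x i * η x) := by
    intro v V hv hV
    have h1 : Integrable (fun x => deriv f (v x) • V x) := hV.bdd_smul L
      (hfdc.comp_aestronglyMeasurable hv.aestronglyMeasurable) (ae_of_all _ fun x => hL _)
    have h2 := (EuclideanSpace.proj i : EuclideanSpace ℝ (Fin N) →L[ℝ] ℝ).integrable_comp h1
    simpa using h2.mul_bdd (c := C) hη.continuous.aestronglyMeasurable (ae_of_all _ hC)
  -- the two limits
  have hlim1 : Tendsto (fun n => ∫ x, f (mollify n W x) * fderiv ℝ η x e) atTop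
      (𝓝 (∫ x, f (W x) * fderiv ℝ η x e)) := by
    refine tendsto_integral_of_L1 _ (hint1 _ hwK).aestronglyMeasurable
      (Eventually.of_forall fun n => hint1 _ (mollify_integrable hwK n)) ?_
    have hT := ENNReal.Tendsto.const_mul (a := ENNReal.ofReal (L * C'))
      (tendsto_lintegral_mollify_sub hwK) (Or.inr ENNReal.ofReal_ne_top)
    rw [mul_zero] at hT
    refine tendsto_of_tendsto_of_tendsto_of_le_of_le tendsto_const_nhds hT
      (fun _ => bot_le) fun n => ?_
    dsimp only
    rw [← lintegral_const_mul' _ _ ENNReal.ofReal_ne_top]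
    refine lintegral_mono fun x => ?_
    have hC0 : 0 ≤ C' := (norm_nonneg _).trans (hC' x)
    rw [← ENNReal.ofReal_mul (by positivity), ← ofReal_norm]
    refine ENNReal.ofReal_le_ofReal ?_
    rw [← sub_mul, norm_mul, mul_right_comm]
    gcongr
    · simpa [dist_eq_norm] using hlip.dist_le_mul (mollify n W x) (W x)
    · exact hC' x
  have hlim2 : Tendsto (fun n => ∫ x, deriv f (mollify n W x) * mollify n H x i * η x) atTop
      (𝓝 (∫ x, deriv f (W x) * H x i * η x)) := by
    refine tendsto_integral_of_L1 _ (hint2 _ _ hwK hGK).aestronglyMeasurable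
      (Eventually.of_forall fun n => hint2 _ _ (mollify_integrable hwK n)
        (mollify_integrable hGK n)) ?_
    have hT := ENNReal.Tendsto.const_mul (a := ENNReal.ofReal (L * C))
      (tendsto_lintegral_mollify_sub hGK) (Or.inr ENNReal.ofReal_ne_top)
    rw [mul_zero] at hT
    -- The factor f'(W_n) converges only pointwise, so it is handled by dominated convergence
    -- against the fixed integrable function H. The L¹ convergence of H_n, multiplied by the bounded
    -- f'(W_n), takes care of the remaining difference.
    have hT2 : Tendsto (fun n => ∫⁻ x, ENNReal.ofReal
        (|deriv f (mollify n W x) - deriv f (W x)| * (‖H x‖ * C))) atTop (𝓝 0) := by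
      have := tendsto_lintegral_of_dominated_convergence' (μ := volume)
        (F := fun n x => ENNReal.ofReal
          (|deriv f (mollify n W x) - deriv f (W x)| * (‖H x‖ * C)))
        (f := fun _ => 0) (fun x => ENNReal.ofReal (2 * L * (‖H x‖ * C))) ?_ ?_ ?_ ?_
      · simpa using this
      · intro n
        refine AEMeasurable.ennreal_ofReal (AEMeasurable.mul ?_ ?_)
        · exact ((hfdc.comp_aestronglyMeasurable
            (mollify_integrable hwK n).aestronglyMeasurable).sub
            (hfdc.comp_aestronglyMeasurable hwK.aestronglyMeasurable)).norm.aemeasurable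
        · exact (hGK.norm.mul_const C).aestronglyMeasurable.aemeasurable
      · intro n
        refine ae_of_all _ fun x => ENNReal.ofReal_le_ofReal ?_
        have hC0 : 0 ≤ C := (norm_nonneg _).trans (hC x)
        gcongr
        have h1 := hL (mollify n W x)
        have h2 := hL (W x)
        rw [abs_le] at *
        constructor <;> linarith
      · have hI : Integrable (fun x => 2 * L * (‖H x‖ * C)) := (hGK.norm.mul_const C).const_mul _
        refine (lintegral_ofReal_le_lintegral_enorm _).trans_lt hI.2 |>.ne
      · filter_upwards [hae1] with x hx
        have h1 := ((hfdc.tendsto (W x)).comp hx).sub_const (deriv f (W x))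
        have h2 := ENNReal.tendsto_ofReal (h1.abs.mul_const (‖H x‖ * C))
        simpa using h2
    have hT3 := hT.add hT2
    rw [zero_add] at hT3
    refine tendsto_of_tendsto_of_tendsto_of_le_of_le tendsto_const_nhds hT3
      (fun _ => bot_le) fun n => ?_
    dsimp only
    rw [← lintegral_const_mul' _ _ ENNReal.ofReal_ne_top, ← lintegral_add_left']
    swap
    · exact ((((mollify_integrable hGK n).sub hGK).norm.aestronglyMeasurable.aemeasurable).ennreal_ofReal).const_mul _
    refine lintegral_mono fun x => ?_
    have hC0 : 0 ≤ C := (norm_nonneg _).trans (hC x)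
    rw [← ENNReal.ofReal_mul (by positivity), ← ENNReal.ofReal_add (by positivity) (by positivity),
      ← ofReal_norm]
    refine ENNReal.ofReal_le_ofReal ?_
    have : deriv f (mollify n W x) * mollify n H x i * η x - deriv f (W x) * H x i * η x
      = deriv f (mollify n W x) * (mollify n H x - H x) i * η x
        + (deriv f (mollify n W x) - deriv f (W x)) * (H x i * η x) := by
      simp; ring
    rw [this]
    refine (norm_add_le _ _).trans (add_le_add ?_ ?_)
    · rw [norm_mul, norm_mul, mul_right_comm (L : ℝ)]
      gcongr
      · exact hL _
      · exact PiLp.norm_apply_le _ i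
      · exact hC x
    · rw [norm_mul, norm_mul, Real.norm_eq_abs]
      gcongr
      · exact PiLp.norm_apply_le _ i
      · exact hC x
  have heq : ∀ᶠ n : ℕ in atTop, ∫ x, f (mollify n W x) * fderiv ℝ η x e
      = - ∫ x, deriv f (mollify n W x) * mollify n H x i * η x := by
    have hsmall : ∀ᶠ n : ℕ in atTop, (1 : ℝ) / (n + 1) < δ :=
      (tendsto_one_div_add_atTop_nhds_zero_nat (𝕜 := ℝ)).eventually_lt_const hδ
    filter_upwards [hsmall] with n hn
    have hder : ∀ x, fderiv ℝ (fun x => f (mollify n W x)) x e * η x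
        = deriv f (mollify n W x) * mollify n H x i * η x := by
      intro x
      by_cases hx : x ∈ tsupport η
      · have hball : Metric.closedBall x (1 / (n + 1 : ℝ)) ⊆ K :=
          (Metric.closedBall_subset_cthickening hx _).trans
            (Metric.cthickening_mono hn.le _)
        rw [← hw.fderiv_mollify hΩ.measurableSet hKc hδΩ n hball i]
        have h1 : HasFDerivAt (mollify n W) _ x :=
          ((hsm n).differentiable (by simp) x).hasFDerivAt
        have h2 : HasDerivAt f (deriv f (mollify n W x)) (mollify n W x) :=
          (hf.differentiable (by simp) _).hasDerivAt
        have h3 : fderiv ℝ (fun x => f (mollify n W x)) x = _ := (h2.comp_hasFDerivAt x h1).fderiv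
        rw [h3]
        simp [e, W]
      · rw [image_eq_zero_of_notMem_tsupport hx, mul_zero, mul_zero]
    have hdiff : Differentiable ℝ (fun x => f (mollify n W x)) :=
      (hf.differentiable (by simp)).comp ((hsm n).differentiable (by simp))
    rw [integral_mul_fderiv_eq_neg_fderiv_mul_of_integrable]
    · simp_rw [hder]
    · simp_rw [hder]
      exact hint2 _ _ (mollify_integrable hwK n) (mollify_integrable hGK n)
    · exact hint1 _ (mollify_integrable hwK n)
    · exact (hdiff.continuous.mul hη.continuous).integrable_of_hasCompactSupport hηc.mul_left
    · exact fun x _ => hdiff x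
    · exact fun x _ => hη.differentiable (by simp) x
  have hfin := tendsto_nhds_unique (hlim1.congr' heq) hlim2.neg
  have e1 : ∫ x in Ω, f (w x) * fderiv ℝ η x e = ∫ x, f (W x) * fderiv ℝ η x e := by
    rw [← integral_indicator hΩ.measurableSet]
    congr 1
    ext x
    by_cases hx : x ∈ K
    · simp [hx, hδΩ hx, W]
    · have : fderiv ℝ η x = 0 :=
        image_eq_zero_of_notMem_tsupport fun h => hx (hsK (tsupport_fderiv_subset ℝ h))
      simp [Set.indicator, this]
  have e2 : ∫ x in Ω, (deriv f (w x) • G x) i * η x = ∫ x, deriv f (W x) * H x i * η x := by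
    rw [← integral_indicator hΩ.measurableSet]
    congr 1
    ext x
    by_cases hx : x ∈ K
    · simp [hx, hδΩ hx, W, H]
    · have : η x = 0 := image_eq_zero_of_notMem_tsupport fun h => hx (hsK h)
      simp [Set.indicator, this]
  rw [e1, e2, hfin]

/-- The backward average of `ψ` over an interval of length `h`. -/
noncomputable def backwardAverage (ψ : ℝ → ℝ) (h : ℝ) (s : ℝ) : ℝ :=
  h⁻¹ * ∫ r in (s - h)..s, ψ r

/-- Averaging backwards makes the derivative equal to the backward difference quotient, which
converges to the left derivative at every point and not merely almost everywhere. -/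
theorem hasDerivAt_backwardAverage {ψ : ℝ → ℝ} (hψ : Continuous ψ) (h s : ℝ) :
    HasDerivAt (backwardAverage ψ h) (h⁻¹ * (ψ s - ψ (s - h))) s := by
  have h1 : ∀ s, HasDerivAt (fun u => ∫ r in (0 : ℝ)..u, ψ r) (ψ s) s := fun s =>
    intervalIntegral.integral_hasDerivAt_right (hψ.intervalIntegrable _ _)
      hψ.stronglyMeasurable.stronglyMeasurableAtFilter hψ.continuousAt
  have h2 : HasDerivAt (fun s => s - h) 1 s := (hasDerivAt_id s).sub_const h
  have h3 := (((h1 s).sub ((h1 (s - h)).comp s h2))).const_mul h⁻¹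
  rw [mul_one] at h3
  refine h3.congr_of_eventuallyEq (Eventually.of_forall fun u => ?_)
  simp only [backwardAverage, Pi.sub_apply, Function.comp]
  rw [intervalIntegral.integral_interval_sub_left (hψ.intervalIntegrable _ _)
    (hψ.intervalIntegrable _ _)]

theorem deriv_backwardAverage {ψ : ℝ → ℝ} (hψ : Continuous ψ) (h : ℝ) :
    deriv (backwardAverage ψ h) = fun s => h⁻¹ * (ψ s - ψ (s - h)) :=
  funext fun s => (hasDerivAt_backwardAverage hψ h s).deriv

theorem contDiff_backwardAverage {ψ : ℝ → ℝ} (hψ : Continuous ψ) (h : ℝ) :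
    ContDiff ℝ 1 (backwardAverage ψ h) := by
  rw [contDiff_one_iff_deriv]
  refine ⟨fun s => (hasDerivAt_backwardAverage hψ h s).differentiableAt, ?_⟩
  rw [deriv_backwardAverage hψ]
  fun_prop

theorem abs_backwardAverage_sub_le {ψ : ℝ → ℝ} {L : ℝ≥0} (hψ : LipschitzWith L ψ) {h : ℝ}
    (hh : 0 < h) (s : ℝ) : |backwardAverage ψ h s - ψ s| ≤ L * h := by
  have h1 : backwardAverage ψ h s - ψ s = h⁻¹ * ∫ r in (s - h)..s, (ψ r - ψ s) := by
    rw [intervalIntegral.integral_sub (hψ.continuous.intervalIntegrable _ _)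
      (by simp), intervalIntegral.integral_const]
    simp only [backwardAverage, sub_sub_cancel, smul_eq_mul]
    field_simp
  have h2 : ‖∫ r in (s - h)..s, (ψ r - ψ s)‖ ≤ (L * h) * |s - (s - h)| := by
    refine intervalIntegral.norm_integral_le_of_norm_le_const fun r hr => ?_
    rw [Set.uIoc_of_le (by linarith)] at hr
    rw [← dist_eq_norm]
    refine (hψ.dist_le_mul r s).trans ?_
    gcongr
    rw [Real.dist_eq, abs_le]
    constructor <;> linarith [hr.1, hr.2]
  rw [h1, abs_mul, abs_of_pos (inv_pos.2 hh)]
  rw [Real.norm_eq_abs, sub_sub_cancel, abs_of_pos hh] at h2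
  calc h⁻¹ * _ ≤ h⁻¹ * (L * h * h) := by gcongr
    _ = L * h := by field_simp

/-- `d` is the left derivative of `ψ` at every point, along the steps `1 / (n + 1)`. -/
def HasLeftSlope (ψ d : ℝ → ℝ) : Prop :=
  ∀ s, Tendsto (fun n : ℕ => ((n : ℝ) + 1) * (ψ s - ψ (s - 1 / (n + 1)))) atTop (𝓝 (d s))

theorem HasLeftSlope.measurable {ψ d : ℝ → ℝ} (h : HasLeftSlope ψ d) (hψ : Measurable ψ) :
    Measurable d :=
  measurable_of_tendsto_metrizable (fun n => by fun_prop) (tendsto_pi_nhds.2 h)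

theorem abs_slope_le {ψ : ℝ → ℝ} {L : ℝ≥0} (hψ : LipschitzWith L ψ) (n : ℕ) (s : ℝ) :
    |((n : ℝ) + 1) * (ψ s - ψ (s - 1 / (n + 1)))| ≤ L := by
  have h1 := hψ.dist_le_mul s (s - 1 / (n + 1))
  have h0 : (0 : ℝ) < n + 1 := by positivity
  rw [Real.dist_eq, Real.dist_eq, sub_sub_cancel, abs_of_pos (a := 1 / ((n : ℝ) + 1))
    (by positivity)] at h1
  rw [abs_mul, abs_of_pos h0]
  calc _ ≤ ((n : ℝ) + 1) * (L * (1 / (n + 1))) := by gcongr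
    _ = L := by field_simp

theorem HasLeftSlope.abs_le {ψ d : ℝ → ℝ} (h : HasLeftSlope ψ d) {L : ℝ≥0}
    (hψ : LipschitzWith L ψ) (s : ℝ) : |d s| ≤ L :=
  le_of_tendsto' (h s).abs fun n => abs_slope_le hψ n s

/-- Chain rule for weak gradients, Lipschitz outer function with left derivatives. -/
theorem HasWeakGradient.comp_lipschitz (hw : HasWeakGradient Ω w G) (hΩ : IsOpen Ω) {ψ d : ℝ → ℝ}
    {L : ℝ≥0} (hψ : LipschitzWith L ψ) (hd : HasLeftSlope ψ d) :
    HasWeakGradient Ω (fun x => ψ (w x)) (fun x => d (w x) • G x) := by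
  have hdm := hd.measurable hψ.continuous.measurable
  have hloc1 := locallyIntegrableOn_comp hΩ hw.1 hψ
  have hloc2 := locallyIntegrableOn_bdd_smul hΩ hw.1 hw.2.1 hdm (hd.abs_le hψ)
  refine ⟨hloc1, hloc2, fun η hη hηc hηs i => ?_⟩
  set e : EuclideanSpace ℝ (Fin N) := EuclideanSpace.single i 1
  set S := tsupport η with hS
  have hη1 : Continuous (fun x => fderiv ℝ η x e) :=
    (hη.continuous_fderiv (by simp)).clm_apply continuous_const
  have hη1c : HasCompactSupport (fun x => fderiv ℝ η x e) := hηc.fderiv_apply (𝕜 := ℝ) e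
  obtain ⟨C, hC⟩ := hηc.exists_bound_of_continuous hη.continuous
  obtain ⟨C', hC'⟩ := hη1c.exists_bound_of_continuous hη1
  have hC0 : 0 ≤ C := (norm_nonneg _).trans (hC 0)
  have hC0' : 0 ≤ C' := (norm_nonneg _).trans (hC' 0)
  have r1 : ∀ v : EuclideanSpace ℝ (Fin N) → ℝ, ∫ x in Ω, v x * fderiv ℝ η x e
      = ∫ x in S, v x * fderiv ℝ η x e := fun v =>
    (setIntegral_eq_of_subset_of_forall_sdiff_eq_zero hΩ.measurableSet hηs fun x hx => by
      rw [image_eq_zero_of_notMem_tsupport fun h => hx.2 (tsupport_fderiv_subset ℝ h)]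
      simp)
  have r2 : ∀ v : EuclideanSpace ℝ (Fin N) → ℝ, ∫ x in Ω, v x * η x
      = ∫ x in S, v x * η x := fun v =>
    (setIntegral_eq_of_subset_of_forall_sdiff_eq_zero hΩ.measurableSet hηs fun x hx => by
      rw [image_eq_zero_of_notMem_tsupport hx.2, mul_zero])
  have hwS := hw.1.integrableOn_compact_subset hηs hηc
  have hψS := hloc1.integrableOn_compact_subset hηs hηc
  have hGS := hw.2.1.integrableOn_compact_subset hηs hηc
  have hfinS : IsFiniteMeasure (volume.restrict S) :=
    ⟨by simpa using (IsCompact.measure_lt_top hηc)⟩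
  -- These C¹ approximations converge to ψ uniformly, and their derivatives are bounded by `L` and
  -- converge everywhere. Hence no exceptional set of values of `w` has to be discussed.
  set f : ℕ → ℝ → ℝ := fun n => backwardAverage ψ (1 / (n + 1))
  have hfd : ∀ n s, deriv (f n) s = ((n : ℝ) + 1) * (ψ s - ψ (s - 1 / (n + 1))) := by
    intro n s
    simp only [f]
    rw [deriv_backwardAverage hψ.continuous]
    simp
  have hclose : ∀ (n : ℕ) s, |f n s - ψ s| ≤ L * (1 / (n + 1)) := fun n s =>
    abs_backwardAverage_sub_le hψ (by positivity) s
  have hdle : ∀ n s, |deriv (f n) s| ≤ L := fun n s => by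
    rw [hfd]; exact abs_slope_le hψ n s
  have hstep : ∀ n, ∫ x in S, f n (w x) * fderiv ℝ η x e
      = - ∫ x in S, (deriv (f n) (w x) * G x i) * η x := by
    intro n
    have := (hw.comp_contDiff hΩ (contDiff_backwardAverage hψ.continuous _)
      (hdle n)).2.2 η hη hηc hηs i
    rw [← r1, ← r2]
    simpa only [PiLp.smul_apply, smul_eq_mul] using this
  have hGm : AEStronglyMeasurable (fun x => G x i) (volume.restrict S) :=
    ((EuclideanSpace.proj i : EuclideanSpace ℝ (Fin N) →L[ℝ] ℝ).integrable_comp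
      hGS).aestronglyMeasurable
  have hlim1 : Tendsto (fun n => ∫ x in S, f n (w x) * fderiv ℝ η x e) atTop
      (𝓝 (∫ x in S, ψ (w x) * fderiv ℝ η x e)) := by
    refine tendsto_integral_of_dominated_convergence (fun x => (L + ‖ψ (w x)‖) * C')
      (fun n => ?_) (((integrable_const _).add hψS.norm).mul_const _) (fun n => ?_) ?_
    · exact (((contDiff_backwardAverage hψ.continuous _).continuous.comp_aestronglyMeasurable
        hwS.aestronglyMeasurable)).mul hη1.aestronglyMeasurable
    · refine ae_of_all _ fun x => ?_
      rw [norm_mul]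
      gcongr
      · have h1 := hclose n (w x)
        have h2 : (L : ℝ) * (1 / (n + 1)) ≤ L * 1 := by
          gcongr
          rw [div_le_one (by positivity)]
          linarith [(Nat.cast_nonneg n : (0 : ℝ) ≤ n)]
        calc ‖f n (w x)‖ = ‖(f n (w x) - ψ (w x)) + ψ (w x)‖ := by rw [sub_add_cancel]
          _ ≤ |f n (w x) - ψ (w x)| + ‖ψ (w x)‖ := norm_add_le _ _
          _ ≤ _ := by linarith
      · exact hC' x
    · refine ae_of_all _ fun x => Tendsto.mul_const _ ?_
      rw [tendsto_iff_norm_sub_tendsto_zero]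
      refine squeeze_zero (fun _ => norm_nonneg _) (fun n => hclose n (w x)) ?_
      simpa using (tendsto_one_div_add_atTop_nhds_zero_nat (𝕜 := ℝ)).const_mul (L : ℝ)
  have hlim2 : Tendsto (fun n => ∫ x in S, (deriv (f n) (w x) * G x i) * η x) atTop
      (𝓝 (∫ x in S, (d (w x) * G x i) * η x)) := by
    refine tendsto_integral_of_dominated_convergence (fun x => (L * ‖G x‖) * C)
      (fun n => ?_) ((hGS.norm.const_mul _).mul_const _) (fun n => ?_) ?_
    · exact ((((contDiff_backwardAverage hψ.continuous _).continuous_deriv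
        (by simp)).comp_aestronglyMeasurable hwS.aestronglyMeasurable).mul hGm).mul
        hη.continuous.aestronglyMeasurable
    · refine ae_of_all _ fun x => ?_
      rw [norm_mul, norm_mul]
      gcongr
      · exact hdle n (w x)
      · exact PiLp.norm_apply_le _ i
      · exact hC x
    · refine ae_of_all _ fun x => ?_
      simp_rw [hfd]
      exact ((hd (w x)).mul_const _).mul_const _
  have := tendsto_nhds_unique (hlim1.congr hstep) hlim2.neg
  rw [r1, r2]
  simpa using this

end WeakGradient

/-! ### Cubes. -/

section Cubes

variable {N : ℕ}

theorem isOpen_cube (y : EuclideanSpace ℝ (Fin N)) (ρ : ℝ) : IsOpen (cube y ρ) := by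
  simp only [cube, Set.ofPred_forall]
  exact isOpen_iInter_of_finite fun i => isOpen_lt (by fun_prop) continuous_const

/-- The closed cube of edge `2ρ` centred at `y`. -/
def closedCube (y : EuclideanSpace ℝ (Fin N)) (ρ : ℝ) : Set (EuclideanSpace ℝ (Fin N)) :=
  {x | ∀ i, |x i - y i| ≤ ρ}

theorem isCompact_closedCube (y : EuclideanSpace ℝ (Fin N)) (ρ : ℝ) :
    IsCompact (closedCube y ρ) := by
  have h : closedCube y ρ = (EuclideanSpace.equiv (Fin N) ℝ).toHomeomorph ⁻¹'
      (Set.univ.pi fun i => Set.Icc (y i - ρ) (y i + ρ)) := by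
    ext x
    simp only [closedCube, Set.mem_ofPred_eq, Set.mem_preimage, Set.mem_pi, Set.mem_univ,
      true_imp_iff, Set.mem_Icc, abs_le]
    refine forall_congr' fun i => ?_
    change _ ↔ y i - ρ ≤ x i ∧ x i ≤ y i + ρ
    constructor <;> rintro ⟨h1, h2⟩ <;> constructor <;> linarith
  rw [h, Homeomorph.isCompact_preimage]
  exact isCompact_univ_pi fun i => isCompact_Icc

theorem cube_subset_closedCube (y : EuclideanSpace ℝ (Fin N)) (ρ : ℝ) :
    cube y ρ ⊆ closedCube y ρ := fun _ hx i => (hx i).le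

theorem closedCube_subset_cube (y : EuclideanSpace ℝ (Fin N)) {ρ r : ℝ} (h : ρ < r) :
    closedCube y ρ ⊆ cube y r := fun _ hx i => (hx i).trans_lt h

theorem cube_mono (y : EuclideanSpace ℝ (Fin N)) {ρ r : ℝ} (h : ρ ≤ r) :
    cube y ρ ⊆ cube y r := fun _ hx i => (hx i).trans_le h

theorem measurableSet_cube (y : EuclideanSpace ℝ (Fin N)) (ρ : ℝ) : MeasurableSet (cube y ρ) :=
  (isOpen_cube y ρ).measurableSet

theorem volume_cube_lt_top (y : EuclideanSpace ℝ (Fin N)) (ρ : ℝ) : volume (cube y ρ) < ⊤ :=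
  (measure_mono (cube_subset_closedCube y ρ)).trans_lt (isCompact_closedCube y ρ).measure_lt_top

theorem add_mem_cube {y x h : EuclideanSpace ℝ (Fin N)} {ρ ε : ℝ} (hx : x ∈ cube y ρ)
    (hh : ‖h‖ ≤ ε) : x + h ∈ cube y (ρ + ε) := by
  intro i
  have h1 := (PiLp.norm_apply_le h i).trans hh
  have h2 : (x + h) i - y i = (x i - y i) + h i := by simp; ring
  rw [h2]
  exact (abs_add_le _ _).trans_lt (add_lt_add_of_lt_of_le (hx i) h1)

end Cubes

/-- Jensen's inequality for t^p, read off from the monotonicity of L^p norms on a probability space.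
-/
theorem rpow_lintegral_le_lintegral_rpow {α : Type*} [MeasurableSpace α] {μ : Measure α}
    [IsProbabilityMeasure μ] {p : ℝ} (hp : 1 ≤ p) {f : α → ℝ≥0∞} (hf : AEMeasurable f μ) :
    (∫⁻ x, f x ∂μ) ^ p ≤ ∫⁻ x, f x ^ p ∂μ := by
  have hp0 : 0 < p := by linarith
  have h := eLpNorm'_le_eLpNorm'_of_exponent_le (μ := μ) one_pos hp hf.aestronglyMeasurable
  simp only [eLpNorm', enorm_eq_self, ENNReal.rpow_one, div_one] at h
  calc _ ≤ ((∫⁻ x, f x ^ p ∂μ) ^ (1 / p)) ^ p := by gcongr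
    _ = _ := by rw [← ENNReal.rpow_mul, one_div_mul_cancel hp0.ne', ENNReal.rpow_one]

/-! ### Translation estimates in L^p. -/

section Translation

variable {N : ℕ}

/-- A mollification averages translates against a probability measure, so Jensen, Tonelli and
translation invariance give the contraction. -/
theorem lintegral_enorm_mollify_rpow_le {H : EuclideanSpace ℝ (Fin N) → EuclideanSpace ℝ (Fin N)}
    (hH : Measurable H) {p : ℝ} (hp : 1 ≤ p) (n : ℕ) :
    ∫⁻ x, ‖mollify n H x‖ₑ ^ p ≤ ∫⁻ x, ‖H x‖ₑ ^ p := by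
  set φ := (stdBump N n).normed (volume : Measure (EuclideanSpace ℝ (Fin N))) with hφ
  have hφm : Measurable fun z => ENNReal.ofReal (φ z) :=
    (contDiff_stdBump_normed N n).continuous.measurable.ennreal_ofReal
  have hφ0 : ∀ z, 0 ≤ φ z := (stdBump N n).nonneg_normed
  set μ := volume.withDensity fun z => ENNReal.ofReal (φ z) with hμ
  have hprob : IsProbabilityMeasure μ := by
    refine ⟨?_⟩
    rw [hμ, withDensity_apply _ MeasurableSet.univ, Measure.restrict_univ,
      ← ofReal_integral_eq_lintegral_ofReal (stdBump N n).integrable_normed (ae_of_all _ hφ0),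
      ContDiffBump.integral_normed, ENNReal.ofReal_one]
  have hpt : ∀ x, ‖mollify n H x‖ₑ ^ p ≤ ∫⁻ z, ‖H (x - z)‖ₑ ^ p ∂μ := by
    intro x
    refine le_trans ?_ (rpow_lintegral_le_lintegral_rpow hp (by fun_prop))
    gcongr
    rw [mollify_apply]
    refine (enorm_integral_le_lintegral_enorm _).trans (le_of_eq ?_)
    rw [hμ, lintegral_withDensity_eq_lintegral_mul _ hφm (by fun_prop)]
    refine lintegral_congr fun z => ?_
    rw [enorm_smul, Pi.mul_apply, Real.enorm_of_nonneg (hφ0 z)]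
  calc ∫⁻ x, ‖mollify n H x‖ₑ ^ p ≤ ∫⁻ x, ∫⁻ z, ‖H (x - z)‖ₑ ^ p ∂μ := lintegral_mono hpt
    _ = ∫⁻ z, (∫⁻ x, ‖H (x - z)‖ₑ ^ p) ∂μ := lintegral_lintegral_swap (by fun_prop)
    _ = ∫⁻ z, (∫⁻ x, ‖H x‖ₑ ^ p) ∂μ := by
        refine lintegral_congr fun z => ?_
        exact lintegral_sub_right_eq_self (fun x => ‖H x‖ₑ ^ p) z
    _ = _ := by simp

/-- The increment is the integral of the derivative along the segment; Jensen moves the power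
inside. -/
theorem enorm_sub_rpow_le_of_fderiv_le {v : EuclideanSpace ℝ (Fin N) → ℝ} (hv : ContDiff ℝ 1 v)
    {g : EuclideanSpace ℝ (Fin N) → EuclideanSpace ℝ (Fin N)} (hg : Measurable g)
    {p : ℝ} (hp : 1 ≤ p) {x h : EuclideanSpace ℝ (Fin N)}
    (hfd : ∀ s ∈ Icc (0 : ℝ) 1, ‖fderiv ℝ v (x + s • h) h‖ ≤ ‖h‖ * ‖g (x + s • h)‖) :
    ‖v (x + h) - v x‖ₑ ^ p ≤ ‖h‖ₑ ^ p * ∫⁻ s in Icc (0 : ℝ) 1, ‖g (x + s • h)‖ₑ ^ p := by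
  have hprob : IsProbabilityMeasure ((volume : Measure ℝ).restrict (Icc 0 1)) := ⟨by simp⟩
  have hder : ∀ s : ℝ, HasDerivAt (fun s : ℝ => v (x + s • h)) (fderiv ℝ v (x + s • h) h) s := by
    intro s
    have h1 : HasDerivAt (fun s : ℝ => x + s • h) h s := by
      simpa using ((hasDerivAt_id s).smul_const h).const_add x
    exact (hv.differentiable (by simp) _).hasFDerivAt.comp_hasDerivAt s h1
  have hcont : Continuous fun s : ℝ => fderiv ℝ v (x + s • h) h :=
    ((hv.continuous_fderiv (by simp)).comp (by fun_prop)).clm_apply continuous_const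
  have hftc := intervalIntegral.integral_eq_sub_of_hasDerivAt (a := 0) (b := 1)
    (fun s _ => hder s) (hcont.intervalIntegrable _ _)
  simp only [one_smul, zero_smul, add_zero] at hftc
  rw [← hftc, intervalIntegral.integral_of_le zero_le_one, ← integral_Icc_eq_integral_Ioc]
  have h2 : ‖∫ s in Icc (0 : ℝ) 1, fderiv ℝ v (x + s • h) h‖ₑ
      ≤ ‖h‖ₑ * ∫⁻ s in Icc (0 : ℝ) 1, ‖g (x + s • h)‖ₑ := by
    rw [← lintegral_const_mul _ (by fun_prop)]
    refine (enorm_integral_le_lintegral_enorm _).trans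
      (setLIntegral_mono' measurableSet_Icc fun s hs => ?_)
    rw [← ofReal_norm, ← ofReal_norm, ← ofReal_norm, ← ENNReal.ofReal_mul (norm_nonneg _)]
    exact ENNReal.ofReal_le_ofReal (hfd s hs)
  calc _ ≤ (‖h‖ₑ * ∫⁻ s in Icc (0 : ℝ) 1, ‖g (x + s • h)‖ₑ) ^ p := by gcongr
    _ = ‖h‖ₑ ^ p * (∫⁻ s in Icc (0 : ℝ) 1, ‖g (x + s • h)‖ₑ) ^ p :=
      ENNReal.mul_rpow_of_nonneg _ _ (by linarith)
    _ ≤ _ := by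
      gcongr
      exact rpow_lintegral_le_lintegral_rpow hp (by fun_prop)

/-- The functional is the inner product with `g`, and Cauchy–Schwarz applies. -/
theorem norm_clm_apply_le_of_single {l : EuclideanSpace ℝ (Fin N) →L[ℝ] ℝ}
    {g : EuclideanSpace ℝ (Fin N)} (hl : ∀ i, l (EuclideanSpace.single i 1) = g i)
    (h : EuclideanSpace ℝ (Fin N)) : ‖l h‖ ≤ ‖h‖ * ‖g‖ := by
  have : l h = inner ℝ h g := by
    conv_lhs => rw [← (EuclideanSpace.basisFun (Fin N) ℝ).sum_repr h]
    simp only [map_sum, map_smul, EuclideanSpace.basisFun_apply, hl, PiLp.inner_apply,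
      EuclideanSpace.basisFun_repr]
    exact Finset.sum_congr rfl fun i _ => by simp [mul_comm]
  rw [this]
  exact norm_inner_le_norm _ _

/-- Translations of a function with a weak gradient in `L^p`. -/
theorem HasWeakGradient.lintegral_translate_sub_le {y : EuclideanSpace ℝ (Fin N)} {R : ℝ}
    {w : EuclideanSpace ℝ (Fin N) → ℝ} {G : EuclideanSpace ℝ (Fin N) → EuclideanSpace ℝ (Fin N)}
    (hw : HasWeakGradient (cube y R) w G) {p : ℝ} (hp : 1 ≤ p) {ρ ε r : ℝ} (hρ : ρ + ε < r)
    (hr : r < R) {h : EuclideanSpace ℝ (Fin N)} (hh : ‖h‖ ≤ ε) :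
    ∫⁻ x in cube y ρ, ‖w (x + h) - w x‖ₑ ^ p
      ≤ ‖h‖ₑ ^ p * ∫⁻ x in cube y r, ‖G x‖ₑ ^ p := by
  have hΩ := isOpen_cube y R
  obtain ⟨G', hG'm, hGG'⟩ : ∃ G', Measurable G' ∧ G =ᵐ[volume.restrict (cube y R)] G' :=
    ⟨_, hw.2.1.aestronglyMeasurable.stronglyMeasurable_mk.measurable,
      hw.2.1.aestronglyMeasurable.ae_eq_mk⟩
  have hw' : HasWeakGradient (cube y R) w G' := hw.congr hΩ (ae_eq_refl _) hGG'
  have hε : 0 ≤ ε := (norm_nonneg _).trans hh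
  have hGint : ∫⁻ x in cube y r, ‖G x‖ₑ ^ p = ∫⁻ x in cube y r, ‖G' x‖ₑ ^ p :=
    lintegral_congr_ae ((ae_restrict_of_ae_restrict_of_subset (cube_mono y hr.le) hGG').mono
      fun x hx => by simp only [hx])
  rw [hGint]
  -- The gap between ρ + ε and r' leaves room for the mollification radius around every segment from
  -- x to x + h.
  obtain ⟨r', hr'1, hr'2⟩ := exists_between hρ
  set K := closedCube y r' with hK
  have hKc : IsCompact K := isCompact_closedCube y r'
  have hKr : K ⊆ cube y r := closedCube_subset_cube y hr'2
  have hKΩ : K ⊆ cube y R := hKr.trans (cube_mono y hr.le)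
  have hwK : Integrable (K.indicator w) :=
    (integrable_indicator_iff hKc.measurableSet).2 (hw'.1.integrableOn_compact_subset hKΩ hKc)
  have hGK : Integrable (K.indicator G') :=
    (integrable_indicator_iff hKc.measurableSet).2 (hw'.2.1.integrableOn_compact_subset hKΩ hKc)
  have hGKm : Measurable (K.indicator G') := hG'm.indicator hKc.measurableSet
  have hmG : ∀ n, Measurable (mollify n (K.indicator G')) := fun n =>
    (mollify_contDiff hGK.locallyIntegrable n).continuous.measurable
  have hmw : ∀ n, Measurable (mollify n (K.indicator w)) := fun n =>
    (mollify_contDiff hwK.locallyIntegrable n).continuous.measurable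
  have hGKint : ∫⁻ x, ‖K.indicator G' x‖ₑ ^ p ≤ ∫⁻ x in cube y r, ‖G' x‖ₑ ^ p := by
    rw [← lintegral_indicator (measurableSet_cube y r)]
    refine lintegral_mono fun x => ?_
    by_cases hx : x ∈ K
    · simp [hx, hKr hx]
    · simp [hx, show 0 < p by linarith]
  have hstep : ∀ᶠ n : ℕ in atTop, ∫⁻ x in cube y ρ,
      ‖mollify n (K.indicator w) (x + h) - mollify n (K.indicator w) x‖ₑ ^ p
      ≤ ‖h‖ₑ ^ p * ∫⁻ x in cube y r, ‖G' x‖ₑ ^ p := by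
    have hsmall : ∀ᶠ n : ℕ in atTop, (1 : ℝ) / (n + 1) < r' - (ρ + ε) :=
      (tendsto_one_div_add_atTop_nhds_zero_nat (𝕜 := ℝ)).eventually_lt_const (by linarith)
    filter_upwards [hsmall] with n hn
    have hfd : ∀ x ∈ cube y (ρ + ε), ∀ i,
        fderiv ℝ (mollify n (K.indicator w)) x (EuclideanSpace.single i 1)
          = mollify n (K.indicator G') x i := by
      intro x hx i
      refine hw'.fderiv_mollify hΩ.measurableSet hKc hKΩ n (fun z hz => ?_) i
      rw [Metric.mem_closedBall, dist_eq_norm] at hz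
      have := add_mem_cube hx hz
      rw [add_sub_cancel] at this
      exact cube_subset_closedCube _ _ (cube_mono y (by linarith) this)
    have hseg : ∀ x ∈ cube y ρ, ∀ s ∈ Icc (0 : ℝ) 1, x + s • h ∈ cube y (ρ + ε) := by
      intro x hx s hs
      refine add_mem_cube hx ?_
      rw [norm_smul, Real.norm_of_nonneg hs.1]
      exact (mul_le_of_le_one_left (norm_nonneg _) hs.2).trans hh
    calc _ ≤ ∫⁻ x in cube y ρ, ‖h‖ₑ ^ p * ∫⁻ s in Icc (0 : ℝ) 1,
          ‖mollify n (K.indicator G') (x + s • h)‖ₑ ^ p :=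
          setLIntegral_mono' (measurableSet_cube y ρ) fun x hx =>
            enorm_sub_rpow_le_of_fderiv_le ((mollify_contDiff hwK.locallyIntegrable n).of_le
              (by simp)) (hmG n) hp fun s hs =>
              norm_clm_apply_le_of_single (hfd _ (hseg x hx s hs)) h
      _ = ‖h‖ₑ ^ p * ∫⁻ x in cube y ρ, ∫⁻ s in Icc (0 : ℝ) 1,
          ‖mollify n (K.indicator G') (x + s • h)‖ₑ ^ p :=
          lintegral_const_mul' _ _ (ENNReal.rpow_ne_top_of_nonneg (by linarith) enorm_ne_top)
      _ = ‖h‖ₑ ^ p * ∫⁻ s in Icc (0 : ℝ) 1, ∫⁻ x in cube y ρ,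
          ‖mollify n (K.indicator G') (x + s • h)‖ₑ ^ p := by
          have := hmG n
          rw [lintegral_lintegral_swap (by fun_prop)]
      _ ≤ ‖h‖ₑ ^ p * ∫⁻ s in Icc (0 : ℝ) 1, ∫⁻ x,
          ‖mollify n (K.indicator G') x‖ₑ ^ p := by
          refine mul_le_mul_right (lintegral_mono fun s => ?_) _
          refine (setLIntegral_le_lintegral _ _).trans (le_of_eq ?_)
          exact lintegral_add_right_eq_self
            (fun x => ‖mollify n (K.indicator G') x‖ₑ ^ p) (s • h)
      _ = ‖h‖ₑ ^ p * ∫⁻ x, ‖mollify n (K.indicator G') x‖ₑ ^ p := by simp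
      _ ≤ _ := by
          refine mul_le_mul_right ?_ _
          exact (lintegral_enorm_mollify_rpow_le hGKm hp n).trans hGKint
  have hae := mollify_ae_tendsto hwK.locallyIntegrable
  have hae' : ∀ᵐ x, Tendsto (fun n => mollify n (K.indicator w) (x + h)) atTop
      (𝓝 (K.indicator w (x + h))) :=
    (quasiMeasurePreserving_add_right (volume : Measure (EuclideanSpace ℝ (Fin N))) h).ae hae
  have hmem : ∀ x ∈ cube y ρ, x ∈ K ∧ x + h ∈ K := fun x hx =>
    ⟨cube_subset_closedCube _ _ (cube_mono y (by linarith) hx),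
      cube_subset_closedCube _ _ (cube_mono y hr'1.le (add_mem_cube hx hh))⟩
  calc ∫⁻ x in cube y ρ, ‖w (x + h) - w x‖ₑ ^ p
      = ∫⁻ x in cube y ρ, liminf (fun n => ‖mollify n (K.indicator w) (x + h)
          - mollify n (K.indicator w) x‖ₑ ^ p) atTop := by
        refine lintegral_congr_ae ?_
        filter_upwards [ae_restrict_mem (measurableSet_cube y ρ), ae_restrict_of_ae hae,
          ae_restrict_of_ae hae'] with x hx h1 h2
        have h3 := ((ENNReal.continuous_rpow_const (y := p)).tendsto _).comp
          ((continuous_enorm.tendsto _).comp (h2.sub h1))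
        simp only [(hmem x hx).1, (hmem x hx).2, indicator_of_mem, Function.comp_def] at h3
        exact h3.liminf_eq.symm
    _ ≤ liminf (fun n => ∫⁻ x in cube y ρ, ‖mollify n (K.indicator w) (x + h)
          - mollify n (K.indicator w) x‖ₑ ^ p) atTop :=
        lintegral_liminf_le fun n => by
          have := hmw n
          fun_prop
    _ ≤ _ := liminf_le_of_le (by isBoundedDefault) fun b hb => by
        obtain ⟨n, h1, h2⟩ := (hb.and hstep).exists
        exact h1.trans h2

end Translation

/-! ### A Faber–Krahn inequality from averaged translations. -/

section FaberKrahn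

variable {N : ℕ} {y : EuclideanSpace ℝ (Fin N)} {R : ℝ}
    {w : EuclideanSpace ℝ (Fin N) → ℝ} {G : EuclideanSpace ℝ (Fin N) → EuclideanSpace ℝ (Fin N)}

/-- For x in the small cube and |h| < ε, either x + h lies in the positivity set, or w(x + h) = 0
and w(x) is itself a difference, controlled by the gradient. Averaged over h in the ball of radius
ε, the first case has weight at most 1/2 by the hypothesis on the measure, and is absorbed on the
left. -/
theorem HasWeakGradient.lintegral_rpow_le_of_measurable
    (hw : HasWeakGradient (cube y R) w G) (hwm : Measurable w) (hw0 : ∀ x, 0 ≤ w x)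
    {p : ℝ} (hp : 1 ≤ p) {ρ ε r : ℝ} (hε : 0 < ε) (hρ : ρ + ε < r) (hr : r < R)
    (hA : 2 * volume (cube y r ∩ {x | 0 < w x}) ≤
      volume (Metric.ball (0 : EuclideanSpace ℝ (Fin N)) ε))
    (hfin : ∫⁻ x in cube y ρ, ‖w x‖ₑ ^ p ≠ ⊤) :
    ∫⁻ x in cube y ρ, ‖w x‖ₑ ^ p
      ≤ 2 * (ENNReal.ofReal ε ^ p * ∫⁻ x in cube y r, ‖G x‖ₑ ^ p) := by
  have hp0 : 0 < p := by linarith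
  set A := cube y r ∩ {x | 0 < w x} with hAdef
  set B := Metric.ball (0 : EuclideanSpace ℝ (Fin N)) ε with hB
  have hAm : MeasurableSet A :=
    (measurableSet_cube y r).inter (measurableSet_lt measurable_const hwm)
  have hBm : MeasurableSet B := Metric.isOpen_ball.measurableSet
  set I := ∫⁻ x in cube y ρ, ‖w x‖ₑ ^ p with hI
  set J := ∫⁻ x in cube y r, ‖G x‖ₑ ^ p with hJ
  have h1m : Measurable (A.indicator (1 : EuclideanSpace ℝ (Fin N) → ℝ≥0∞)) :=
    measurable_one.indicator hAm
  have hpt : ∀ h ∈ B, I ≤ ENNReal.ofReal ε ^ p * J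
      + ∫⁻ x in cube y ρ, ‖w x‖ₑ ^ p * A.indicator 1 (x + h) := by
    intro h hh
    have hhε : ‖h‖ ≤ ε := by
      rw [hB, Metric.mem_ball, dist_zero_right] at hh
      exact hh.le
    calc I ≤ ∫⁻ x in cube y ρ, (‖w (x + h) - w x‖ₑ ^ p
          + ‖w x‖ₑ ^ p * A.indicator 1 (x + h)) := by
          refine setLIntegral_mono' (measurableSet_cube y ρ) fun x hx => ?_
          by_cases hxA : x + h ∈ A
          · simp [hxA]
          · have hmem : x + h ∈ cube y r := cube_mono y hρ.le (add_mem_cube hx hhε)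
            have hz : w (x + h) = 0 :=
              le_antisymm (not_lt.1 fun hlt => hxA ⟨hmem, hlt⟩) (hw0 _)
            simp [hxA, hz]
      _ = (∫⁻ x in cube y ρ, ‖w (x + h) - w x‖ₑ ^ p)
          + ∫⁻ x in cube y ρ, ‖w x‖ₑ ^ p * A.indicator 1 (x + h) :=
          lintegral_add_left (by fun_prop) _
      _ ≤ _ := by
          refine add_le_add_left ?_ _
          refine (hw.lintegral_translate_sub_le hp hρ hr hhε).trans ?_
          refine mul_le_mul_left ?_ _
          gcongr
          rw [← ofReal_norm]
          exact ENNReal.ofReal_le_ofReal hhε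
  have hsecond : ∫⁻ h in B, ∫⁻ x in cube y ρ, ‖w x‖ₑ ^ p * A.indicator 1 (x + h)
      ≤ I * volume A := by
    rw [lintegral_lintegral_swap (by fun_prop), hI,
      ← lintegral_mul_const _ (by fun_prop)]
    refine lintegral_mono fun x => ?_
    rw [lintegral_const_mul _ (by fun_prop)]
    refine mul_le_mul_right ((setLIntegral_le_lintegral _ _).trans (le_of_eq ?_)) _
    rw [lintegral_add_left_eq_self 
      (fun z => A.indicator (1 : EuclideanSpace ℝ (Fin N) → ℝ≥0∞) z) x,
      lintegral_indicator_one hAm]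
  have hV0 : volume B ≠ 0 := (Metric.measure_ball_pos _ _ hε).ne'
  have hVt : volume B ≠ ⊤ := measure_ball_lt_top.ne
  have havg : I * volume B ≤ ENNReal.ofReal ε ^ p * J * volume B + I * volume A := by
    calc I * volume B = ∫⁻ _ in B, I := (setLIntegral_const _ _).symm
      _ ≤ ∫⁻ h in B, (ENNReal.ofReal ε ^ p * J
          + ∫⁻ x in cube y ρ, ‖w x‖ₑ ^ p * A.indicator 1 (x + h)) :=
          setLIntegral_mono' hBm hpt
      _ = ENNReal.ofReal ε ^ p * J * volume B
          + ∫⁻ h in B, ∫⁻ x in cube y ρ, ‖w x‖ₑ ^ p * A.indicator 1 (x + h) := by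
          rw [lintegral_add_left measurable_const, setLIntegral_const]
      _ ≤ _ := add_le_add_right hsecond _
  have h2 : 2 * (I * volume B) ≤ 2 * (ENNReal.ofReal ε ^ p * J) * volume B + I * volume B := by
    calc 2 * (I * volume B) ≤ 2 * (ENNReal.ofReal ε ^ p * J * volume B + I * volume A) := by gcongr
      _ = 2 * (ENNReal.ofReal ε ^ p * J) * volume B + I * (2 * volume A) := by ring
      _ ≤ _ := by gcongr
  rw [two_mul] at h2
  -- The absorption: cancelling is legitimate because `I` is assumed finite.
  have h3 := (ENNReal.add_le_add_iff_right (ENNReal.mul_ne_top hfin hVt)).1 h2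
  exact (ENNReal.mul_le_mul_iff_left hV0 hVt).1 h3

/-- A Faber–Krahn type inequality: a nonnegative function with a weak gradient whose set of
positivity is small is controlled by its gradient. -/
theorem HasWeakGradient.lintegral_rpow_le
    (hw : HasWeakGradient (cube y R) w G) (hw0 : ∀ x, 0 ≤ w x)
    {p : ℝ} (hp : 1 ≤ p) {ρ ε r : ℝ} (hε : 0 < ε) (hρ : ρ + ε < r) (hr : r < R)
    (hA : 2 * volume (cube y r ∩ {x | 0 < w x}) ≤
      volume (Metric.ball (0 : EuclideanSpace ℝ (Fin N)) ε))
    (hfin : ∫⁻ x in cube y ρ, ‖w x‖ₑ ^ p ≠ ⊤) :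
    ∫⁻ x in cube y ρ, ‖w x‖ₑ ^ p
      ≤ 2 * (ENNReal.ofReal ε ^ p * ∫⁻ x in cube y r, ‖G x‖ₑ ^ p) := by
  obtain ⟨v, hvm, hv⟩ : ∃ v, Measurable v ∧ w =ᵐ[volume.restrict (cube y R)] v :=
    ⟨_, hw.1.aestronglyMeasurable.stronglyMeasurable_mk.measurable,
      hw.1.aestronglyMeasurable.ae_eq_mk⟩
  -- Taking the positive part makes the measurable representative nonnegative everywhere, not just
  -- almost everywhere.
  have hv' : w =ᵐ[volume.restrict (cube y R)] fun x => max (v x) 0 := by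
    filter_upwards [hv] with x hx
    rw [← hx, max_eq_left (hw0 x)]
  have hI : ∫⁻ x in cube y ρ, ‖w x‖ₑ ^ p = ∫⁻ x in cube y ρ, ‖max (v x) 0‖ₑ ^ p :=
    lintegral_congr_ae ((ae_restrict_of_ae_restrict_of_subset (cube_mono y (by linarith))
      hv').mono fun x hx => by simp only [hx])
  have hvol : volume (cube y r ∩ {x | 0 < w x}) = volume (cube y r ∩ {x | 0 < max (v x) 0}) := by
    refine measure_congr ?_
    have := ae_restrict_of_ae_restrict_of_subset (cube_mono y hr.le) hv'
    rw [ae_restrict_iff' (measurableSet_cube y r)] at this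
    filter_upwards [this] with x hx
    refine propext (and_congr_right fun hxr => ?_)
    change 0 < w x ↔ 0 < max (v x) 0
    rw [hx hxr]
  rw [hI] at hfin ⊢
  rw [hvol] at hA
  exact (hw.congr (isOpen_cube y R) hv' (ae_eq_refl _)).lintegral_rpow_le_of_measurable
    (hvm.max measurable_const) (fun x => le_max_right _ _) hp hε hρ hr hA hfin

end FaberKrahn

/-! ### Cylinders, slicing in time, truncations. -/

section Cylinders

variable {N : ℕ}

theorem parCylinder_mono (y : EuclideanSpace ℝ (Fin N)) (s : ℝ) {ρ τ R T : ℝ} (h : ρ ≤ R)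
    (h' : τ ≤ T) : parCylinder y s ρ τ ⊆ parCylinder y s R T :=
  prod_mono (cube_mono y h) (Ioc_subset_Ioc_left (by linarith))

theorem restrict_parCylinder (y : EuclideanSpace ℝ (Fin N)) (s ρ τ : ℝ) :
    (volume : Measure (EuclideanSpace ℝ (Fin N) × ℝ)).restrict (parCylinder y s ρ τ)
      = (volume.restrict (cube y ρ)).prod (volume.restrict (Ioo (s - τ) s)) := by
  rw [parCylinder, Measure.volume_eq_prod, ← Measure.prod_restrict,
    Measure.restrict_congr_set (Ioo_ae_eq_Ioc (μ := (volume : Measure ℝ)))]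

theorem lintegral_parCylinder (y : EuclideanSpace ℝ (Fin N)) (s ρ τ : ℝ)
    {f : EuclideanSpace ℝ (Fin N) × ℝ → ℝ≥0∞}
    (hf : AEMeasurable f (volume.restrict (parCylinder y s ρ τ))) :
    ∫⁻ z in parCylinder y s ρ τ, f z
      = ∫⁻ t in Ioo (s - τ) s, ∫⁻ x in cube y ρ, f (x, t) := by
  rw [restrict_parCylinder] at hf ⊢
  exact lintegral_prod_symm _ hf

theorem ae_ae_of_ae_parCylinder {y : EuclideanSpace ℝ (Fin N)} {s ρ τ : ℝ}
    {P : EuclideanSpace ℝ (Fin N) × ℝ → Prop}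
    (h : ∀ᵐ z ∂(volume.restrict (parCylinder y s ρ τ)), P z) :
    ∀ᵐ t ∂(volume.restrict (Ioo (s - τ) s)), ∀ᵐ x ∂(volume.restrict (cube y ρ)), P (x, t) := by
  rw [restrict_parCylinder] at h
  have h' := (Measure.measurePreserving_swap (μ := volume.restrict (Ioo (s - τ) s))
    (ν := volume.restrict (cube y ρ))).quasiMeasurePreserving.ae h
  exact Measure.ae_ae_of_ae_prod h'

theorem CompactlyContained.mono {X : Type*} [TopologicalSpace X] {A A' E : Set X}
    (h : CompactlyContained A E) (hA : A' ⊆ A) : CompactlyContained A' E :=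
  ⟨h.1.of_isClosed_subset isClosed_closure (closure_mono hA), (closure_mono hA).trans h.2⟩

theorem CompactlyContained.subset {X : Type*} [TopologicalSpace X] {A E : Set X}
    (h : CompactlyContained A E) : A ⊆ E := subset_closure.trans h.2

theorem truncPlus_nonneg {X : Type*} (u : X → ℝ) (k : ℝ) (z : X) : 0 ≤ truncPlus u k z :=
  le_max_right _ _

theorem truncPlus_anti {X : Type*} (u : X → ℝ) {k k' : ℝ} (h : k ≤ k') (z : X) :
    truncPlus u k' z ≤ truncPlus u k z :=
  max_le_max (by linarith) le_rfl

theorem ofReal_rpow_eq_enorm {a p : ℝ} (ha : 0 ≤ a) (hp : 0 ≤ p) :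
    ENNReal.ofReal (a ^ p) = ‖a‖ₑ ^ p := by
  rw [Real.enorm_of_nonneg ha, ENNReal.ofReal_rpow_of_nonneg ha hp]

theorem ofReal_norm_rpow_eq_enorm {F : Type*} [NormedAddCommGroup F] (a : F) {p : ℝ} (hp : 0 ≤ p) :
    ENNReal.ofReal (‖a‖ ^ p) = ‖a‖ₑ ^ p := by
  rw [← ofReal_norm, ENNReal.ofReal_rpow_of_nonneg (norm_nonneg a) hp]

theorem ofReal_truncPlus_rpow {X : Type*} (u : X → ℝ) (k : ℝ) (z : X) {p : ℝ} (hp : 0 ≤ p) :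
    ENNReal.ofReal (truncPlus u k z ^ p) = ‖truncPlus u k z‖ₑ ^ p :=
  ofReal_rpow_eq_enorm (truncPlus_nonneg u k z) hp

end Cylinders

/-! ### One step of the De Giorgi iteration. -/

section DeGiorgi

variable {N : ℕ} {E : Set (EuclideanSpace ℝ (Fin N) × ℝ)} {p γ : ℝ}
  {u : EuclideanSpace ℝ (Fin N) × ℝ → ℝ} {y : EuclideanSpace ℝ (Fin N)} {s : ℝ}

/-- The integral of `(u-k)_+^p` over a cylinder. -/
noncomputable def excess (p : ℝ) (u : EuclideanSpace ℝ (Fin N) × ℝ → ℝ)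
    (y : EuclideanSpace ℝ (Fin N)) (s R T k : ℝ) : ℝ≥0∞ :=
  ∫⁻ z in parCylinder y s R T, ENNReal.ofReal (truncPlus u k z ^ p)

theorem excess_mono (hp : 0 ≤ p) {R T k R' T' k' : ℝ} (hR : R ≤ R') (hT : T ≤ T') (hk : k' ≤ k) :
    excess p u y s R T k ≤ excess p u y s R' T' k' :=
  lintegral_mono' (Measure.restrict_mono (parCylinder_mono y s hR hT) le_rfl) fun z =>
    ENNReal.ofReal_le_ofReal
      (Real.rpow_le_rpow (truncPlus_nonneg u k z) (truncPlus_anti u hk z) hp)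

theorem aemeasurable_truncPlus {A : Set (EuclideanSpace ℝ (Fin N) × ℝ)}
    (hu : AEMeasurable u (volume.restrict A)) (k : ℝ) :
    AEMeasurable (truncPlus u k) (volume.restrict A) :=
  (hu.sub_const k).max aemeasurable_const

/-- One step of the De Giorgi iteration. -/
theorem ClassAPlus.excess_le (hu : ClassAPlus E p γ u) (hp : 1 ≤ p)
    {ρ ε r R τ T k k' : ℝ} (hρ : 0 < ρ) (hε : 0 < ε) (hρr : ρ + ε < r) (hrR : r < R)
    (hτ : 0 < τ) (hτT : τ < T) (hk : k < k')
    (hE : CompactlyContained (parCylinder y s R T) E)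
    (hfin : excess p u y s R T k ≠ ⊤)
    (hsmall : 2 * (ENNReal.ofReal (γ / (R - r) ^ p + γ / (T - τ)) * excess p u y s R T k)
      ≤ volume (Metric.ball (0 : EuclideanSpace ℝ (Fin N)) ε) * ENNReal.ofReal (k' - k) ^ p) :
    excess p u y s ρ τ k' ≤ 2 * (ENNReal.ofReal ε ^ p *
      (ENNReal.ofReal (γ / (R - r) ^ p + γ / (T - τ)) * excess p u y s R T k)) := by
  have hp0 : 0 ≤ p := by linarith
  have hp0' : 0 < p := by linarith
  set B := ENNReal.ofReal (γ / (R - r) ^ p + γ / (T - τ)) with hB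
  set Y := excess p u y s R T k with hY
  -- Two energy inequalities are used: the supremum part at the lower level `k` bounds the measure
  -- of {u > k'} on almost every time slice, and the gradient part at the higher level `k'` feeds
  -- the Faber–Krahn inequality there.
  obtain ⟨G₀, hG₀, h₀⟩ := hu.2 y s R T r τ k (by linarith) hrR hτ hτT hE
  obtain ⟨G, hG, h₁⟩ := hu.2 y s R T r τ k' (by linarith) hrR hτ hτT hE
  have hsub : Ioo (s - τ) s ⊆ Ioo (s - T) s := Ioo_subset_Ioo_left (by linarith)
  have hsup : ∀ᵐ t ∂(volume.restrict (Ioo (s - τ) s)),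
      ∫⁻ x in cube y r, ENNReal.ofReal (truncPlus u k (x, t) ^ p) ≤ B * Y := by
    filter_upwards [ENNReal.ae_le_essSup (μ := volume.restrict (Ioo (s - τ) s)) (fun t =>
      ∫⁻ x in cube y r, ENNReal.ofReal (truncPlus u k (x, t) ^ p))] with t ht
    exact ht.trans (le_self_add.trans h₀)
  have hgrad : ∫⁻ z in parCylinder y s r τ, ENNReal.ofReal (‖G z‖ ^ p) ≤ B * Y :=
    (le_add_self.trans h₁).trans (mul_le_mul_right (excess_mono hp0 le_rfl le_rfl hk.le) _)
  have hslice : ∀ᵐ t ∂(volume.restrict (Ioo (s - τ) s)),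
      ∫⁻ x in cube y ρ, ENNReal.ofReal (truncPlus u k' (x, t) ^ p)
        ≤ 2 * (ENNReal.ofReal ε ^ p * ∫⁻ x in cube y r, ENNReal.ofReal (‖G (x, t)‖ ^ p)) := by
    filter_upwards [hsup, ae_restrict_of_ae_restrict_of_subset hsub hG₀.2,
      ae_restrict_of_ae_restrict_of_subset hsub hG.2] with t ht hw₀ hw
    simp_rw [ofReal_truncPlus_rpow _ _ _ hp0] at ht
    simp_rw [ofReal_truncPlus_rpow _ _ _ hp0, ofReal_norm_rpow_eq_enorm _ hp0]
    have hk0 : ENNReal.ofReal (k' - k) ^ p ≠ 0 := by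
      rw [ENNReal.ofReal_rpow_of_pos (by linarith)]
      exact (ENNReal.ofReal_pos.2 (Real.rpow_pos_of_pos (by linarith) _)).ne'
    have hkt : ENNReal.ofReal (k' - k) ^ p ≠ ⊤ :=
      ENNReal.rpow_ne_top_of_nonneg hp0 ENNReal.ofReal_ne_top
    have hmeas : AEMeasurable (fun x => ‖truncPlus u k (x, t)‖ₑ ^ p)
        (volume.restrict (cube y r)) := by
      have := (hw₀.1.aestronglyMeasurable.mono_measure
        (Measure.restrict_mono (cube_mono y hrR.le) le_rfl)).aemeasurable
      fun_prop
    -- Chebyshev: where u > k', the truncation (u - k)_+ is at least k' - k.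
    have hmarkov : ENNReal.ofReal (k' - k) ^ p *
        volume (cube y r ∩ {x | 0 < truncPlus u k' (x, t)}) ≤ B * Y := by
      refine le_trans ?_ ht
      refine le_trans ?_ (mul_meas_ge_le_lintegral₀ hmeas (ENNReal.ofReal (k' - k) ^ p))
      refine mul_le_mul_right ?_ _
      rw [Measure.restrict_apply' (measurableSet_cube y r), inter_comm]
      refine measure_mono (inter_subset_inter_left _ fun x hx => ?_)
      have hx' : k' < u (x, t) := by
        have : 0 < max (u (x, t) - k') 0 := hx
        rcases lt_max_iff.1 this with h | h
        · linarith
        · exact absurd h (lt_irrefl _)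
      change ENNReal.ofReal (k' - k) ^ p ≤ ‖truncPlus u k (x, t)‖ₑ ^ p
      gcongr
      rw [Real.enorm_of_nonneg (truncPlus_nonneg _ _ _)]
      exact ENNReal.ofReal_le_ofReal ((sub_le_sub_right hx'.le k).trans (le_max_left _ _))
    refine hw.lintegral_rpow_le (fun x => truncPlus_nonneg _ _ _) hp hε hρr hrR ?_ ?_
    · refine (ENNReal.mul_le_mul_iff_left hk0 hkt).1 ?_
      refine le_trans ?_ hsmall
      rw [mul_assoc, mul_comm (volume _)]
      exact mul_le_mul_right hmarkov 2
    · refine ne_top_of_le_ne_top (ENNReal.mul_ne_top ENNReal.ofReal_ne_top hfin)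
        (le_trans ?_ ht)
      refine lintegral_mono' (Measure.restrict_mono (cube_mono y (by linarith)) le_rfl) fun x => ?_
      dsimp only
      gcongr
      rw [Real.enorm_of_nonneg (truncPlus_nonneg _ _ _),
        Real.enorm_of_nonneg (truncPlus_nonneg _ _ _)]
      exact ENNReal.ofReal_le_ofReal (truncPlus_anti u hk.le _)
  have huE : AEMeasurable u (volume.restrict (parCylinder y s ρ τ)) :=
    hu.1.1.mono_measure (Measure.restrict_mono
      ((parCylinder_mono y s (by linarith) hτT.le).trans hE.subset) le_rfl)
  have hGm : AEMeasurable (fun z => ENNReal.ofReal (‖G z‖ ^ p))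
      (volume.restrict (parCylinder y s r τ)) := by
    have := hG.1.mono_measure (Measure.restrict_mono (parCylinder_mono y s hrR.le hτT.le) le_rfl)
    exact (this.norm.aemeasurable.pow_const p).ennreal_ofReal
  calc excess p u y s ρ τ k'
      = ∫⁻ t in Ioo (s - τ) s, ∫⁻ x in cube y ρ, ENNReal.ofReal (truncPlus u k' (x, t) ^ p) :=
        lintegral_parCylinder y s ρ τ
          ((aemeasurable_truncPlus huE k').pow_const p).ennreal_ofReal
    _ ≤ ∫⁻ t in Ioo (s - τ) s, 2 * (ENNReal.ofReal ε ^ p *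
          ∫⁻ x in cube y r, ENNReal.ofReal (‖G (x, t)‖ ^ p)) := lintegral_mono_ae hslice
    _ = 2 * (ENNReal.ofReal ε ^ p * ∫⁻ z in parCylinder y s r τ, ENNReal.ofReal (‖G z‖ ^ p)) := by
        rw [lintegral_const_mul' _ _ (by simp), lintegral_const_mul' _ _
          (ENNReal.rpow_ne_top_of_nonneg hp0 ENNReal.ofReal_ne_top), lintegral_parCylinder _ _ _ _ hGm]
    _ ≤ _ := mul_le_mul_right (mul_le_mul_right hgrad _) _

theorem ClassAPlus.excess_ne_top (hu : ClassAPlus E p γ u) (hp : 1 ≤ p) {R T : ℝ} (hR : 0 < R)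
    (hT : 0 < T) (hE : CompactlyContained (parCylinder y s R T) E) :
    excess p u y s R T 0 ≠ ⊤ := by
  have hp0 : 0 < p := by linarith
  have h := ((hu.1.2 y s R T hR hT hE).2.1).2
  rw [eLpNorm_lt_top_iff_lintegral_rpow_enorm_lt_top (by simpa using hp0)
    ENNReal.ofReal_ne_top, ENNReal.toReal_ofReal hp0.le] at h
  refine (lt_of_le_of_lt (lintegral_mono fun z => ?_) h).ne
  rw [ofReal_truncPlus_rpow _ _ _ hp0.le]
  gcongr
  rw [Real.enorm_of_nonneg (truncPlus_nonneg _ _ _), ← ofReal_norm]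
  refine ENNReal.ofReal_le_ofReal ?_
  simp only [truncPlus, sub_zero, Real.norm_eq_abs]
  exact max_le (le_abs_self _) (abs_nonneg _)

end DeGiorgi

/-! ### Local boundedness from above. -/

section Boundedness

variable {N : ℕ} {E : Set (EuclideanSpace ℝ (Fin N) × ℝ)} {p γ : ℝ}
  {u : EuclideanSpace ℝ (Fin N) × ℝ → ℝ} {y : EuclideanSpace ℝ (Fin N)} {s : ℝ}

/-- Along gaps shrinking like 2^{-n} the coefficient grows at most like 2^{pn}; p ≥ 1 lets the
spatial term dominate the growth of the time term. -/
theorem energy_coefficient_le {a b : ℝ} (hγ : 0 < γ) (ha : 0 < a) (hb : 0 < b) (hp : 1 ≤ p)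
    (n : ℕ) :
    γ / (a / 4 * (1 / 2) ^ n) ^ p + γ / (b / 2 * (1 / 2) ^ n)
      ≤ (γ / (a / 4) ^ p + γ / (b / 2)) * ((2 : ℝ) ^ p) ^ n := by
  have h1 : ((1 / 2 : ℝ) ^ n) ^ p = (((2 : ℝ) ^ p) ^ n)⁻¹ := by
    rw [← Real.rpow_natCast, ← Real.rpow_mul (by norm_num), mul_comm, Real.rpow_mul (by norm_num),
      Real.rpow_natCast, ← inv_pow, one_div, Real.inv_rpow (by norm_num)]
  have h2 : (2 : ℝ) ^ n ≤ ((2 : ℝ) ^ p) ^ n := by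
    gcongr
    simpa using Real.rpow_le_rpow_of_exponent_le (x := 2) (by norm_num) hp
  rw [Real.mul_rpow (by positivity) (by positivity), h1, add_mul]
  have h3 : (1 / 2 : ℝ) ^ n = (2 ^ n)⁻¹ := by rw [one_div, inv_pow]
  rw [h3]
  have e1 : γ / ((a / 4) ^ p * (((2 : ℝ) ^ p) ^ n)⁻¹) = γ / (a / 4) ^ p * ((2 : ℝ) ^ p) ^ n := by
    field_simp
  have e2 : γ / (b / 2 * ((2 : ℝ) ^ n)⁻¹) = γ / (b / 2) * 2 ^ n := by
    field_simp
  rw [e1, e2]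
  gcongr

/-- The number `c` is the translation radius relative to the current gap, and is chosen first, small
enough to force the decay ratio of the iteration. The level `k` comes last and is taken large to
meet the smallness condition, which depends on `c`. -/
theorem exists_iteration_constants {a β v y₀ : ℝ} (ha : 0 < a) (hβ : 0 < β) (hv : 0 < v)
    (hp : 1 ≤ p) (N : ℕ) :
    ∃ c k : ℝ, 0 < c ∧ c < a / 4 ∧ 0 < k ∧ 2 * c ^ p * β ≤ (2 ^ N * ((2 : ℝ) ^ p) ^ 2)⁻¹ ∧
      2 * β * y₀ * 2 ^ p ≤ v * c ^ N * k ^ p := by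
  have hp0 : 0 < p := by linarith
  set l : ℝ := (2 ^ N * ((2 : ℝ) ^ p) ^ 2)⁻¹ with hl
  have hl0 : 0 < l := by positivity
  set c := min (a / 8) ((l / (2 * β)) ^ (1 / p)) with hc
  have hc0 : 0 < c := lt_min (by positivity) (by positivity)
  refine ⟨c, (max (2 * β * y₀ * 2 ^ p / (v * c ^ N)) 1) ^ (1 / p), hc0,
    (min_le_left _ _).trans_lt (by linarith), by positivity, ?_, ?_⟩
  · have : c ^ p ≤ l / (2 * β) := by
      calc c ^ p ≤ ((l / (2 * β)) ^ (1 / p)) ^ p := by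
            gcongr
            exact min_le_right _ _
        _ = _ := by rw [← Real.rpow_mul (by positivity), one_div_mul_cancel hp0.ne', Real.rpow_one]
    calc 2 * c ^ p * β ≤ 2 * (l / (2 * β)) * β := by gcongr
      _ = l := by field_simp
  · rw [← Real.rpow_mul (by positivity), one_div_mul_cancel hp0.ne', Real.rpow_one]
    calc 2 * β * y₀ * 2 ^ p = v * c ^ N * (2 * β * y₀ * 2 ^ p / (v * c ^ N)) := by field_simp
      _ ≤ _ := by
        gcongr
        exact le_max_left _ _

/-- Local boundedness from above on smaller cylinders, by De Giorgi iteration. -/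
theorem ClassAPlus.exists_excess_eq_zero (hu : ClassAPlus E p γ u) (hγ : 0 < γ) (hp : 1 ≤ p)
    {R R' T T' : ℝ} (hR : 0 < R) (hRR : R < R') (hT : 0 < T) (hTT : T < T')
    (hE : CompactlyContained (parCylinder y s R' T') E) :
    ∃ k : ℝ, excess p u y s R T k = 0 := by
  have hp0 : 0 < p := by linarith
  set a := R' - R with ha
  set b := T' - T with hb
  have ha0 : 0 < a := by linarith
  have hb0 : 0 < b := by linarith
  set β := γ / (a / 4) ^ p + γ / (b / 2) with hβ
  have hβ0 : 0 < β := by positivity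
  set v := (volume (Metric.ball (0 : EuclideanSpace ℝ (Fin N)) 1)).toReal with hv
  have hv0 : 0 < v := ENNReal.toReal_pos (Metric.measure_ball_pos _ _ one_pos).ne'
    measure_ball_lt_top.ne
  have hY0 := hu.excess_ne_top hp (by linarith) (by linarith) hE
  set y₀ := (excess p u y s R' T' 0).toReal with hy₀
  have hy₀0 : 0 ≤ y₀ := ENNReal.toReal_nonneg
  obtain ⟨c, k, hc0, hca, hk0, hc1, hk1⟩ :=
    exists_iteration_constants (a := a) (β := β) (v := v) (y₀ := y₀) ha0 hβ0 hv0 hp N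
  set q : ℝ := 2 ^ p with hq
  have hq0 : 0 < q := by positivity
  -- With this decay ratio both sides of the smallness condition scale by the same factor 2^{-Nn}
  -- q^{-n}, so the single choice of `k` serves every step.
  set l : ℝ := (2 ^ N * q ^ 2)⁻¹ with hl
  have hl0 : 0 < l := by positivity
  have hball : ∀ r : ℝ, 0 < r → volume (Metric.ball (0 : EuclideanSpace ℝ (Fin N)) r)
      = ENNReal.ofReal (v * r ^ N) := by
    intro r hr
    rw [Measure.addHaar_ball_of_pos _ _ hr, finrank_euclideanSpace_fin, mul_comm v,
      ENNReal.ofReal_mul (by positivity), ENNReal.ofReal_toReal measure_ball_lt_top.ne]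
  have hind : ∀ n : ℕ, excess p u y s (R + a * (1 / 2) ^ n) (T + b * (1 / 2) ^ n)
      (k * (1 - (1 / 2) ^ n)) ≤ ENNReal.ofReal (l ^ n * y₀) := by
    intro n
    induction n with
    | zero =>
      simp only [pow_zero, mul_one, sub_self, mul_zero, one_mul, ha, hb, add_sub_cancel]
      rw [hy₀, ENNReal.ofReal_toReal hY0]
    | succ n ih =>
      set d : ℝ := (1 / 2) ^ n with hd
      have hd0 : 0 < d := by positivity
      have hd1 : d ≤ 1 := pow_le_one₀ (by norm_num) (by norm_num)
      have hdp : d ^ p = (q ^ n)⁻¹ := by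
        rw [hd, ← Real.rpow_natCast, ← Real.rpow_mul (by norm_num), mul_comm,
          Real.rpow_mul (by norm_num), Real.rpow_natCast, ← inv_pow, one_div,
          Real.inv_rpow (by norm_num)]
      have hsucc : (1 / 2 : ℝ) ^ (n + 1) = d / 2 := by rw [pow_succ, hd]; ring
      have hcoef := energy_coefficient_le hγ ha0 hb0 hp n
      have hcd : c * d < a / 4 * d := mul_lt_mul_of_pos_right hca hd0
      have had : 0 < a * d := by positivity
      have hbd : 0 < b * d := by positivity
      have hkd : 0 < k * d := by positivity
      have hEn : CompactlyContained (parCylinder y s (R + a * d) (T + b * d)) E := by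
        refine hE.mono (parCylinder_mono y s ?_ ?_)
        · have := mul_le_mul_of_nonneg_left hd1 ha0.le
          linarith
        · have := mul_le_mul_of_nonneg_left hd1 hb0.le
          linarith
      have eR : R + a * d - (R + 3 / 4 * a * d) = a / 4 * d := by ring
      have eT : T + b * d - (T + b * (d / 2)) = b / 2 * d := by ring
      have ek : k * (1 - d / 2) - k * (1 - d) = k * (d / 2) := by ring
      have hBY : ENNReal.ofReal (γ / (a / 4 * d) ^ p + γ / (b / 2 * d)) *
          excess p u y s (R + a * d) (T + b * d) (k * (1 - d))
          ≤ ENNReal.ofReal (β * q ^ n * (l ^ n * y₀)) := by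
        rw [ENNReal.ofReal_mul (by positivity)]
        exact mul_le_mul' (ENNReal.ofReal_le_ofReal hcoef) ih
      have hql : q ^ n * l ^ n = d ^ N * (q ^ n)⁻¹ := by
        rw [hl, hd, ← pow_mul, mul_comm n N, pow_mul, ← inv_pow, ← mul_pow, ← mul_pow]
        congr 1
        rw [one_div, inv_pow]
        field_simp
      -- The gap in radius from step n to n + 1 is a d / 2. Its outer half is spent on the energy
      -- inequality, and its inner half leaves room for translations of length c d < a d / 4.
      have hstep := hu.excess_le (y := y) (s := s) (ρ := R + a * (d / 2)) (ε := c * d)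
        (r := R + 3 / 4 * a * d) (R := R + a * d) (τ := T + b * (d / 2)) (T := T + b * d)
        (k := k * (1 - d)) (k' := k * (1 - d / 2)) hp
        (by positivity) (by positivity) (by linarith) (by linarith) (by positivity)
        (by linarith) (by linarith) hEn
        (ih.trans_lt ENNReal.ofReal_lt_top).ne
      rw [eR, eT, ek] at hstep
      rw [hsucc]
      refine (hstep ?_).trans ?_
      · have h2 : (2 : ℝ≥0∞) = ENNReal.ofReal 2 := by simp
        refine (mul_le_mul_right hBY 2).trans ?_
        rw [hball _ (by positivity), ENNReal.ofReal_rpow_of_pos (by positivity), h2,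
          ← ENNReal.ofReal_mul (by norm_num), ← ENNReal.ofReal_mul (by positivity)]
        refine ENNReal.ofReal_le_ofReal ?_
        have e1 : 2 * (β * q ^ n * (l ^ n * y₀)) = 2 * β * y₀ * q * (q⁻¹ * (q ^ n * l ^ n)) := by
          field_simp
        have e2 : v * (c * d) ^ N * (k * (d / 2)) ^ p
            = v * c ^ N * k ^ p * (q⁻¹ * (d ^ N * (q ^ n)⁻¹)) := by
          rw [Real.mul_rpow hk0.le (by positivity), Real.div_rpow hd0.le (by norm_num), hdp,
            mul_pow, ← hq]
          ring
        rw [e1, e2, hql]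
        gcongr
      · have h2 : (2 : ℝ≥0∞) = ENNReal.ofReal 2 := by simp
        refine (mul_le_mul_right (mul_le_mul_right hBY _) 2).trans ?_
        rw [ENNReal.ofReal_rpow_of_pos (by positivity), h2,
          ← ENNReal.ofReal_mul (by positivity), ← ENNReal.ofReal_mul (by positivity)]
        refine ENNReal.ofReal_le_ofReal ?_
        rw [Real.mul_rpow hc0.le hd0.le, hdp, pow_succ]
        calc 2 * (c ^ p * (q ^ n)⁻¹ * (β * q ^ n * (l ^ n * y₀)))
            = (2 * c ^ p * β) * (l ^ n * y₀) := by field_simp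
          _ ≤ l * (l ^ n * y₀) := by gcongr
          _ = _ := by ring
  refine ⟨k, ?_⟩
  have hl1 : l < 1 := by
    refine inv_lt_one_of_one_lt₀ ?_
    have h1 : (1 : ℝ) < q := Real.one_lt_rpow (by norm_num) hp0
    have h2 : (1 : ℝ) ≤ 2 ^ N := one_le_pow₀ (by norm_num)
    nlinarith
  have hlim : Tendsto (fun n : ℕ => ENNReal.ofReal (l ^ n * y₀)) atTop (𝓝 0) := by
    have := ENNReal.tendsto_ofReal ((tendsto_pow_atTop_nhds_zero_of_lt_one hl0.le hl1).mul_const y₀)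
    simpa using this
  refine le_antisymm (ge_of_tendsto' hlim fun n => (excess_mono hp0.le ?_ ?_ ?_).trans (hind n))
    bot_le
  · have : 0 < a * (1 / 2) ^ n := by positivity
    linarith
  · have : 0 < b * (1 / 2) ^ n := by positivity
    linarith
  · have : 0 < k * (1 / 2) ^ n := by positivity
    linarith

theorem norm_sub_le_of_mem_cube {x : EuclideanSpace ℝ (Fin N)} {ρ : ℝ} (hx : x ∈ cube y ρ) :
    ‖x - y‖ ≤ N * |ρ| := by
  have h1 : x - y = ∑ i, (x i - y i) • EuclideanSpace.single i (1 : ℝ) := by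
    have := (EuclideanSpace.basisFun (Fin N) ℝ).sum_repr (x - y)
    simpa using this.symm
  rw [h1]
  refine (norm_sum_le _ _).trans ?_
  have : ∀ i ∈ Finset.univ, ‖(x i - y i) • EuclideanSpace.single i (1 : ℝ)‖ ≤ |ρ| := by
    intro i _
    rw [norm_smul, PiLp.norm_single, norm_one, mul_one]
    exact (hx i).le.trans (le_abs_self _)
  refine (Finset.sum_le_sum this).trans (le_of_eq ?_)
  simp

/-- A compactly contained cylinder can be enlarged. -/
theorem CompactlyContained.exists_larger {R T : ℝ} (hE : IsOpen E) (hR : 0 < R) (hT : 0 < T)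
    (h : CompactlyContained (parCylinder y s R T) E) :
    ∃ R' T', R < R' ∧ T < T' ∧ CompactlyContained (parCylinder y s R' T') E := by
  obtain ⟨δ, hδ, hδE⟩ := h.1.exists_cthickening_subset_open hE h.2
  -- Dilation about (y, s) by 1 + κ displaces a point of the cylinder by at most κ N R in space and
  -- κ T in time, hence by at most δ.
  set κ : ℝ := δ / (N * R + T) with hκ
  have hNR : 0 < N * R + T := by positivity
  have hκ0 : 0 < κ := by positivity
  have hκδ : κ * (N * R) ≤ δ ∧ κ * T ≤ δ := by
    have : κ * (N * R + T) = δ := by rw [hκ]; field_simp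
    constructor <;> nlinarith [show 0 ≤ κ * (N * R) by positivity, show 0 ≤ κ * T by positivity]
  have hsub : parCylinder y s ((1 + κ) * R) ((1 + κ) * T) ⊆
      Metric.cthickening δ (closure (parCylinder y s R T)) := by
    rintro ⟨x, t⟩ ⟨hx, ht⟩
    have hκ1 : 0 < 1 + κ := by linarith
    -- The preimage under the dilation lies in the original cylinder and within δ of the given
    -- point.
    set x' := y + (1 + κ)⁻¹ • (x - y) with hx'
    set t' := s + (1 + κ)⁻¹ * (t - s) with ht'
    have hxmem : x' ∈ cube y R := by
      intro i
      have : x' i - y i = (1 + κ)⁻¹ * (x i - y i) := by simp [hx']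
      rw [this, abs_mul, abs_of_pos (inv_pos.2 hκ1), inv_mul_lt_iff₀ hκ1]
      exact hx i
    have htmem : t' ∈ Ioc (s - T) s := by
      simp only [mem_Ioc] at ht ⊢
      have h1 : (1 + κ)⁻¹ * (s - t) < T := by
        rw [inv_mul_lt_iff₀ hκ1]; linarith
      have h2 : 0 ≤ (1 + κ)⁻¹ * (s - t) := mul_nonneg (inv_pos.2 hκ1).le (by linarith)
      constructor <;> linarith
    refine Metric.mem_cthickening_of_dist_le (x, t) (x', t') δ _
      (subset_closure ⟨hxmem, htmem⟩) ?_
    rw [Prod.dist_eq]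
    refine max_le ?_ ?_
    · have e : x - x' = κ • (x' - y) := by
        have : (x - y) = (1 + κ) • (x' - y) := by
          simp [hx', smul_smul, hκ1.ne']
        rw [add_smul, one_smul] at this
        rw [← sub_eq_iff_eq_add'] at this
        rw [← this]
        abel
      simp only [dist_eq_norm]
      rw [e, norm_smul, Real.norm_of_nonneg hκ0.le]
      have := norm_sub_le_of_mem_cube hxmem
      rw [abs_of_pos hR] at this
      exact (mul_le_mul_of_nonneg_left this hκ0.le).trans hκδ.1
    · have e : t - t' = κ * (t' - s) := by
        rw [ht']; field_simp; ring
      simp only [dist_eq_norm]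
      rw [e, norm_mul, Real.norm_of_nonneg hκ0.le]
      have : ‖t' - s‖ ≤ T := by
        rw [Real.norm_eq_abs, abs_le]
        constructor <;> linarith [htmem.1, htmem.2]
      exact (mul_le_mul_of_nonneg_left this hκ0.le).trans hκδ.2
  refine ⟨(1 + κ) * R, (1 + κ) * T, by nlinarith, by nlinarith, ?_⟩
  have hcl := closure_minimal hsub Metric.isClosed_cthickening
  exact ⟨(h.1.cthickening).of_isClosed_subset isClosed_closure hcl, hcl.trans hδE⟩

/-- Functions in the parabolic De Giorgi class are locally bounded above. -/
theorem ClassAPlus.exists_ae_le (hu : ClassAPlus E p γ u) (hE : IsOpen E) (hγ : 0 < γ)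
    (hp : 1 ≤ p) {R T : ℝ} (hR : 0 < R) (hT : 0 < T)
    (h : CompactlyContained (parCylinder y s R T) E) :
    ∃ M : ℝ, ∀ᵐ z ∂(volume.restrict (parCylinder y s R T)), u z ≤ M := by
  obtain ⟨R', T', hRR, hTT, h'⟩ := h.exists_larger hE hR hT
  obtain ⟨k, hk⟩ := hu.exists_excess_eq_zero hγ hp hR hRR hT hTT h'
  refine ⟨k, ?_⟩
  have huE : AEMeasurable u (volume.restrict (parCylinder y s R T)) :=
    hu.1.1.mono_measure (Measure.restrict_mono h.subset le_rfl)
  rw [excess, lintegral_eq_zero_iff'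
    ((aemeasurable_truncPlus huE k).pow_const p).ennreal_ofReal] at hk
  filter_upwards [hk] with z hz
  simp only [Pi.zero_apply, ENNReal.ofReal_eq_zero] at hz
  by_contra hcon
  have hpos : 0 < truncPlus u k z := lt_max_of_lt_left (by linarith)
  exact absurd hz (not_le.2 (Real.rpow_pos_of_pos hpos p))

end Boundedness

/-! ### Convex functions: left derivatives and the slope ladder. -/

section Convex

variable {ψ : ℝ → ℝ}

/-- The left derivative of a convex function, as the supremum of its backward slopes. -/
noncomputable def leftSlope (ψ : ℝ → ℝ) (s : ℝ) : ℝ :=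
  ⨆ n : ℕ, ((n : ℝ) + 1) * (ψ s - ψ (s - 1 / (n + 1)))

/-- Both chords are compared with the chord over [a, d]. -/
theorem slope_le_slope (hc : ConvexOn ℝ univ ψ) {a b c d : ℝ} (hab : a < b) (hcd : c < d)
    (hac : a ≤ c) (hbd : b ≤ d) : (ψ b - ψ a) / (b - a) ≤ (ψ d - ψ c) / (d - c) := by
  have h1 : (ψ b - ψ a) / (b - a) ≤ (ψ d - ψ a) / (d - a) :=
    hc.secant_mono (mem_univ a) (mem_univ b) (mem_univ d) hab.ne' (by linarith) hbd
  have h2 := hc.secant_mono (mem_univ d) (mem_univ a) (mem_univ c) (by linarith) hcd.ne hac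
  have e : ∀ x, (ψ x - ψ d) / (x - d) = (ψ d - ψ x) / (d - x) := fun x => by
    rw [← neg_sub (ψ d), ← neg_sub d, neg_div_neg_eq]
  rw [e, e] at h2
  exact h1.trans h2

theorem backwardSlope_eq (ψ : ℝ → ℝ) (s : ℝ) (n : ℕ) :
    ((n : ℝ) + 1) * (ψ s - ψ (s - 1 / (n + 1)))
      = (ψ s - ψ (s - 1 / (n + 1))) / (s - (s - 1 / (n + 1))) := by
  rw [sub_sub_cancel, div_div_eq_mul_div, div_one, mul_comm]

theorem backwardSlope_le (hc : ConvexOn ℝ univ ψ) {s r : ℝ} (h : s < r) (n : ℕ) :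
    ((n : ℝ) + 1) * (ψ s - ψ (s - 1 / (n + 1))) ≤ (ψ r - ψ s) / (r - s) := by
  have : (0 : ℝ) < 1 / (n + 1) := by positivity
  rw [backwardSlope_eq]
  exact slope_le_slope hc (by linarith) h (by linarith) h.le

theorem bddAbove_backwardSlope (hc : ConvexOn ℝ univ ψ) (s : ℝ) :
    BddAbove (range fun n : ℕ => ((n : ℝ) + 1) * (ψ s - ψ (s - 1 / (n + 1)))) := by
  refine ⟨(ψ (s + 1) - ψ s) / (s + 1 - s), ?_⟩
  rintro _ ⟨n, rfl⟩
  exact backwardSlope_le hc (by linarith) n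

theorem backwardSlope_le_leftSlope (hc : ConvexOn ℝ univ ψ) (s : ℝ) (n : ℕ) :
    ((n : ℝ) + 1) * (ψ s - ψ (s - 1 / (n + 1))) ≤ leftSlope ψ s :=
  le_ciSup (bddAbove_backwardSlope hc s) n

theorem hasLeftSlope_leftSlope (hc : ConvexOn ℝ univ ψ) : HasLeftSlope ψ (leftSlope ψ) := by
  intro s
  refine tendsto_atTop_ciSup (fun m n hmn => ?_) (bddAbove_backwardSlope hc s)
  have hm : (0 : ℝ) < 1 / (m + 1) := by positivity
  have hn : (0 : ℝ) < 1 / (n + 1) := by positivity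
  have hmn' : (1 : ℝ) / (n + 1) ≤ 1 / (m + 1) := by gcongr
  simp only [backwardSlope_eq]
  exact slope_le_slope hc (by linarith) (by linarith) (by linarith) le_rfl

theorem leftSlope_le (hc : ConvexOn ℝ univ ψ) {s r : ℝ} (h : s < r) :
    leftSlope ψ s ≤ (ψ r - ψ s) / (r - s) :=
  ciSup_le fun n => backwardSlope_le hc h n

theorem le_leftSlope (hc : ConvexOn ℝ univ ψ) {s r : ℝ} (h : r < s) :
    (ψ s - ψ r) / (s - r) ≤ leftSlope ψ s := by
  obtain ⟨n, hn⟩ := exists_nat_one_div_lt (sub_pos.2 h)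
  refine le_trans ?_ (backwardSlope_le_leftSlope hc s n)
  have h0 : (0 : ℝ) < 1 / (n + 1) := by positivity
  rw [backwardSlope_eq]
  exact slope_le_slope hc h (by linarith) (by linarith) le_rfl

theorem leftSlope_mono (hc : ConvexOn ℝ univ ψ) : Monotone (leftSlope ψ) := by
  intro s r h
  rcases h.eq_or_lt with rfl | h
  · rfl
  · exact (leftSlope_le hc h).trans (le_leftSlope hc h)

theorem leftSlope_nonneg (hc : ConvexOn ℝ univ ψ) (hm : Monotone ψ) (s : ℝ) :
    0 ≤ leftSlope ψ s :=
  le_trans (div_nonneg (sub_nonneg.2 (hm (by linarith))) (by linarith))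
    (le_leftSlope hc (show s - 1 < s by linarith))

theorem continuous_of_convexOn_univ (hc : ConvexOn ℝ univ ψ) : Continuous ψ :=
  continuousOn_univ.1 (hc.continuousOn isOpen_univ)

/-- The left derivative is a supremum of continuous functions, hence lower semicontinuous. This
makes the infimum of such a set lie strictly below each of its points. -/
theorem isOpen_lt_leftSlope (hc : ConvexOn ℝ univ ψ) (c : ℝ) : IsOpen {s | c < leftSlope ψ s} := by
  have hcont := continuous_of_convexOn_univ hc
  have : {s | c < leftSlope ψ s}
      = ⋃ n : ℕ, {s | c < ((n : ℝ) + 1) * (ψ s - ψ (s - 1 / (n + 1)))} := by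
    ext s
    simp only [mem_iUnion, mem_ofPred_eq]
    exact lt_ciSup_iff (bddAbove_backwardSlope hc s)
  rw [this]
  exact isOpen_iUnion fun n => isOpen_lt continuous_const (by fun_prop)

/-- The convex function cut off at height `ψ M` is Lipschitz. -/
theorem exists_lipschitzWith_comp_min (hc : ConvexOn ℝ univ ψ) (hm : Monotone ψ) (M : ℝ) :
    ∃ L : ℝ≥0, LipschitzWith L fun s => ψ (min s M) := by
  -- The slope over [M, M + 1] dominates every slope to the left of M, and is the Lipschitz
  -- constant.
  have hL : 0 ≤ ψ (M + 1) - ψ M := sub_nonneg.2 (hm (by linarith))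
  have key : ∀ a b, a < b → b ≤ M → ψ b - ψ a ≤ (ψ (M + 1) - ψ M) * (b - a) := by
    intro a b hab hb
    have := slope_le_slope hc hab (show M < M + 1 by linarith) (by linarith) (by linarith)
    rw [add_sub_cancel_left, div_one, div_le_iff₀ (by linarith)] at this
    exact this
  refine ⟨⟨ψ (M + 1) - ψ M, hL⟩, LipschitzWith.of_le_add_mul _ fun a b => ?_⟩
  change ψ (min a M) ≤ ψ (min b M) + (ψ (M + 1) - ψ M) * dist a b
  rcases le_or_gt (min a M) (min b M) with h | h
  · have := hm h
    have := mul_nonneg hL (dist_nonneg (x := a) (y := b))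
    linarith
  · have h1 := key _ _ h (min_le_right a M)
    have h2 : min a M - min b M ≤ dist a b := by
      have := abs_min_sub_min_le_max a M b M
      rw [sub_self, abs_zero, max_eq_left (abs_nonneg _)] at this
      exact (le_abs_self _).trans this
    have := mul_le_mul_of_nonneg_left h2 hL
    linarith

/-- Backward steps from s ≤ M stay on the uncut branch, so the corner at M does not affect the left
derivative, not even at M itself. -/
theorem hasLeftSlope_comp_min (hc : ConvexOn ℝ univ ψ) (M : ℝ) :
    HasLeftSlope (fun s => ψ (min s M)) (fun s => if s ≤ M then leftSlope ψ s else 0) := by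
  intro s
  dsimp only
  split_ifs with h
  · refine (hasLeftSlope_leftSlope hc s).congr fun n => ?_
    have : (0 : ℝ) < 1 / (n + 1) := by positivity
    rw [min_eq_left h, min_eq_left (by linarith)]
  · rw [not_le] at h
    have hsmall : ∀ᶠ n : ℕ in atTop, (1 : ℝ) / (n + 1) < s - M :=
      (tendsto_one_div_add_atTop_nhds_zero_nat (𝕜 := ℝ)).eventually_lt_const (by linarith)
    refine tendsto_const_nhds.congr' ?_
    filter_upwards [hsmall] with n hn
    rw [min_eq_right h.le, min_eq_right (by linarith), sub_self, mul_zero]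

/-- Superadditivity of t^p for p ≥ 1, iterated. -/
theorem sum_rpow_le_rpow_sum {ι : Type*} (t : Finset ι) {f : ι → ℝ} (hf : ∀ i, 0 ≤ f i) {p : ℝ}
    (hp : 1 ≤ p) : ∑ i ∈ t, f i ^ p ≤ (∑ i ∈ t, f i) ^ p := by
  classical
  induction t using Finset.induction_on with
  | empty => simp [Real.zero_rpow (show p ≠ 0 by linarith)]
  | insert a t ha ih =>
    rw [Finset.sum_insert ha, Finset.sum_insert ha]
    exact (add_le_add_right ih _).trans
      (Real.add_rpow_le_rpow_add (hf a) (Finset.sum_nonneg fun i _ => hf i) hp)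

/-- Induction on `n`. Past κ_n, split (s - κ_j)_+ ≤ (s - κ_n) + (κ_n - κ_j)_+. The last parts sum to
at most 2ψ(κ_n) by induction. The slopes with j < n add up to less than δ 2^n, so with the top line
they contribute at most 2 δ 2^n (s - κ_n). Twice the line starting at κ_n accounts for both. The κ_j
need not be ordered. -/
theorem sum_geometric_lines_le (hψ0 : ∀ s, 0 ≤ ψ s) {δ : ℝ} (hδ : 0 < δ) {κ : ℕ → ℝ} (n : ℕ)
    (h : ∀ j < n, ∀ s, κ j ≤ s → ψ (κ j) + δ * 2 ^ j * (s - κ j) ≤ ψ s) (s : ℝ) :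
    ∑ j ∈ Finset.range n, δ * 2 ^ j * max (s - κ j) 0 ≤ 2 * ψ s := by
  induction n generalizing s with
  | zero => simpa using hψ0 s
  | succ n ih =>
    have ih' := ih fun j hj => h j (by omega)
    rw [Finset.sum_range_succ]
    rcases le_or_gt s (κ n) with hs | hs
    · rw [max_eq_right (by linarith), mul_zero, add_zero]
      exact ih' s
    · have h1 : ∑ j ∈ Finset.range n, δ * 2 ^ j * max (s - κ j) 0
          ≤ ∑ j ∈ Finset.range n, (δ * 2 ^ j * (s - κ n) + δ * 2 ^ j * max (κ n - κ j) 0) := by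
        refine Finset.sum_le_sum fun j _ => ?_
        rw [← mul_add]
        gcongr
        refine max_le ?_ ?_
        · linarith [le_max_left (κ n - κ j) 0]
        · linarith [le_max_right (κ n - κ j) 0]
      rw [Finset.sum_add_distrib, ← Finset.sum_mul, ← Finset.mul_sum,
        geom_sum_eq (by norm_num : (2 : ℝ) ≠ 1)] at h1
      have h2 := ih' (κ n)
      have h3 := h n (by omega) s hs.le
      rw [max_eq_left (by linarith)]
      have h4 : δ * (((2 : ℝ) ^ n - 1) / (2 - 1)) * (s - κ n) ≤ δ * 2 ^ n * (s - κ n) := by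
        have : 0 ≤ s - κ n := by linarith
        gcongr
        norm_num
      linarith

/-- Decomposition of the left derivative of a convex function along dyadic slopes. -/
theorem exists_slope_ladder (hc : ConvexOn ℝ univ ψ) (hψ0 : ∀ s, 0 ≤ ψ s)
    {p : ℝ} (hp : 1 ≤ p) {δ : ℝ} (hδ : 0 < δ) (M : ℝ) (hm : Monotone ψ) :
    ∃ (n : ℕ) (κ : ℕ → ℝ),
      (∀ s ≤ M, leftSlope ψ s ^ p ≤ δ ^ p + 2 ^ p *
        ∑ j ∈ Finset.range n, (δ * 2 ^ j) ^ p * (if κ j < s then 1 else 0)) ∧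
      ∀ s, ∑ j ∈ Finset.range n, (δ * 2 ^ j) ^ p * max (s - κ j) 0 ^ p ≤ 2 ^ p * ψ s ^ p := by
  have hcont := continuous_of_convexOn_univ hc
  have hp0 : 0 < p := by linarith
  have hex : ∃ n : ℕ, leftSlope ψ M ≤ δ * 2 ^ n := by
    obtain ⟨n, hn⟩ := pow_unbounded_of_one_lt (leftSlope ψ M / δ) (one_lt_two)
    exact ⟨n, by rw [div_lt_iff₀ hδ] at hn; linarith⟩
  classical
  -- Minimality puts M in every set S_j with j < n, so these thresholds are infima of nonempty sets.
  set n := Nat.find hex with hn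
  have hnM : leftSlope ψ M ≤ δ * 2 ^ n := Nat.find_spec hex
  have hlt : ∀ j < n, δ * 2 ^ j < leftSlope ψ M := fun j hj => not_le.1 (Nat.find_min hex hj)
  set S : ℕ → Set ℝ := fun j => {s | δ * 2 ^ j < leftSlope ψ s} with hS
  set κ : ℕ → ℝ := fun j => sInf (S j) with hκ
  have hbdd : ∀ j, BddBelow (S j) := by
    intro j
    -- From a point s < M of S_j, ψ rises with slope at least δ 2^j up to M; as ψ(s) ≥ 0, the
    -- distance M - s is bounded.
    refine ⟨M - ψ M / (δ * 2 ^ j), fun s hs => ?_⟩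
    have hs' : δ * 2 ^ j < leftSlope ψ s := hs
    have hd : 0 < δ * 2 ^ j := by positivity
    rcases lt_or_ge s M with h | h
    · have h1 := hs'.trans_le (leftSlope_le hc h)
      rw [lt_div_iff₀ (by linarith)] at h1
      rw [sub_le_comm, le_div_iff₀ hd]
      linarith [hψ0 s]
    · have := div_nonneg (hψ0 M) hd.le
      linarith
  have hgt : ∀ j s, s ∈ S j → κ j < s := by
    intro j s hs
    obtain ⟨r, hrs, hr⟩ := exists_Ioc_subset_of_mem_nhds
      ((isOpen_lt_leftSlope hc (δ * 2 ^ j)).mem_nhds hs) ⟨s - 1, by linarith⟩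
    have hmid : (r + s) / 2 ∈ S j := hr ⟨by linarith, by linarith⟩
    exact (csInf_le (hbdd j) hmid).trans_lt (by linarith)
  have hline : ∀ j < n, ∀ s, κ j ≤ s → ψ (κ j) + δ * 2 ^ j * (s - κ j) ≤ ψ s := by
    intro j hj s hs
    rcases hs.eq_or_lt with h | h
    · rw [← h]; simp
    -- The threshold itself does not belong to S_j, so the line is obtained as a limit of lines
    -- starting at points r > κ_j, where the left slope does exceed δ 2^j.
    have hlim : Tendsto (fun r => ψ r + δ * 2 ^ j * (s - r)) (𝓝[>] (κ j))
        (𝓝 (ψ (κ j) + δ * 2 ^ j * (s - κ j))) :=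
      ((by fun_prop : Continuous fun r => ψ r + δ * 2 ^ j * (s - r)).tendsto _).mono_left
        nhdsWithin_le_nhds
    refine le_of_tendsto hlim ?_
    filter_upwards [Ioo_mem_nhdsGT h] with r hr
    obtain ⟨r', hr'S, hr'⟩ := exists_lt_of_csInf_lt ⟨M, hlt j hj⟩ hr.1
    have h1 : δ * 2 ^ j < leftSlope ψ r := lt_of_lt_of_le hr'S (leftSlope_mono hc hr'.le)
    have h2 := h1.trans_le (leftSlope_le hc hr.2)
    rw [lt_div_iff₀ (by linarith [hr.2])] at h2
    linarith
  refine ⟨n, κ, fun s hs => ?_, fun s => ?_⟩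
  · have hd0 := leftSlope_nonneg hc hm s
    have hnn : ∀ j ∈ Finset.range n, 0 ≤ (δ * 2 ^ j) ^ p * (if κ j < s then (1 : ℝ) else 0) :=
      fun j _ => mul_nonneg (by positivity) (by split_ifs <;> norm_num)
    rcases le_or_gt (leftSlope ψ s) δ with h | h
    · have h1 := Real.rpow_le_rpow hd0 h hp0.le
      have h2 := mul_nonneg (by positivity : (0 : ℝ) ≤ 2 ^ p) (Finset.sum_nonneg hnn)
      linarith
    · have hex' : ∃ i : ℕ, leftSlope ψ s ≤ δ * 2 ^ i :=
        ⟨n, (leftSlope_mono hc hs).trans hnM⟩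
      set i := Nat.find hex' with hi
      have hi1 : leftSlope ψ s ≤ δ * 2 ^ i := Nat.find_spec hex'
      have hi0 : i ≠ 0 := by
        intro h0
        rw [h0] at hi1
        simp only [pow_zero, mul_one] at hi1
        linarith
      obtain ⟨j, hj⟩ := Nat.exists_eq_succ_of_ne_zero hi0
      have hin : i ≤ n := Nat.find_min' hex' ((leftSlope_mono hc hs).trans hnM)
      -- The slope at s lies in (δ 2^j, δ 2^{j+1}], so the single term `j` already suffices, at the
      -- cost of the factor 2^p.
      have hjs : δ * 2 ^ j < leftSlope ψ s :=
        not_le.1 (Nat.find_min hex' (show j < Nat.find hex' by rw [← hi, hj]; exact j.lt_succ_self))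
      have hjn : j ∈ Finset.range n := by
        rw [Finset.mem_range]; omega
      have h1 : (δ * 2 ^ j) ^ p ≤
          ∑ j ∈ Finset.range n, (δ * 2 ^ j) ^ p * (if κ j < s then (1 : ℝ) else 0) := by
        refine le_trans (le_of_eq ?_) (Finset.single_le_sum hnn hjn)
        rw [if_pos (hgt j s hjs), mul_one]
      have h2 : leftSlope ψ s ^ p ≤ 2 ^ p * (δ * 2 ^ j) ^ p := by
        rw [← Real.mul_rpow (by norm_num) (by positivity)]
        refine Real.rpow_le_rpow hd0 (hi1.trans (le_of_eq ?_)) hp0.le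
        rw [hj, pow_succ]; ring
      have h3 := mul_le_mul_of_nonneg_left h1 (by positivity : (0 : ℝ) ≤ 2 ^ p)
      have h4 : 0 ≤ δ ^ p := by positivity
      linarith
  · rw [← Real.mul_rpow (by norm_num) (hψ0 s)]
    have hnn : ∀ j, 0 ≤ δ * 2 ^ j * max (s - κ j) 0 := fun j =>
      mul_nonneg (by positivity) (le_max_right _ _)
    calc _ = ∑ j ∈ Finset.range n, (δ * 2 ^ j * max (s - κ j) 0) ^ p :=
          Finset.sum_congr rfl fun j _ =>
            (Real.mul_rpow (by positivity) (le_max_right _ _)).symm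
      _ ≤ (∑ j ∈ Finset.range n, δ * 2 ^ j * max (s - κ j) 0) ^ p :=
          sum_rpow_le_rpow_sum _ hnn hp
      _ ≤ _ := Real.rpow_le_rpow (Finset.sum_nonneg fun j _ => hnn j)
          (sum_geometric_lines_le hψ0 hδ n hline s) hp0.le

end Convex

/-! ### The value ladder: powers of convex functions against powers of truncations. -/

section ValueLadder

variable {ψ : ℝ → ℝ}

/-- Bernoulli's inequality for (b/a)^p. -/
theorem rpow_sub_rpow_le {a b p : ℝ} (hb : 0 ≤ b) (hab : b ≤ a) (hp : 1 ≤ p) :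
    a ^ p - b ^ p ≤ p * a ^ (p - 1) * (a - b) := by
  rcases (hb.trans hab).eq_or_lt with h0 | ha
  · have : b = 0 := le_antisymm (hab.trans h0.ge) hb
    simp [this, ← h0]
  have h := one_add_mul_self_le_rpow_one_add (s := b / a - 1) (p := p)
    (by have := div_nonneg hb ha.le; linarith) hp
  rw [add_sub_cancel, Real.div_rpow hb ha.le, le_div_iff₀ (by positivity)] at h
  have e : a ^ p = a ^ (p - 1) * a := by
    rw [Real.rpow_sub_one ha.ne']; field_simp
  have e2 : (1 + p * (b / a - 1)) * a ^ p = a ^ p - p * a ^ (p - 1) * (a - b) := by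
    rw [e]; field_simp; ring
  linarith

/-- The coefficients `m₀ ^ p, m₁ ^ p - m₀ ^ p, …`. -/
noncomputable def ladderCoeff (p : ℝ) (m : ℕ → ℝ) : ℕ → ℝ
  | 0 => m 0 ^ p
  | n + 1 => m (n + 1) ^ p - m n ^ p

theorem ladderCoeff_nonneg {p : ℝ} (hp : 0 ≤ p) {m : ℕ → ℝ} (hm0 : ∀ n, 0 ≤ m n)
    (hm : Monotone m) (n : ℕ) : 0 ≤ ladderCoeff p m n := by
  cases n with
  | zero => exact Real.rpow_nonneg (hm0 0) p
  | succ n => exact sub_nonneg.2 (Real.rpow_le_rpow (hm0 n) (hm n.le_succ) hp)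

/-- The combination of powers `Σ_{j ≤ n} (m_j ^ p - m_{j-1} ^ p) (s - κ_j)_+ ^ p`. -/
noncomputable def ladderSum (p : ℝ) (m κ : ℕ → ℝ) (n : ℕ) (s : ℝ) : ℝ :=
  ∑ j ∈ Finset.range (n + 1), ladderCoeff p m j * max (s - κ j) 0 ^ p

variable {p ε : ℝ} {m κ : ℕ → ℝ}

theorem ladderSum_succ (n : ℕ) (s : ℝ) : ladderSum p m κ (n + 1) s =
    ladderSum p m κ n s + (m (n + 1) ^ p - m n ^ p) * max (s - κ (n + 1)) 0 ^ p :=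
  Finset.sum_range_succ _ _

/-- Since (s - κ_j)_+ decreases in j, replacing each by the last one makes the coefficients
telescope to m_n^p. -/
theorem rpow_le_ladderSum (hp : 1 ≤ p) (hm0 : ∀ n, 0 ≤ m n) (hκ : Monotone κ)
    (n : ℕ) (s : ℝ) : m n ^ p * max (s - κ n) 0 ^ p ≤ ladderSum p m κ n s := by
  induction n with
  | zero => simp [ladderSum, ladderCoeff]
  | succ n ih =>
    rw [ladderSum_succ]
    have h : max (s - κ (n + 1)) 0 ^ p ≤ max (s - κ n) 0 ^ p :=
      Real.rpow_le_rpow (le_max_right _ _)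
        (max_le_max (sub_le_sub_left (hκ n.le_succ) s) le_rfl) (by linarith)
    have := mul_le_mul_of_nonneg_left h (Real.rpow_nonneg (hm0 n) p)
    linarith

theorem ladderSum_mono (hp : 0 ≤ p) (hm0 : ∀ n, 0 ≤ m n) (hm : Monotone m) {i n : ℕ} (h : i ≤ n)
    (s : ℝ) : ladderSum p m κ i s ≤ ladderSum p m κ n s :=
  Finset.sum_le_sum_of_subset_of_nonneg (by simpa using h) fun j _ _ =>
    mul_nonneg (ladderCoeff_nonneg hp hm0 hm j) (Real.rpow_nonneg (le_max_right _ _) _)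

/-- Induction. Passing from (s - κ_n)^p to (s - κ_{n+1})^p costs at most p m_n^p (s - κ_n)^{p-1}
(κ_{n+1} - κ_n) = p (m_n (s - κ_n))^{p-1} ε 2^n, which is at most p ψ^{p-1} ε 2^n. These errors add
up geometrically to the factor ε 2^n - ε. -/
theorem ladderSum_le_of_le (hp : 1 ≤ p) (hε : 0 < ε) (hm0 : ∀ n, 0 ≤ m n)
    (hκ : Monotone κ) (hmκ : ∀ n, m n * (κ (n + 1) - κ n) = ε * 2 ^ n)
    (hmψ : ∀ n s, κ n ≤ s → m n * (s - κ n) ≤ ψ s) (n : ℕ) :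
    ∀ s, κ n ≤ s → ladderSum p m κ n s
      ≤ p * ψ s ^ (p - 1) * (ε * 2 ^ n - ε) + m n ^ p * (s - κ n) ^ p := by
  induction n with
  | zero =>
    intro s hs
    simp [ladderSum, ladderCoeff, max_eq_left (sub_nonneg.2 hs)]
  | succ n ih =>
    intro s hs
    have hs' : κ n ≤ s := (hκ n.le_succ).trans hs
    rw [ladderSum_succ, max_eq_left (sub_nonneg.2 hs)]
    have h1 := rpow_sub_rpow_le (sub_nonneg.2 hs) (sub_le_sub_left (hκ n.le_succ) s) hp
    have h2 := mul_le_mul_of_nonneg_left h1 (Real.rpow_nonneg (hm0 n) p)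
    have hsκ : 0 ≤ s - κ n := sub_nonneg.2 hs'
    have e : m n ^ p * (p * (s - κ n) ^ (p - 1) * (s - κ n - (s - κ (n + 1))))
        = p * (m n * (s - κ n)) ^ (p - 1) * (ε * 2 ^ n) := by
      rw [← hmκ n, Real.mul_rpow (hm0 n) hsκ]
      rcases (hm0 n).eq_or_lt with h0 | h0
      · rw [← h0, Real.zero_rpow (by linarith)]; simp
      · have : m n ^ p = m n ^ (p - 1) * m n := by
          rw [Real.rpow_sub_one h0.ne']; field_simp
        rw [this]; ring
    rw [e] at h2
    have h3 : (m n * (s - κ n)) ^ (p - 1) ≤ ψ s ^ (p - 1) :=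
      Real.rpow_le_rpow (mul_nonneg (hm0 n) hsκ) (hmψ n s hs') (by linarith)
    have h4 : p * (m n * (s - κ n)) ^ (p - 1) * (ε * 2 ^ n) ≤ p * ψ s ^ (p - 1) * (ε * 2 ^ n) := by
      gcongr
    have h5 := ih s hs'
    have h6 : (ε * 2 ^ (n + 1) : ℝ) = ε * 2 ^ n + ε * 2 ^ n := by rw [pow_succ]; ring
    rw [h6]
    linarith

/-- When s ≥ κ_n, the value ψ(s) is at least ε 2^n, so the accumulated error is at most p ψ^p and
the remaining term at most ψ^p. When s < κ_n, the top term vanishes and `n` can be lowered. -/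
theorem ladderSum_le (hp : 1 ≤ p) (hε : 0 < ε) (hm0 : ∀ n, 0 ≤ m n)
    (hκ : Monotone κ) (hmκ : ∀ n, m n * (κ (n + 1) - κ n) = ε * 2 ^ n)
    (hψ0 : ∀ s, 0 ≤ ψ s) (hmψ : ∀ n s, κ n ≤ s → m n * (s - κ n) ≤ ψ s)
    (hεψ : ∀ n s, κ n ≤ s → ε * 2 ^ n ≤ ψ s) (n : ℕ) (s : ℝ) :
    ladderSum p m κ n s ≤ (p + 1) * ψ s ^ p := by
  have hp0 : 0 < p := by linarith
  have hnn : 0 ≤ (p + 1) * ψ s ^ p := mul_nonneg (by linarith) (Real.rpow_nonneg (hψ0 s) p)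
  have main : ∀ n, κ n ≤ s → ladderSum p m κ n s ≤ (p + 1) * ψ s ^ p := by
    intro n hs
    have h1 := ladderSum_le_of_le hp hε hm0 hκ hmκ hmψ n s hs
    have h2 := hεψ n s hs
    have hpos : 0 < ψ s := lt_of_lt_of_le (by positivity) h2
    have h3 : m n ^ p * (s - κ n) ^ p ≤ ψ s ^ p := by
      rw [← Real.mul_rpow (hm0 n) (sub_nonneg.2 hs)]
      exact Real.rpow_le_rpow (mul_nonneg (hm0 n) (sub_nonneg.2 hs)) (hmψ n s hs) hp0.le
    have h4 : p * ψ s ^ (p - 1) * (ε * 2 ^ n - ε) ≤ p * ψ s ^ (p - 1) * ψ s := by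
      gcongr
      linarith
    have h5 : p * ψ s ^ (p - 1) * ψ s = p * ψ s ^ p := by
      rw [Real.rpow_sub_one hpos.ne']; field_simp
    linarith
  induction n with
  | zero =>
    rcases le_or_gt (κ 0) s with h | h
    · exact main 0 h
    · simpa [ladderSum, max_eq_right (sub_nonpos.2 h.le), Real.zero_rpow hp0.ne'] using hnn
  | succ n ih =>
    rcases le_or_gt (κ (n + 1)) s with h | h
    · exact main _ h
    · rw [ladderSum_succ, max_eq_right (sub_nonpos.2 h.le), Real.zero_rpow hp0.ne', mul_zero,
        add_zero]
      exact ih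

/-- A power of a nonnegative convex function is comparable, above a small threshold, with a
combination of powers of truncations. -/
theorem exists_value_ladder (hc : ConvexOn ℝ univ ψ) (hm : Monotone ψ) (hψ0 : ∀ s, 0 ≤ ψ s)
    (hp : 1 ≤ p) (hε : 0 < ε) {x₀ : ℝ} (hx₀ : ψ x₀ ≤ ε) (M : ℝ) :
    ∃ (n : ℕ) (c κ : ℕ → ℝ), (∀ j, 0 ≤ c j) ∧
      (∀ s ≤ M, ψ s ^ p ≤ (2 * ε) ^ p + 4 ^ p *
        ∑ j ∈ Finset.range n, c j * max (s - κ j) 0 ^ p) ∧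
      ∀ s, ∑ j ∈ Finset.range n, c j * max (s - κ j) 0 ^ p ≤ (p + 1) * ψ s ^ p := by
  have hp0 : 0 < p := by linarith
  have hcont := continuous_of_convexOn_univ hc
  rcases le_or_gt (ψ M) (2 * ε) with hM | hM
  · refine ⟨0, fun _ => 0, fun _ => 0, fun _ => le_rfl, fun s hs => ?_, fun s => ?_⟩
    · simpa using Real.rpow_le_rpow (hψ0 s) ((hm hs).trans hM) hp0.le
    · simpa using mul_nonneg (by linarith : 0 ≤ p + 1) (Real.rpow_nonneg (hψ0 s) p)
  have hx₀M : x₀ < M := by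
    by_contra h
    have := hm (not_lt.1 h)
    linarith
  -- The chord from x₀ to M has positive slope, so by convexity ψ is unbounded to the right, and
  -- every value above ψ(x₀) is attained.
  have hattain : ∀ j : ℕ, ∃ x, ψ x = ε * 2 ^ j := by
    intro j
    have h1 : ψ x₀ ≤ ε * 2 ^ j := hx₀.trans (le_mul_of_one_le_right hε.le
      (one_le_pow₀ (by norm_num)))
    set S := (ψ M - ψ x₀) / (M - x₀) with hS
    have hS0 : 0 < S := div_pos (by linarith) (by linarith)
    set b := max M (x₀ + ε * 2 ^ j / S) with hb
    have hbx : x₀ < b := hx₀M.trans_le (le_max_left _ _)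
    have h2 : S ≤ (ψ b - ψ x₀) / (b - x₀) :=
      slope_le_slope hc hx₀M hbx le_rfl (le_max_left _ _)
    rw [le_div_iff₀ (by linarith)] at h2
    have h3 : ε * 2 ^ j ≤ S * (b - x₀) := by
      have : x₀ + ε * 2 ^ j / S ≤ b := le_max_right _ _
      have h4 : ε * 2 ^ j / S ≤ b - x₀ := by linarith
      rw [div_le_iff₀ hS0] at h4
      linarith
    obtain ⟨x, -, hx⟩ := intermediate_value_Icc hbx.le hcont.continuousOn
      ⟨h1, by linarith [hψ0 x₀]⟩
    exact ⟨x, hx⟩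
  choose κ hκ using hattain
  have hκlt : ∀ n, κ n < κ (n + 1) := by
    intro n
    by_contra h
    have h1 := hm (not_lt.1 h)
    rw [hκ, hκ, pow_succ] at h1
    have : 0 < ε * 2 ^ n := by positivity
    linarith
  have hκm : Monotone κ := monotone_nat_of_le_succ fun n => (hκlt n).le
  set m : ℕ → ℝ := fun n => (ψ (κ (n + 1)) - ψ (κ n)) / (κ (n + 1) - κ n) with hmdef
  have hmκ : ∀ n, m n * (κ (n + 1) - κ n) = ε * 2 ^ n := by
    intro n
    have : κ (n + 1) - κ n ≠ 0 := (sub_pos.2 (hκlt n)).ne'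
    simp only [hmdef]
    rw [div_mul_cancel₀ _ this, hκ, hκ, pow_succ]
    ring
  have hm0 : ∀ n, 0 ≤ m n := fun n =>
    div_nonneg (sub_nonneg.2 (hm (hκlt n).le)) (sub_pos.2 (hκlt n)).le
  have hmm : Monotone m := monotone_nat_of_le_succ fun n =>
    slope_le_slope hc (hκlt n) (hκlt (n + 1)) (hκlt n).le (hκlt (n + 1)).le
  have hεψ : ∀ n s, κ n ≤ s → ε * 2 ^ n ≤ ψ s := fun n s hs => by
    rw [← hκ n]; exact hm hs
  have hmψ : ∀ n s, κ n ≤ s → m n * (s - κ n) ≤ ψ s := by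
    intro n s hs
    rcases le_or_gt s (κ (n + 1)) with h | h
    · calc m n * (s - κ n) ≤ m n * (κ (n + 1) - κ n) :=
            mul_le_mul_of_nonneg_left (by linarith) (hm0 n)
        _ ≤ ψ s := (hmκ n).le.trans (hεψ n s hs)
    · have h1 : m n ≤ (ψ s - ψ (κ n)) / (s - κ n) :=
        slope_le_slope hc (hκlt n) ((hκlt n).trans h) le_rfl h.le
      rw [le_div_iff₀ (by linarith [hκlt n])] at h1
      linarith [hψ0 (κ n)]
  have hex : ∃ i : ℕ, ψ M ≤ ε * 2 ^ i := by
    obtain ⟨i, hi⟩ := pow_unbounded_of_one_lt (ψ M / ε) (one_lt_two)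
    exact ⟨i, by rw [div_lt_iff₀ hε] at hi; linarith⟩
  obtain ⟨n, hn⟩ := hex
  refine ⟨n + 1, ladderCoeff p m, κ, ladderCoeff_nonneg hp0.le hm0 hmm, fun s hs => ?_, fun s =>
    ladderSum_le hp hε hm0 hκm hmκ hψ0 hmψ hεψ n s⟩
  change ψ s ^ p ≤ (2 * ε) ^ p + 4 ^ p * ladderSum p m κ n s
  have hF0 : ∀ i, 0 ≤ ladderSum p m κ i s := fun i =>
    Finset.sum_nonneg fun j _ => mul_nonneg (ladderCoeff_nonneg hp0.le hm0 hmm j)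
      (Real.rpow_nonneg (le_max_right _ _) _)
  rcases le_or_gt (ψ s) (2 * ε) with h | h
  · have h1 := Real.rpow_le_rpow (hψ0 s) h hp0.le
    have h2 := mul_nonneg (by positivity : (0 : ℝ) ≤ 4 ^ p) (hF0 n)
    linarith
  · classical
    have hex' : ∃ i : ℕ, ψ s ≤ ε * 2 ^ i := ⟨n, (hm hs).trans hn⟩
    set i := Nat.find hex' with hi
    have hi1 : ψ s ≤ ε * 2 ^ i := Nat.find_spec hex'
    have hin : i ≤ n := Nat.find_min' hex' ((hm hs).trans hn)
    have hi2 : 2 ≤ i := by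
      by_contra hlt
      -- Both are excluded by ψ(s) > 2ε.
      have : i = 0 ∨ i = 1 := by omega
      rcases this with h0 | h0 <;> rw [h0] at hi1 <;> norm_num at hi1 <;> linarith
    obtain ⟨j, hj⟩ := Nat.exists_eq_add_of_le' hi2
    have hjs : ε * 2 ^ (j + 1) < ψ s :=
      not_le.1 (Nat.find_min hex' (show j + 1 < Nat.find hex' by rw [← hi, hj]; omega))
    have hκs : κ (j + 1) ≤ s := by
      by_contra hlt
      have := hm (not_le.1 hlt).le
      rw [hκ] at this
      linarith
    -- With i = j + 2, the point s is past κ_{j+1}, so the chord of index j has risen by ε 2^j, at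
    -- least a quarter of ψ(s). This is the source of 4^p.
    have h1 : ε * 2 ^ j ≤ m j * (s - κ j) := by
      rw [← hmκ j]
      exact mul_le_mul_of_nonneg_left (by linarith) (hm0 j)
    have hκj : 0 ≤ s - κ j := by linarith [hκlt j]
    have h2 : (ε * 2 ^ j) ^ p ≤ ladderSum p m κ n s := by
      refine le_trans ?_ ((rpow_le_ladderSum hp hm0 hκm j s).trans
        (ladderSum_mono hp0.le hm0 hmm (by omega) s))
      rw [max_eq_left hκj, ← Real.mul_rpow (hm0 j) hκj]
      exact Real.rpow_le_rpow (by positivity) h1 hp0.le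
    have h3 : ψ s ^ p ≤ 4 ^ p * (ε * 2 ^ j) ^ p := by
      rw [← Real.mul_rpow (by norm_num) (by positivity)]
      refine Real.rpow_le_rpow (hψ0 s) (hi1.trans (le_of_eq ?_)) hp0.le
      rw [hj, pow_add]; ring
    have h4 := mul_le_mul_of_nonneg_left h2 (by positivity : (0 : ℝ) ≤ 4 ^ p)
    have h5 : 0 ≤ (2 * ε) ^ p := by positivity
    linarith

end ValueLadder

/-! ### The energy inequality and integrability for convex functions of u. -/

section Composition

variable {N : ℕ} {E : Set (EuclideanSpace ℝ (Fin N) × ℝ)} {p γ : ℝ}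
  {u : EuclideanSpace ℝ (Fin N) × ℝ → ℝ} {y : EuclideanSpace ℝ (Fin N)} {s R T : ℝ}
  {G : EuclideanSpace ℝ (Fin N) × ℝ → EuclideanSpace ℝ (Fin N)} {ψ : ℝ → ℝ} {M : ℝ}

theorem measurable_leftSlope (hc : ConvexOn ℝ univ ψ) : Measurable (leftSlope ψ) :=
  (leftSlope_mono hc).measurable

/-- Chain rule for the spatial gradient of a convex function of a function bounded above. -/
theorem HasSpatialGradient.comp_convex (hG : HasSpatialGradient y s R T u G)
    (hum : AEMeasurable u (volume.restrict (parCylinder y s R T)))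
    (hM : ∀ᵐ z ∂(volume.restrict (parCylinder y s R T)), u z ≤ M)
    (hc : ConvexOn ℝ univ ψ) (hm : Monotone ψ) :
    HasSpatialGradient y s R T (fun z => ψ (u z)) (fun z => leftSlope ψ (u z) • G z) := by
  refine ⟨((measurable_leftSlope hc).comp_aemeasurable hum).aestronglyMeasurable.smul hG.1, ?_⟩
  -- Cutting ψ at M makes it globally Lipschitz and does not change ψ(u) almost everywhere.
  obtain ⟨L, hL⟩ := exists_lipschitzWith_comp_min hc hm M
  filter_upwards [hG.2, ae_ae_of_ae_parCylinder hM] with t ht htM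
  refine (ht.comp_lipschitz (isOpen_cube y R) hL (hasLeftSlope_comp_min hc M)).congr
    (isOpen_cube y R) ?_ ?_
  · filter_upwards [htM] with x hx
    rw [min_eq_left hx]
  · filter_upwards [htM] with x hx
    rw [if_pos hx]

theorem convexOn_truncation (k : ℝ) : ConvexOn ℝ univ fun s : ℝ => max (s - k) 0 :=
  ((convexOn_id convex_univ).sub (concaveOn_const k convex_univ)).sup (convexOn_const 0 convex_univ)

theorem monotone_truncation (k : ℝ) : Monotone fun s : ℝ => max (s - k) 0 := fun _ _ h =>
  max_le_max (sub_le_sub_right h k) le_rfl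

/-- The energy inequality in terms of the gradient of `u` itself. -/
theorem ClassAPlus.lintegral_gradient_le (hu : ClassAPlus E p γ u) (hp : 0 ≤ p) {ρ τ : ℝ}
    (hρ : 0 < ρ) (hρR : ρ < R) (hτ : 0 < τ) (hτT : τ < T)
    (hE : CompactlyContained (parCylinder y s R T) E)
    (hG : HasSpatialGradient y s R T u G)
    (hM : ∀ᵐ z ∂(volume.restrict (parCylinder y s R T)), u z ≤ M) (k : ℝ) :
    ∫⁻ z in parCylinder y s ρ τ, (if k < u z then 1 else 0) * ‖G z‖ₑ ^ p
      ≤ ENNReal.ofReal (γ / (R - ρ) ^ p + γ / (T - τ)) * excess p u y s R T k := by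
  obtain ⟨H, hH, hen⟩ := hu.2 y s R T ρ τ k hρ hρR hτ hτT hE
  have hum : AEMeasurable u (volume.restrict (parCylinder y s R T)) :=
    hu.1.1.mono_measure (Measure.restrict_mono hE.subset le_rfl)
  have hH' := hG.comp_convex hum hM (convexOn_truncation k) (monotone_truncation k)
  have hmono : (volume : Measure (EuclideanSpace ℝ (Fin N) × ℝ)).restrict (parCylinder y s ρ τ)
      ≤ volume.restrict (parCylinder y s R T) :=
    Measure.restrict_mono (parCylinder_mono y s hρR.le hτT.le) le_rfl
  refine le_trans ?_ (le_add_self.trans hen)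
  have hum' := hum.mono_measure hmono
  have hGm := hG.1.mono_measure hmono
  have hHm := hH.1.mono_measure hmono
  have hind : Measurable fun r : ℝ => if k < r then (1 : ℝ≥0∞) else 0 :=
    Measurable.ite measurableSet_Ioi measurable_const measurable_const
  have hleft : AEMeasurable (fun z => (if k < u z then 1 else 0) * ‖G z‖ₑ ^ p)
      (volume.restrict (parCylinder y s ρ τ)) :=
    (hind.comp_aemeasurable hum').mul (hGm.enorm.pow_const p)
  rw [lintegral_parCylinder _ _ _ _ hleft,
    lintegral_parCylinder _ _ _ _ (hHm.norm.aemeasurable.pow_const p).ennreal_ofReal]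
  have hsub : Ioo (s - τ) s ⊆ Ioo (s - T) s := Ioo_subset_Ioo_left (by linarith)
  refine lintegral_mono_ae ?_
  filter_upwards [ae_restrict_of_ae_restrict_of_subset hsub hH.2,
    ae_restrict_of_ae_restrict_of_subset hsub hH'.2] with t h1 h2
  refine lintegral_mono_ae ?_
  -- The gradient supplied by the energy inequality is some weak gradient of (u - k)_+; uniqueness
  -- identifies it with the chain-rule one.
  filter_upwards [ae_restrict_of_ae_restrict_of_subset (cube_mono y hρR.le)
    (h1.ae_unique h2 (isOpen_cube y R))] with x hx
  rw [ofReal_norm_rpow_eq_enorm _ hp, hx, enorm_smul]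
  split_ifs with hk
  · rw [one_mul]
    gcongr
    refine le_mul_of_one_le_left' ?_
    -- The chord from k to u(x, t) shows that the left derivative of the truncation is at least 1
    -- where u > k.
    have h3 := le_leftSlope (convexOn_truncation k) hk
    rw [max_eq_left (by linarith), sub_self, max_self, sub_zero,
      div_self (by linarith)] at h3
    rw [Real.enorm_of_nonneg (by linarith)]
    simpa using ENNReal.ofReal_le_ofReal h3
  · simp

/-- Recombines the right-hand sides of the energy inequalities at the levels of a ladder. -/
theorem sum_mul_excess_le (hum : AEMeasurable u (volume.restrict (parCylinder y s R T)))
    {n : ℕ} {c κ : ℕ → ℝ} (hc : ∀ j, 0 ≤ c j) {C : ℝ} (hC : 0 ≤ C)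
    (h : ∀ r, ∑ j ∈ Finset.range n, c j * max (r - κ j) 0 ^ p ≤ C * ψ r ^ p) :
    ∑ j ∈ Finset.range n, ENNReal.ofReal (c j) * excess p u y s R T (κ j)
      ≤ ENNReal.ofReal C * ∫⁻ z in parCylinder y s R T, ENNReal.ofReal (ψ (u z) ^ p) := by
  calc _ = ∑ j ∈ Finset.range n, ∫⁻ z in parCylinder y s R T,
        ENNReal.ofReal (c j) * ENNReal.ofReal (truncPlus u (κ j) z ^ p) :=
        Finset.sum_congr rfl fun j _ => (lintegral_const_mul' _ _ ENNReal.ofReal_ne_top).symm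
    _ = ∫⁻ z in parCylinder y s R T, ∑ j ∈ Finset.range n,
        ENNReal.ofReal (c j) * ENNReal.ofReal (truncPlus u (κ j) z ^ p) :=
        (lintegral_finsetSum' _ fun j _ =>
          ((aemeasurable_truncPlus hum (κ j)).pow_const p).ennreal_ofReal.const_mul _).symm
    _ ≤ ∫⁻ z in parCylinder y s R T, ENNReal.ofReal C * ENNReal.ofReal (ψ (u z) ^ p) := by
        refine lintegral_mono fun z => ?_
        simp_rw [← ENNReal.ofReal_mul (hc _)]
        rw [← ENNReal.ofReal_mul hC, ← ENNReal.ofReal_sum_of_nonneg fun j _ =>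
          mul_nonneg (hc j) (Real.rpow_nonneg (truncPlus_nonneg u _ z) p)]
        exact ENNReal.ofReal_le_ofReal (h (u z))
    _ = _ := lintegral_const_mul' _ _ ENNReal.ofReal_ne_top

/-- Gradient part of the energy inequality for `ψ(u)`. -/
theorem ClassAPlus.lintegral_gradient_comp_le (hu : ClassAPlus E p γ u) (hp : 1 ≤ p) {ρ τ : ℝ}
    (hρ : 0 < ρ) (hρR : ρ < R) (hτ : 0 < τ) (hτT : τ < T)
    (hE : CompactlyContained (parCylinder y s R T) E)
    (hG : HasSpatialGradient y s R T u G)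
    (hGfin : ∫⁻ z in parCylinder y s R T, ‖G z‖ₑ ^ p ≠ ⊤)
    (hM : ∀ᵐ z ∂(volume.restrict (parCylinder y s R T)), u z ≤ M)
    (hc : ConvexOn ℝ univ ψ) (hm : Monotone ψ) (hψ0 : ∀ r, 0 ≤ ψ r) :
    ∫⁻ z in parCylinder y s ρ τ, ENNReal.ofReal (‖leftSlope ψ (u z) • G z‖ ^ p)
      ≤ ENNReal.ofReal (4 ^ p) * (ENNReal.ofReal (γ / (R - ρ) ^ p + γ / (T - τ)) *
        ∫⁻ z in parCylinder y s R T, ENNReal.ofReal (ψ (u z) ^ p)) := by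
  have hp0 : 0 < p := by linarith
  set B := ENNReal.ofReal (γ / (R - ρ) ^ p + γ / (T - τ)) with hB
  set X := ∫⁻ z in parCylinder y s R T, ENNReal.ofReal (ψ (u z) ^ p) with hX
  set J := ∫⁻ z in parCylinder y s R T, ‖G z‖ₑ ^ p with hJ
  have hsubset := parCylinder_mono y s hρR.le hτT.le
  have hum : AEMeasurable u (volume.restrict (parCylinder y s R T)) :=
    hu.1.1.mono_measure (Measure.restrict_mono hE.subset le_rfl)
  have hmono : (volume : Measure (EuclideanSpace ℝ (Fin N) × ℝ)).restrict (parCylinder y s ρ τ)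
      ≤ volume.restrict (parCylinder y s R T) := Measure.restrict_mono hsubset le_rfl
  have hum' := hum.mono_measure hmono
  have hGm := hG.1.mono_measure hmono
  have hstep : ∀ δ : ℝ, 0 < δ →
      ∫⁻ z in parCylinder y s ρ τ, ENNReal.ofReal (‖leftSlope ψ (u z) • G z‖ ^ p)
        ≤ ENNReal.ofReal (δ ^ p) * J + ENNReal.ofReal (4 ^ p) * (B * X) := by
    intro δ hδ
    obtain ⟨n, κ, h1, h2⟩ := exists_slope_ladder hc hψ0 hp hδ M hm
    have hc0 : ∀ j : ℕ, 0 ≤ (δ * 2 ^ j) ^ p := fun j => by positivity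
    have hind : ∀ k : ℝ, Measurable fun r : ℝ => if k < r then (1 : ℝ≥0∞) else 0 := fun k =>
      Measurable.ite measurableSet_Ioi measurable_const measurable_const
    have hterm : ∀ j : ℕ, AEMeasurable (fun z => ENNReal.ofReal ((δ * 2 ^ j) ^ p) *
        ((if κ j < u z then 1 else 0) * ‖G z‖ₑ ^ p)) (volume.restrict (parCylinder y s ρ τ)) :=
      fun j => (((hind (κ j)).comp_aemeasurable hum').mul (hGm.enorm.pow_const p)).const_mul _
    calc ∫⁻ z in parCylinder y s ρ τ, ENNReal.ofReal (‖leftSlope ψ (u z) • G z‖ ^ p)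
        ≤ ∫⁻ z in parCylinder y s ρ τ, (ENNReal.ofReal (δ ^ p) * ‖G z‖ₑ ^ p +
          ENNReal.ofReal (2 ^ p) * ∑ j ∈ Finset.range n, ENNReal.ofReal ((δ * 2 ^ j) ^ p) *
            ((if κ j < u z then 1 else 0) * ‖G z‖ₑ ^ p)) := by
          refine lintegral_mono_ae ?_
          filter_upwards [ae_restrict_of_ae_restrict_of_subset hsubset hM] with z hz
          have hd0 := leftSlope_nonneg hc hm (u z)
          rw [norm_smul, Real.mul_rpow (norm_nonneg _) (norm_nonneg _), Real.norm_of_nonneg hd0,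
            ENNReal.ofReal_mul (Real.rpow_nonneg hd0 p), ofReal_norm_rpow_eq_enorm _ hp0.le]
          have hnn : ∀ j ∈ Finset.range n,
              0 ≤ (δ * 2 ^ j) ^ p * (if κ j < u z then (1 : ℝ) else 0) :=
            fun j _ => mul_nonneg (hc0 j) (by split_ifs <;> norm_num)
          have h3 := ENNReal.ofReal_le_ofReal (h1 _ hz)
          rw [ENNReal.ofReal_add (by positivity)
            (mul_nonneg (by positivity) (Finset.sum_nonneg hnn)),
            ENNReal.ofReal_mul (by positivity), ENNReal.ofReal_sum_of_nonneg hnn] at h3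
          refine (mul_le_mul_left h3 _).trans (le_of_eq ?_)
          rw [add_mul, mul_assoc, Finset.sum_mul]
          congr 2
          refine Finset.sum_congr rfl fun j _ => ?_
          rw [ENNReal.ofReal_mul (hc0 j), mul_assoc]
          split_ifs <;> simp
      _ = ENNReal.ofReal (δ ^ p) * (∫⁻ z in parCylinder y s ρ τ, ‖G z‖ₑ ^ p) +
          ENNReal.ofReal (2 ^ p) * ∑ j ∈ Finset.range n, ENNReal.ofReal ((δ * 2 ^ j) ^ p) *
            ∫⁻ z in parCylinder y s ρ τ, (if κ j < u z then 1 else 0) * ‖G z‖ₑ ^ p := by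
          rw [lintegral_add_left' ((hGm.enorm.pow_const p).const_mul _),
            lintegral_const_mul' _ _ ENNReal.ofReal_ne_top,
            lintegral_const_mul' _ _ ENNReal.ofReal_ne_top,
            lintegral_finsetSum' _ fun j _ => hterm j]
          simp_rw [lintegral_const_mul' _ _ ENNReal.ofReal_ne_top]
      _ ≤ ENNReal.ofReal (δ ^ p) * J + ENNReal.ofReal (2 ^ p) *
          ∑ j ∈ Finset.range n, ENNReal.ofReal ((δ * 2 ^ j) ^ p) *
            (B * excess p u y s R T (κ j)) := by
          refine add_le_add (mul_le_mul_right (lintegral_mono' hmono le_rfl) _)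
            (mul_le_mul_right (Finset.sum_le_sum fun j _ => mul_le_mul_right ?_ _) _)
          exact hu.lintegral_gradient_le hp0.le hρ hρR hτ hτT hE hG hM (κ j)
      _ = ENNReal.ofReal (δ ^ p) * J + ENNReal.ofReal (2 ^ p) * (B *
          ∑ j ∈ Finset.range n, ENNReal.ofReal ((δ * 2 ^ j) ^ p) *
            excess p u y s R T (κ j)) := by
          congr 2
          rw [Finset.mul_sum]
          exact Finset.sum_congr rfl fun j _ => mul_left_comm _ _ _
      _ ≤ ENNReal.ofReal (δ ^ p) * J + ENNReal.ofReal (2 ^ p) * (B *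
          (ENNReal.ofReal (2 ^ p) * X)) :=
          add_le_add_right (mul_le_mul_right (mul_le_mul_right
            (sum_mul_excess_le hum hc0 (by positivity) h2) _) _) _
      _ = _ := by
          have : (4 : ℝ) ^ p = 2 ^ p * 2 ^ p := by
            rw [← Real.mul_rpow (by norm_num) (by norm_num)]; norm_num
          rw [this, ENNReal.ofReal_mul (by positivity)]
          ring
  -- Letting δ tend to 0 removes the error term because the gradient of u is p-integrable on the
  -- cylinder.
  have hlim : Tendsto (fun n : ℕ => ENNReal.ofReal ((1 / ((n : ℝ) + 1)) ^ p) * J +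
      ENNReal.ofReal (4 ^ p) * (B * X)) atTop (𝓝 (0 * J + ENNReal.ofReal (4 ^ p) * (B * X))) := by
    refine (ENNReal.Tendsto.mul_const ?_ (Or.inr hGfin)).add_const _
    have h1 := ((tendsto_one_div_add_atTop_nhds_zero_nat (𝕜 := ℝ)).rpow_const
      (p := p) (Or.inr hp0.le))
    rw [Real.zero_rpow hp0.ne'] at h1
    simpa using ENNReal.tendsto_ofReal h1
  rw [zero_mul, zero_add] at hlim
  exact ge_of_tendsto' hlim fun n => hstep _ (by positivity)

/-- Supremum part of the energy inequality for `ψ(u)`. -/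
theorem ClassAPlus.essSup_comp_le (hu : ClassAPlus E p γ u) (hγ : 0 < γ) (hp : 1 ≤ p) {ρ τ : ℝ}
    (hρ : 0 < ρ) (hρR : ρ < R) (hτ : 0 < τ) (hτT : τ < T)
    (hE : CompactlyContained (parCylinder y s R T) E)
    (hM : ∀ᵐ z ∂(volume.restrict (parCylinder y s R T)), u z ≤ M)
    (hc : ConvexOn ℝ univ ψ) (hm : Monotone ψ) (hψ0 : ∀ r, 0 ≤ ψ r) :
    essSup (fun t => ∫⁻ x in cube y ρ, ENNReal.ofReal (ψ (u (x, t)) ^ p))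
        (volume.restrict (Ioo (s - τ) s))
      ≤ ENNReal.ofReal (4 ^ p * (1 / γ + (p + 1))) *
        (ENNReal.ofReal (γ / (R - ρ) ^ p + γ / (T - τ)) *
        ∫⁻ z in parCylinder y s R T, ENNReal.ofReal (ψ (u z) ^ p)) := by
  have hp0 : 0 < p := by linarith
  set B := ENNReal.ofReal (γ / (R - ρ) ^ p + γ / (T - τ)) with hB
  set X := ∫⁻ z in parCylinder y s R T, ENNReal.ofReal (ψ (u z) ^ p) with hX
  set V := volume (cube y ρ) with hV
  have hVt : V ≠ ⊤ := (volume_cube_lt_top y ρ).ne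
  have hsub : Ioo (s - τ) s ⊆ Ioo (s - T) s := Ioo_subset_Ioo_left (by linarith)
  have hum : AEMeasurable u (volume.restrict (parCylinder y s R T)) :=
    hu.1.1.mono_measure (Measure.restrict_mono hE.subset le_rfl)
  obtain ⟨-, -, G, hG, -⟩ := hu.1.2 y s R T (by linarith) (by linarith) hE
  set L := ⨅ r, ψ r with hL
  have hbdd : BddBelow (range ψ) := ⟨0, by rintro _ ⟨r, rfl⟩; exact hψ0 r⟩
  have hL0 : 0 ≤ L := le_ciInf hψ0
  -- As ψ(u) ≥ L on a cylinder of volume at least V (T - τ), and the coefficient is at least γ/(T -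
  -- τ), the constant L^p V is paid for by the right-hand side with a factor 1/γ.
  have hLX : ENNReal.ofReal (L ^ p) * V ≤ ENNReal.ofReal (1 / γ) * (B * X) := by
    have h1 : ENNReal.ofReal (L ^ p) * (V * ENNReal.ofReal (T - τ)) ≤ X := by
      calc _ ≤ ENNReal.ofReal (L ^ p) * volume (parCylinder y s R T) := by
            refine mul_le_mul_right ?_ _
            rw [parCylinder, Measure.volume_eq_prod, Measure.prod_prod, Real.volume_Ioc]
            exact mul_le_mul' (measure_mono (cube_mono y hρR.le))
              (ENNReal.ofReal_le_ofReal (by linarith))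
        _ = ∫⁻ _ in parCylinder y s R T, ENNReal.ofReal (L ^ p) := (setLIntegral_const _ _).symm
        _ ≤ X := lintegral_mono fun z => ENNReal.ofReal_le_ofReal
            (Real.rpow_le_rpow hL0 (ciInf_le hbdd (u z)) hp0.le)
    have h2 : (1 : ℝ≥0∞) ≤ ENNReal.ofReal (T - τ) * (ENNReal.ofReal (1 / γ) * B) := by
      have h3 : 0 < T - τ := by linarith
      have h4 : 0 < (R - ρ) ^ p := Real.rpow_pos_of_pos (by linarith) p
      rw [hB, ← ENNReal.ofReal_mul (by positivity), ← ENNReal.ofReal_mul h3.le,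
        ← ENNReal.ofReal_one]
      refine ENNReal.ofReal_le_ofReal ?_
      have : (T - τ) * (1 / γ * (γ / (R - ρ) ^ p + γ / (T - τ))) = (T - τ) / (R - ρ) ^ p + 1 := by
        field_simp
      rw [this]
      have := div_pos h3 h4
      linarith
    calc ENNReal.ofReal (L ^ p) * V
        ≤ ENNReal.ofReal (L ^ p) * V * (ENNReal.ofReal (T - τ) * (ENNReal.ofReal (1 / γ) * B)) :=
          le_mul_of_one_le_right' h2
      _ = ENNReal.ofReal (1 / γ) * (B * (ENNReal.ofReal (L ^ p) * (V * ENNReal.ofReal (T - τ)))) := by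
          ring
      _ ≤ _ := mul_le_mul_right (mul_le_mul_right h1 _) _
  -- The threshold ε must stay above inf ψ, since the ladder needs a point where ψ ≤ ε.
  have hstep : ∀ ε : ℝ, L < ε →
      essSup (fun t => ∫⁻ x in cube y ρ, ENNReal.ofReal (ψ (u (x, t)) ^ p))
        (volume.restrict (Ioo (s - τ) s))
      ≤ ENNReal.ofReal ((2 * ε) ^ p) * V + ENNReal.ofReal (4 ^ p * (p + 1)) * (B * X) := by
    intro ε hε
    have hε0 : 0 < ε := hL0.trans_lt hε
    obtain ⟨x₀, hx₀⟩ := exists_lt_of_ciInf_lt hε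
    obtain ⟨n, c, κ, hc0, h1, h2⟩ := exists_value_ladder hc hm hψ0 hp hε0 hx₀.le M
    refine essSup_le_of_ae_le _ ?_
    -- Countably many levels, hence a common null set of times.
    have hsup : ∀ᵐ t ∂(volume.restrict (Ioo (s - τ) s)), ∀ j : ℕ,
        ∫⁻ x in cube y ρ, ENNReal.ofReal (truncPlus u (κ j) (x, t) ^ p)
          ≤ B * excess p u y s R T (κ j) := by
      rw [ae_all_iff]
      intro j
      obtain ⟨H, -, hen⟩ := hu.2 y s R T ρ τ (κ j) hρ hρR hτ hτT hE
      filter_upwards [ENNReal.ae_le_essSup (μ := volume.restrict (Ioo (s - τ) s)) (fun t =>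
        ∫⁻ x in cube y ρ, ENNReal.ofReal (truncPlus u (κ j) (x, t) ^ p))] with t ht
      exact ht.trans (le_self_add.trans hen)
    filter_upwards [hsup, ae_restrict_of_ae_restrict_of_subset hsub hG.2,
      ae_restrict_of_ae_restrict_of_subset hsub (ae_ae_of_ae_parCylinder hM)] with t ht hw htM
    have hwm : AEMeasurable (fun x => u (x, t)) (volume.restrict (cube y ρ)) :=
      (hw.1.aestronglyMeasurable.mono_measure
        (Measure.restrict_mono (cube_mono y hρR.le) le_rfl)).aemeasurable
    have hterm : ∀ j, AEMeasurable (fun x => ENNReal.ofReal (c j) *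
        ENNReal.ofReal (truncPlus u (κ j) (x, t) ^ p)) (volume.restrict (cube y ρ)) := fun j =>
      ((((hwm.sub_const (κ j)).max aemeasurable_const).pow_const p).ennreal_ofReal).const_mul _
    calc ∫⁻ x in cube y ρ, ENNReal.ofReal (ψ (u (x, t)) ^ p)
        ≤ ∫⁻ x in cube y ρ, (ENNReal.ofReal ((2 * ε) ^ p) + ENNReal.ofReal (4 ^ p) *
          ∑ j ∈ Finset.range n, ENNReal.ofReal (c j) *
            ENNReal.ofReal (truncPlus u (κ j) (x, t) ^ p)) := by
          refine lintegral_mono_ae ?_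
          filter_upwards [ae_restrict_of_ae_restrict_of_subset (cube_mono y hρR.le) htM] with x hx
          have hnn : ∀ j ∈ Finset.range n, 0 ≤ c j * truncPlus u (κ j) (x, t) ^ p := fun j _ =>
            mul_nonneg (hc0 j) (Real.rpow_nonneg (truncPlus_nonneg _ _ _) p)
          simp_rw [← ENNReal.ofReal_mul (hc0 _)]
          rw [← ENNReal.ofReal_sum_of_nonneg hnn, ← ENNReal.ofReal_mul (by positivity),
            ← ENNReal.ofReal_add (by positivity)
              (mul_nonneg (by positivity) (Finset.sum_nonneg hnn))]
          exact ENNReal.ofReal_le_ofReal (h1 _ hx)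
      _ = ENNReal.ofReal ((2 * ε) ^ p) * V + ENNReal.ofReal (4 ^ p) *
          ∑ j ∈ Finset.range n, ENNReal.ofReal (c j) *
            ∫⁻ x in cube y ρ, ENNReal.ofReal (truncPlus u (κ j) (x, t) ^ p) := by
          rw [lintegral_add_left measurable_const, setLIntegral_const,
            lintegral_const_mul' _ _ ENNReal.ofReal_ne_top,
            lintegral_finsetSum' _ fun j _ => hterm j]
          simp_rw [lintegral_const_mul' _ _ ENNReal.ofReal_ne_top]
          rfl
      _ ≤ ENNReal.ofReal ((2 * ε) ^ p) * V + ENNReal.ofReal (4 ^ p) *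
          ∑ j ∈ Finset.range n, ENNReal.ofReal (c j) * (B * excess p u y s R T (κ j)) :=
          add_le_add_right (mul_le_mul_right (Finset.sum_le_sum fun j _ =>
            mul_le_mul_right (ht j) _) _) _
      _ = ENNReal.ofReal ((2 * ε) ^ p) * V + ENNReal.ofReal (4 ^ p) * (B *
          ∑ j ∈ Finset.range n, ENNReal.ofReal (c j) * excess p u y s R T (κ j)) := by
          congr 2
          rw [Finset.mul_sum]
          exact Finset.sum_congr rfl fun j _ => mul_left_comm _ _ _
      _ ≤ ENNReal.ofReal ((2 * ε) ^ p) * V + ENNReal.ofReal (4 ^ p) * (B *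
          (ENNReal.ofReal (p + 1) * X)) :=
          add_le_add_right (mul_le_mul_right (mul_le_mul_right
            (sum_mul_excess_le hum hc0 (by positivity) h2) _) _) _
      _ = _ := by
          rw [ENNReal.ofReal_mul (by positivity)]
          ring
  have hlim : Tendsto (fun n : ℕ => ENNReal.ofReal ((2 * (L + 1 / ((n : ℝ) + 1))) ^ p) * V +
      ENNReal.ofReal (4 ^ p * (p + 1)) * (B * X)) atTop
      (𝓝 (ENNReal.ofReal ((2 * L) ^ p) * V + ENNReal.ofReal (4 ^ p * (p + 1)) * (B * X))) := by
    refine (ENNReal.Tendsto.mul_const (ENNReal.tendsto_ofReal ?_) (Or.inr hVt)).add_const _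
    refine Tendsto.rpow_const ?_ (Or.inr hp0.le)
    have h1 := ((tendsto_one_div_add_atTop_nhds_zero_nat (𝕜 := ℝ)).const_add L).const_mul 2
    rwa [add_zero] at h1
  refine (ge_of_tendsto' hlim fun n => hstep _ (lt_add_of_pos_right _ (by positivity))).trans ?_
  have e : 4 ^ p * (1 / γ + (p + 1)) = 4 ^ p * (1 / γ) + 4 ^ p * (p + 1) := by ring
  rw [e, ENNReal.ofReal_add (by positivity) (by positivity), add_mul]
  refine add_le_add_left ?_ _
  rw [Real.mul_rpow (by norm_num) hL0, ENNReal.ofReal_mul (by positivity),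
    ENNReal.ofReal_mul (by positivity), mul_assoc, mul_assoc]
  refine mul_le_mul' (ENNReal.ofReal_le_ofReal ?_) hLX
  exact Real.rpow_le_rpow (by norm_num) (by norm_num) hp0.le

/-- The energy inequality for truncations of `φ(u)`. -/
theorem ClassAPlus.energyIneqPlus_comp (hu : ClassAPlus E p γ u) (hEo : IsOpen E) (hγ : 0 < γ)
    (hp : 1 ≤ p) {φ : ℝ → ℝ} (hc : ConvexOn ℝ univ φ) (hm : Monotone φ) {ρ τ : ℝ}
    (hρ : 0 < ρ) (hρR : ρ < R) (hτ : 0 < τ) (hτT : τ < T)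
    (hE : CompactlyContained (parCylinder y s R T) E) (k : ℝ) :
    EnergyIneqPlus p (4 ^ p * (1 + γ * (p + 2))) y s R T ρ τ k (fun z => φ (u z)) := by
  have hp0 : 0 < p := by linarith
  obtain ⟨M, hM⟩ := hu.exists_ae_le hEo hγ hp (by linarith) (by linarith) hE
  obtain ⟨-, -, G, hG, hGp⟩ := hu.1.2 y s R T (by linarith) (by linarith) hE
  have hum : AEMeasurable u (volume.restrict (parCylinder y s R T)) :=
    hu.1.1.mono_measure (Measure.restrict_mono hE.subset le_rfl)
  have hGfin := hGp.2
  rw [eLpNorm_lt_top_iff_lintegral_rpow_enorm_lt_top (by simpa using hp0)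
    ENNReal.ofReal_ne_top, ENNReal.toReal_ofReal hp0.le] at hGfin
  set ψ : ℝ → ℝ := fun r => max (φ r - k) 0 with hψ
  have hψc : ConvexOn ℝ univ ψ := (hc.sub (concaveOn_const k convex_univ)).sup (convexOn_const 0 convex_univ)
  have hψm : Monotone ψ := (monotone_truncation k).comp hm
  have hψ0 : ∀ r, 0 ≤ ψ r := fun r => le_max_right _ _
  refine ⟨fun z => leftSlope ψ (u z) • G z, hG.comp_convex hum hM hψc hψm, ?_⟩
  have h1 := hu.essSup_comp_le hγ hp hρ hρR hτ hτT hE hM hψc hψm hψ0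
  have h2 := hu.lintegral_gradient_comp_le hp hρ hρR hτ hτT hE hG hGfin.ne hM hψc hψm hψ0
  refine (add_le_add h1 h2).trans (le_of_eq ?_)
  have h3 : 0 < T - τ := by linarith
  have h4 : 0 < (R - ρ) ^ p := Real.rpow_pos_of_pos (by linarith) p
  -- The two parts add up to the factor 4^p (1/γ + p + 2); multiplying by the γ inside the
  -- coefficient gives 4^p (1 + γ (p + 2)).
  rw [← add_mul, ← ENNReal.ofReal_add (by positivity) (by positivity), ← mul_assoc,
    ← ENNReal.ofReal_mul (by positivity)]
  congr 2
  field_simp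
  ring

/-- Convex non-decreasing functions of `u` stay in the parabolic space. -/
theorem ClassAPlus.parabolicSpace_comp (hu : ClassAPlus E p γ u) (hEo : IsOpen E) (hγ : 0 < γ)
    (hp : 1 ≤ p) {φ : ℝ → ℝ} (hc : ConvexOn ℝ univ φ) (hm : Monotone φ) :
    ParabolicSpace E p (fun z => φ (u z)) := by
  have hp0 : 0 < p := by linarith
  have hp1 : (1 : ℝ≥0∞) ≤ ENNReal.ofReal p := by simpa using hp
  refine ⟨hm.measurable.comp_aemeasurable hu.1.1, fun y s R T hR hT hE => ?_⟩
  obtain ⟨M, hM⟩ := hu.exists_ae_le hEo hγ hp hR hT hE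
  obtain ⟨⟨hsm, hess⟩, hLp, G, hG, hGp⟩ := hu.1.2 y s R T hR hT hE
  obtain ⟨L, hL⟩ := exists_lipschitzWith_comp_min hc hm M
  set K : ℝ := |φ (min 0 M)| with hK
  -- Below M the function φ is Lipschitz, so it grows at most linearly towards -∞. The outer norm on
  -- the right matches the form of the L^p comparison lemmas.
  have hbound : ∀ r ≤ M, ‖φ r‖ ≤ ‖K + L * ‖r‖‖ := by
    intro r hr
    have h1 := hL.dist_le_mul r 0
    simp only [min_eq_left hr, dist_eq_norm, sub_zero] at h1
    rw [Real.norm_of_nonneg (r := K + L * ‖r‖) (by positivity)]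
    calc ‖φ r‖ = ‖φ (min 0 M) + (φ r - φ (min 0 M))‖ := by rw [add_sub_cancel]
      _ ≤ K + ‖φ r - φ (min 0 M)‖ := norm_add_le _ _
      _ ≤ _ := by gcongr
  have hcubefin : IsFiniteMeasure (volume.restrict (cube y R)) :=
    ⟨by simpa using volume_cube_lt_top y R⟩
  have hcylfin : IsFiniteMeasure ((volume : Measure (EuclideanSpace ℝ (Fin N) × ℝ)).restrict
      (parCylinder y s R T)) := by
    refine ⟨?_⟩
    rw [Measure.restrict_apply_univ, parCylinder, Measure.volume_eq_prod, Measure.prod_prod,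
      Real.volume_Ioc]
    exact ENNReal.mul_lt_top (volume_cube_lt_top y R) ENNReal.ofReal_lt_top
  have hφsm : AEStronglyMeasurable (fun z => φ (u z)) (volume.restrict (parCylinder y s R T)) :=
    (hm.measurable.comp_aemeasurable hsm.aemeasurable).aestronglyMeasurable
  refine ⟨⟨hφsm, ?_⟩, ?_, fun z => leftSlope φ (u z) • G z,
    hG.comp_convex hsm.aemeasurable hM hc hm, ?_⟩
  · set S := essSup (fun t => eLpNorm (fun x => u (x, t)) (ENNReal.ofReal p)
      (volume.restrict (cube y R))) (volume.restrict (Ioo (s - T) s)) with hS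
    refine lt_of_le_of_lt (essSup_le_of_ae_le (eLpNorm (fun _ : EuclideanSpace ℝ (Fin N) => K)
      (ENNReal.ofReal p) (volume.restrict (cube y R)) + ‖(L : ℝ)‖ₑ * S) ?_) ?_
    · filter_upwards [ae_ae_of_ae_parCylinder hM, hG.2,
        ENNReal.ae_le_essSup (μ := volume.restrict (Ioo (s - T) s)) (fun t =>
          eLpNorm (fun x => u (x, t)) (ENNReal.ofReal p) (volume.restrict (cube y R)))]
        with t htM hw htS
      have hwm := hw.1.aestronglyMeasurable
      calc eLpNorm (fun x => φ (u (x, t))) (ENNReal.ofReal p) (volume.restrict (cube y R))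
          ≤ eLpNorm ((fun _ => K) + fun x => (L : ℝ) * ‖u (x, t)‖) (ENNReal.ofReal p)
            (volume.restrict (cube y R)) := eLpNorm_mono_ae (htM.mono fun x hx => hbound _ hx)
        _ ≤ eLpNorm (fun _ => K) (ENNReal.ofReal p) (volume.restrict (cube y R)) +
            eLpNorm (fun x => (L : ℝ) * ‖u (x, t)‖) (ENNReal.ofReal p)
            (volume.restrict (cube y R)) :=
            eLpNorm_add_le aestronglyMeasurable_const (hwm.norm.const_mul _) hp1
        _ ≤ _ := by
            refine add_le_add_right ?_ _
            refine (eLpNorm_const_smul (L : ℝ) (fun x => ‖u (x, t)‖) _ _).le.trans ?_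
            rw [eLpNorm_norm]
            exact mul_le_mul_right htS _
    · exact ENNReal.add_lt_top.2 ⟨(memLp_const K).2, ENNReal.mul_lt_top enorm_lt_top hess⟩
  · exact ((memLp_const K).add (hLp.norm.const_mul (L : ℝ))).of_le hφsm
      (hM.mono fun z hz => hbound _ hz)
  · refine hGp.of_le_mul (c := leftSlope φ M)
      ((((measurable_leftSlope hc).comp_aemeasurable hsm.aemeasurable).aestronglyMeasurable).smul
        hG.1) (hM.mono fun z hz => ?_)
    rw [norm_smul, Real.norm_of_nonneg (leftSlope_nonneg hc hm _)]
    gcongr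
    exact leftSlope_mono hc hz

end Composition

end ParabolicDeGiorgi

/-! ### The main theorem. -/

theorem lemma3p1 (N : ℕ) (hN : 1 ≤ N) (p : ℝ) (hp : 1 < p) (γ : ℝ) (hγ : 0 < γ) :
    ∃ A : ℝ → ℝ → ℝ → ℝ → ℝ, ParabolicDeGiorgi.IsHomogeneousQuantity p A ∧
      ∀ E : Set (EuclideanSpace ℝ (Fin N) × ℝ), IsOpen E →
      ∀ φ : ℝ → ℝ, ConvexOn ℝ Set.univ φ → Monotone φ →
      ∀ u : EuclideanSpace ℝ (Fin N) × ℝ → ℝ, ParabolicDeGiorgi.ClassAPlus E p γ u →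
        ParabolicDeGiorgi.GeneralizedClassAPlus E p A (fun z => φ (u z)) := by
  refine ⟨fun _ _ _ _ => 4 ^ p * (1 + γ * (p + 2)), ⟨fun _ _ _ _ _ _ _ _ => by positivity,
    fun _ _ => 4 ^ p * (1 + γ * (p + 2)), fun _ _ _ _ _ _ _ _ _ _ => rfl⟩, ?_⟩
  intro E hE φ hφ hφm u hu
  exact ⟨hu.parabolicSpace_comp hE hγ hp.le hφ hφm,
    fun y s R T ρ τ k hρ hρR hτ hτT hc =>
      hu.energyIneqPlus_comp hE hγ hp.le hφ hφm hρ hρR hτ hτT hc k⟩
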